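/- **Fubini's rule II for lax ends.** Conventions. "2-category" and "2-functor" mean strict ones, $\mathcal A^{op}$ reverses 1-cells only, and $\mathrm{Cat}$ is the 2-category of categories. *Lax ends.* Let $\mathcal X$ be a 2-category and $S:\mathcal X^{op}\times\mathcal X\to\mathrm{Cat}$ a 2-functor. A lax wedge from a category $C$ to $S$ consists of functors $\sigma_x:C\to S(x,x)$ and natural transformations $\sigma_f:S(1,f)\sigma_x\Rightarrow S(f,1)\sigma_{y}$ for $f:x\to y$, such that $\sigma_{1}=1$; $(S(\alpha,1)\sigma_y)\circ\sigma_f=\sigma_{f'}\circ (S(1,\alpha)\sigma_x)$ for every 2-cell $\alpha:f\Rightarrow f'$; and $\sigma_{gf}=(S(f,1)\sigma_g)\circ(S(1,g)\sigma_f)$ for composable $f,g$. The lax end $\int_{x}S(x,x)$ is the category that carries the universal lax wedge, for wedges and for their modifications. Explicitly, its objects are the lax wedges from the terminal category, that is, families $(s_x\in S(x,x),\ s_f:S(1,f)s_x\to S(f,1)s_y)$ satisfying these equations, and its morphisms are the families $t_x:s_x\to s'_x$ with $s'_f\circ S(1,f)t_x=S(f,1)t_y\circ s_f$. *Gray tensor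 products.* An $\mathcal F$-category is a 2-category with a class of tight 1-cells that contains the identities and is closed under composition. For $\mathcal F$-categories $\mathcal X,\mathcal Y$ the 2-category $\mathcal X\otimes_{s,l}\mathcal Y$ has objects the pairs $(x,y)$. It is generated by 1-cells $(f,1)$ and $(1,g)$, by 2-cells $(\alpha,1)$ and $(1,\beta)$, which compose as in $\mathcal X$ and in $\mathcal Y$, and by 2-cells $\Sigma_{f,g}:(1,g)\circ(f,1)\Rightarrow(f,1)\circ(1,g)$ for $f$ in $\mathcal X$ and $g$ in $\mathcal Y$. The $\Sigma_{f,g}$ are natural in 2-cells of each variable, compatible with composition in each variable, and identities as soon as $f$ or $g$ is tight. The lax Gray tensor product $\mathcal A\otimes_l\mathcal B$ of two 2-categories is the case where only identities are tight. Sending every $\Sigma$ to an identity gives a quotient 2-functor $\mathcal A\otimes_l\mathcal B\to\mathcal A\times\mathcal B$. Let $\mathrm{Fun}_{s,l}(\mathcal X,\mathrm{Cat})$ be the 2-category of 2-functors, lax natural transformations that are strict on tight 1-cells, and modifications. Every 2-functor $\mathcal X\otimes_{s,l}\mathcal Y\to\mathrm{Cat}$ has a transpose $\mathcal X\to\mathrm{Fun}_{s,l}(\mathcal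 Y,\mathrm{Cat})$. **Statement.** Let $\mathcal A,\mathcal B$ be 2-categories and $T:\mathcal A^{op}\times\mathcal B^{op}\times(\mathcal A\otimes_l\mathcal B)\to\mathrm{Cat}$ a 2-functor. (i) *Two-variable lax end.* Let $\int_{a,b}T(a,b,a,b)$ be the lax end over $\mathcal X=\mathcal A\otimes_l\mathcal B$ of the composite of $T$ with $(\mathcal A\otimes_l\mathcal B)^{op}\times(\mathcal A\otimes_l\mathcal B)\to\mathcal A^{op}\times\mathcal B^{op}\times(\mathcal A\otimes_l\mathcal B)$, the quotient 2-functor in the contravariant variable. (ii) *Iterated lax end.* Regard $\mathcal A^{op}\times\mathcal A$ and $\mathcal B^{op}\times\mathcal B$ as $\mathcal F$-categories whose tight 1-cells are those of the form $(f,1)$. Exchanging the two middle factors is a 2-functor $j:(\mathcal A^{op}\times\mathcal A)\otimes_{s,l}(\mathcal B^{op}\times\mathcal B)\to\mathcal A^{op}\times\mathcal B^{op}\times(\mathcal A\otimes_l\mathcal B)$, so $T\circ j$ has a transpose $\widehat T:\mathcal A^{op}\times\mathcal A\to\mathrm{Fun}_{s,l}(\mathcal B^{op}\times\mathcal B,\mathrm{Cat})$,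 $(a,a')\mapsto T(a,-,a',-)$. The lax end over $\mathcal B$ is a 2-functor $\int_b:\mathrm{Fun}_{s,l}(\mathcal B^{op}\times\mathcal B,\mathrm{Cat})\to\mathrm{Cat}$: a 1-cell $\eta:S\to S'$ sends $(s_b,s_g)$ to the object with components $\eta_{b,b}(s_b)$ and with cell at $g:b\to b'$ the lax naturality cell of $\eta$ at $(1,g)$ and $s_b$, followed by $\eta_{b,b'}(s_g)$, where $\eta_{b,b'}S(g,1)=S'(g,1)\eta_{b',b'}$. Let $\int_a\int_bT(a,b,a,b)$ be the lax end over $\mathcal A$ of $\int_b\circ\,\widehat T:\mathcal A^{op}\times\mathcal A\to\mathrm{Cat}$. Then there is an isomorphism of categories $$\int_{a,b}T(a,b,a,b)\;\cong\;\int_a\int_b T(a,b,a,b)$$ that commutes with the projections to $T(a,b,a,b)$ for all objects $a$ of $\mathcal A$ and $b$ of $\mathcal B$. -/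

import Mathlib

universe w₁ v₁ u₁ w₂ v₂ u₂ w₃ v₃ u₃ w₄ v₄ u₄

open CategoryTheory Bicategory Opposite

namespace LaxFubini

/-- The structure of an `F`-category on a 2-category `X`: a class of tight 1-cells, which contains
the identities and is closed under composition. -/
structure FStr (X : Type u₁) [Bicategory.{w₁, v₁} X] where
  Tight : ∀ {x y : X}, (x ⟶ y) → Prop
  tight_id : ∀ x : X, Tight (𝟙 x)
  tight_comp : ∀ {x y z : X} {f : x ⟶ y} {g : y ⟶ z}, Tight f → Tight g → Tight (f ≫ g)

/-- The semi-strict lax Gray tensor product of two `F`-categories `(X, P)` and `(Y, Q)`. Its objects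
are the pairs `(x, y)`. Its 1-cells are generated by the `(f, 1)` and the `(1, g)`, and its 2-cells by
the `(α, 1)`, the `(1, β)` and the Gray cells `Σ : (1, g) ∘ (f, 1) ⟶ (f, 1) ∘ (1, g)`, subject to the
relations below; `Σ` is an identity as soon as `f` or `g` is tight. -/
@[ext]
structure Gray {X : Type u₁} [Bicategory.{w₁, v₁} X] {Y : Type u₂} [Bicategory.{w₂, v₂} Y]
    (P : FStr X) (Q : FStr Y) where
  fst : X
  snd : Y

namespace Gray

section
variable {X : Type u₁} [Bicategory.{w₁, v₁} X] {Y : Type u₂} [Bicategory.{w₂, v₂} Y]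
  (P : FStr X) (Q : FStr Y)

/-- Formal composites of the 1-cells `(f, 1)` and `(1, g)`. -/
inductive Path : Gray P Q → Gray P Q → Type (max u₁ u₂ v₁ v₂)
  | nil (p : Gray P Q) : Path p p
  | left {x x' : X} (f : x ⟶ x') (y : Y) : Path ⟨x, y⟩ ⟨x', y⟩
  | right (x : X) {y y' : Y} (g : y ⟶ y') : Path ⟨x, y⟩ ⟨x, y'⟩
  | comp {p q r : Gray P Q} (s : Path p q) (t : Path q r) : Path p r

variable {P Q}
/-- The relations between the 1-cells. -/
inductive PathRel : ∀ {p q : Gray P Q}, Path P Q p q → Path P Q p q → Prop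
  | comp_left {p q r : Gray P Q} {s s' : Path P Q p q} (t : Path P Q q r) (h : PathRel s s') :
      PathRel (s.comp t) (s'.comp t)
  | comp_right {p q r : Gray P Q} (s : Path P Q p q) {t t' : Path P Q q r} (h : PathRel t t') :
      PathRel (s.comp t) (s.comp t')
  | nil_comp {p q : Gray P Q} (s : Path P Q p q) : PathRel ((Path.nil p).comp s) s
  | comp_nil {p q : Gray P Q} (s : Path P Q p q) : PathRel (s.comp (Path.nil q)) s
  | assoc {p q r t : Gray P Q} (f : Path P Q p q) (g : Path P Q q r) (h : Path P Q r t) :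
      PathRel ((f.comp g).comp h) (f.comp (g.comp h))
  | left_id (x : X) (y : Y) : PathRel (Path.left (𝟙 x) y) (Path.nil ⟨x, y⟩)
  | left_comp {x x' x'' : X} (f : x ⟶ x') (f' : x' ⟶ x'') (y : Y) :
      PathRel (Path.left (f ≫ f') y) ((Path.left f y).comp (Path.left f' y))
  | right_id (x : X) (y : Y) : PathRel (Path.right x (𝟙 y)) (Path.nil ⟨x, y⟩)
  | right_comp (x : X) {y y' y'' : Y} (g : y ⟶ y') (g' : y' ⟶ y'') :
      PathRel (Path.right x (g ≫ g')) ((Path.right x g).comp (Path.right x g'))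
  | tight {x x' : X} (f : x ⟶ x') {y y' : Y} (g : y ⟶ y') (h : P.Tight f ∨ Q.Tight g) :
      PathRel ((Path.left f y).comp (Path.right x' g)) ((Path.right x g).comp (Path.left f y'))

instance : CategoryStruct (Gray P Q) where
  Hom p q := Quot (PathRel (p := p) (q := q))
  id p := Quot.mk _ (Path.nil p)
  comp s t := Quot.map₂ Path.comp (fun s _ _ h => PathRel.comp_right s h)
    (fun _ _ t h => PathRel.comp_left t h) s t

variable (P Q) in
/-- The 1-cell `(f, 1)`. -/
def inl {x x' : X} (f : x ⟶ x') (y : Y) : (⟨x, y⟩ : Gray P Q) ⟶ ⟨x', y⟩ := Quot.mk _ (.left f y)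

variable (P Q) in
/-- The 1-cell `(1, g)`. -/
def inr (x : X) {y y' : Y} (g : y ⟶ y') : (⟨x, y⟩ : Gray P Q) ⟶ ⟨x, y'⟩ := Quot.mk _ (.right x g)

theorem id_comp' {p q : Gray P Q} (s : p ⟶ q) : 𝟙 p ≫ s = s :=
  Quot.inductionOn s fun s => Quot.sound (.nil_comp s)

theorem comp_id' {p q : Gray P Q} (s : p ⟶ q) : s ≫ 𝟙 q = s :=
  Quot.inductionOn s fun s => Quot.sound (.comp_nil s)

theorem assoc' {p q r t : Gray P Q} (f : p ⟶ q) (g : q ⟶ r) (h : r ⟶ t) :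
    (f ≫ g) ≫ h = f ≫ g ≫ h :=
  Quot.inductionOn f fun f => Quot.inductionOn g fun g => Quot.inductionOn h fun h =>
    Quot.sound (.assoc f g h)

theorem inl_id (x : X) (y : Y) : inl P Q (𝟙 x) y = 𝟙 _ := Quot.sound (.left_id x y)

theorem inl_comp {x x' x'' : X} (f : x ⟶ x') (f' : x' ⟶ x'') (y : Y) :
    inl P Q (f ≫ f') y = inl P Q f y ≫ inl P Q f' y := Quot.sound (.left_comp f f' y)

theorem inr_id (x : X) (y : Y) : inr P Q x (𝟙 y) = 𝟙 _ := Quot.sound (.right_id x y)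

theorem inr_comp (x : X) {y y' y'' : Y} (g : y ⟶ y') (g' : y' ⟶ y'') :
    inr P Q x (g ≫ g') = inr P Q x g ≫ inr P Q x g' := Quot.sound (.right_comp x g g')

theorem inl_inr {x x' : X} (f : x ⟶ x') {y y' : Y} (g : y ⟶ y') (h : P.Tight f ∨ Q.Tight g) :
    inl P Q f y ≫ inr P Q x' g = inr P Q x g ≫ inl P Q f y' := Quot.sound (.tight f g h)

variable (P Q) in
/-- Formal composites of the 2-cells `(α, 1)`, `(1, β)` and `Σ`. -/
inductive Cell : ∀ {p q : Gray P Q}, (p ⟶ q) → (p ⟶ q) → Type (max u₁ u₂ v₁ v₂ w₁ w₂)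
  | id {p q : Gray P Q} (f : p ⟶ q) : Cell f f
  | comp {p q : Gray P Q} {f g h : p ⟶ q} (η : Cell f g) (θ : Cell g h) : Cell f h
  | whiskerLeft {p q r : Gray P Q} (f : p ⟶ q) {g h : q ⟶ r} (η : Cell g h) :
      Cell (f ≫ g) (f ≫ h)
  | whiskerRight {p q r : Gray P Q} {f g : p ⟶ q} (η : Cell f g) (h : q ⟶ r) :
      Cell (f ≫ h) (g ≫ h)
  | left {x x' : X} {f f' : x ⟶ x'} (α : f ⟶ f') (y : Y) : Cell (inl P Q f y) (inl P Q f' y)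
  | right (x : X) {y y' : Y} {g g' : y ⟶ y'} (β : g ⟶ g') : Cell (inr P Q x g) (inr P Q x g')
  | sigma {x x' : X} (f : x ⟶ x') {y y' : Y} (g : y ⟶ y') :
      Cell (inl P Q f y ≫ inr P Q x' g) (inr P Q x g ≫ inl P Q f y')

/-- The identity 2-cell between equal 1-cells. -/
def Cell.ofEq {p q : Gray P Q} {f g : p ⟶ q} (h : f = g) : Cell P Q f g := h ▸ Cell.id f

/-- The relations between the 2-cells. -/
inductive CellRel : ∀ {p q : Gray P Q} {f g : p ⟶ q}, Cell P Q f g → Cell P Q f g → Prop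
  | comp_left {p q : Gray P Q} {f g h : p ⟶ q} {η η' : Cell P Q f g} (θ : Cell P Q g h)
      (r : CellRel η η') : CellRel (η.comp θ) (η'.comp θ)
  | comp_right {p q : Gray P Q} {f g h : p ⟶ q} (η : Cell P Q f g) {θ θ' : Cell P Q g h}
      (r : CellRel θ θ') : CellRel (η.comp θ) (η.comp θ')
  | whiskerLeft_congr {p q r : Gray P Q} (f : p ⟶ q) {g h : q ⟶ r} {η η' : Cell P Q g h}
      (r : CellRel η η') : CellRel (η.whiskerLeft f) (η'.whiskerLeft f)
  | whiskerRight_congr {p q r : Gray P Q} {f g : p ⟶ q} {η η' : Cell P Q f g} (h : q ⟶ r)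
      (r : CellRel η η') : CellRel (η.whiskerRight h) (η'.whiskerRight h)
  -- the 2-cells between two fixed objects form a category
  | id_comp {p q : Gray P Q} {f g : p ⟶ q} (η : Cell P Q f g) : CellRel ((Cell.id f).comp η) η
  | comp_id {p q : Gray P Q} {f g : p ⟶ q} (η : Cell P Q f g) : CellRel (η.comp (Cell.id g)) η
  | assoc {p q : Gray P Q} {f g h i : p ⟶ q} (η : Cell P Q f g) (θ : Cell P Q g h)
      (κ : Cell P Q h i) : CellRel ((η.comp θ).comp κ) (η.comp (θ.comp κ))
  -- whiskering makes this a strict 2-category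
  | whiskerLeft_id {p q r : Gray P Q} (f : p ⟶ q) (g : q ⟶ r) :
      CellRel ((Cell.id g).whiskerLeft f) (Cell.id (f ≫ g))
  | whiskerLeft_comp {p q r : Gray P Q} (f : p ⟶ q) {g h i : q ⟶ r} (η : Cell P Q g h)
      (θ : Cell P Q h i) :
      CellRel ((η.comp θ).whiskerLeft f) ((η.whiskerLeft f).comp (θ.whiskerLeft f))
  | id_whiskerLeft {p q : Gray P Q} {f g : p ⟶ q} (η : Cell P Q f g) :
      CellRel (η.whiskerLeft (𝟙 p))
        ((Cell.ofEq (id_comp' f)).comp (η.comp (Cell.ofEq (id_comp' g).symm)))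
  | comp_whiskerLeft {p q r s : Gray P Q} (f : p ⟶ q) (g : q ⟶ r) {h i : r ⟶ s}
      (η : Cell P Q h i) :
      CellRel (η.whiskerLeft (f ≫ g)) ((Cell.ofEq (assoc' f g h)).comp
        (((η.whiskerLeft g).whiskerLeft f).comp (Cell.ofEq (assoc' f g i).symm)))
  | id_whiskerRight {p q r : Gray P Q} (f : p ⟶ q) (g : q ⟶ r) :
      CellRel ((Cell.id f).whiskerRight g) (Cell.id (f ≫ g))
  | comp_whiskerRight {p q r : Gray P Q} {f g h : p ⟶ q} (η : Cell P Q f g) (θ : Cell P Q g h)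
      (i : q ⟶ r) :
      CellRel ((η.comp θ).whiskerRight i) ((η.whiskerRight i).comp (θ.whiskerRight i))
  | whiskerRight_id {p q : Gray P Q} {f g : p ⟶ q} (η : Cell P Q f g) :
      CellRel (η.whiskerRight (𝟙 q))
        ((Cell.ofEq (comp_id' f)).comp (η.comp (Cell.ofEq (comp_id' g).symm)))
  | whiskerRight_comp {p q r s : Gray P Q} {f g : p ⟶ q} (η : Cell P Q f g) (h : q ⟶ r)
      (i : r ⟶ s) :
      CellRel (η.whiskerRight (h ≫ i)) ((Cell.ofEq (assoc' f h i).symm).comp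
        (((η.whiskerRight h).whiskerRight i).comp (Cell.ofEq (assoc' g h i))))
  | whisker_assoc {p q r s : Gray P Q} (f : p ⟶ q) {g h : q ⟶ r} (η : Cell P Q g h)
      (i : r ⟶ s) :
      CellRel ((η.whiskerLeft f).whiskerRight i) ((Cell.ofEq (assoc' f g i)).comp
        (((η.whiskerRight i).whiskerLeft f).comp (Cell.ofEq (assoc' f h i).symm)))
  | whisker_exchange {p q r : Gray P Q} {f g : p ⟶ q} {h i : q ⟶ r} (η : Cell P Q f g)
      (θ : Cell P Q h i) :
      CellRel ((θ.whiskerLeft f).comp (η.whiskerRight i))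
        ((η.whiskerRight h).comp (θ.whiskerLeft g))
  -- the 2-cells `(α, 1)` and `(1, β)` compose as in the two factors
  | left_id {x x' : X} (f : x ⟶ x') (y : Y) :
      CellRel (Cell.left (𝟙 f) y) (Cell.id (inl P Q f y))
  | left_comp {x x' : X} {f f' f'' : x ⟶ x'} (α : f ⟶ f') (α' : f' ⟶ f'') (y : Y) :
      CellRel (Cell.left (α ≫ α') y) ((Cell.left α y).comp (Cell.left α' y))
  | left_whiskerLeft {x x' x'' : X} (f : x ⟶ x') {h h' : x' ⟶ x''} (α : h ⟶ h') (y : Y) :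
      CellRel (Cell.left (f ◁ α) y) ((Cell.ofEq (inl_comp f h y)).comp
        (((Cell.left α y).whiskerLeft (inl P Q f y)).comp (Cell.ofEq (inl_comp f h' y).symm)))
  | left_whiskerRight {x x' x'' : X} {f f' : x ⟶ x'} (α : f ⟶ f') (h : x' ⟶ x'') (y : Y) :
      CellRel (Cell.left (α ▷ h) y) ((Cell.ofEq (inl_comp f h y)).comp
        (((Cell.left α y).whiskerRight (inl P Q h y)).comp (Cell.ofEq (inl_comp f' h y).symm)))
  | right_id (x : X) {y y' : Y} (g : y ⟶ y') :
      CellRel (Cell.right x (𝟙 g)) (Cell.id (inr P Q x g))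
  | right_comp (x : X) {y y' : Y} {g g' g'' : y ⟶ y'} (β : g ⟶ g') (β' : g' ⟶ g'') :
      CellRel (Cell.right x (β ≫ β')) ((Cell.right x β).comp (Cell.right x β'))
  | right_whiskerLeft (x : X) {y y' y'' : Y} (g : y ⟶ y') {h h' : y' ⟶ y''} (β : h ⟶ h') :
      CellRel (Cell.right x (g ◁ β)) ((Cell.ofEq (inr_comp x g h)).comp
        (((Cell.right x β).whiskerLeft (inr P Q x g)).comp (Cell.ofEq (inr_comp x g h').symm)))
  | right_whiskerRight (x : X) {y y' y'' : Y} {g g' : y ⟶ y'} (β : g ⟶ g') (h : y' ⟶ y'') :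
      CellRel (Cell.right x (β ▷ h)) ((Cell.ofEq (inr_comp x g h)).comp
        (((Cell.right x β).whiskerRight (inr P Q x h)).comp (Cell.ofEq (inr_comp x g' h).symm)))
  -- coherence of the Gray cells
  | sigma_left {x x' : X} {f f' : x ⟶ x'} (α : f ⟶ f') {y y' : Y} (g : y ⟶ y') :
      CellRel (((Cell.left α y).whiskerRight (inr P Q x' g)).comp (Cell.sigma f' g))
        ((Cell.sigma f g).comp ((Cell.left α y').whiskerLeft (inr P Q x g)))
  | sigma_right {x x' : X} (f : x ⟶ x') {y y' : Y} {g g' : y ⟶ y'} (β : g ⟶ g') :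
      CellRel (((Cell.right x' β).whiskerLeft (inl P Q f y)).comp (Cell.sigma f g'))
        ((Cell.sigma f g).comp ((Cell.right x β).whiskerRight (inl P Q f y')))
  | sigma_comp_left {x x' x'' : X} (f : x ⟶ x') (f' : x' ⟶ x'') {y y' : Y} (g : y ⟶ y') :
      CellRel (Cell.sigma (f ≫ f') g)
        ((Cell.ofEq (by rw [inl_comp, assoc'])).comp
          (((Cell.sigma f' g).whiskerLeft (inl P Q f y)).comp
            ((Cell.ofEq (assoc' _ _ _).symm).comp
              (((Cell.sigma f g).whiskerRight (inl P Q f' y')).comp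
                (Cell.ofEq (by rw [inl_comp, assoc']))))))
  | sigma_comp_right {x x' : X} (f : x ⟶ x') {y y' y'' : Y} (g : y ⟶ y') (g' : y' ⟶ y'') :
      CellRel (Cell.sigma f (g ≫ g'))
        ((Cell.ofEq (by rw [inr_comp, assoc'])).comp
          (((Cell.sigma f g).whiskerRight (inr P Q x' g')).comp
            ((Cell.ofEq (assoc' _ _ _)).comp
              (((Cell.sigma f g').whiskerLeft (inr P Q x g)).comp
                (Cell.ofEq (by rw [inr_comp, assoc']))))))
  | sigma_tight {x x' : X} (f : x ⟶ x') {y y' : Y} (g : y ⟶ y') (h : P.Tight f ∨ Q.Tight g) :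
      CellRel (Cell.sigma f g) (Cell.ofEq (inl_inr f g h))

instance homCategory (p q : Gray P Q) : Category (p ⟶ q) where
  Hom f g := Quot (CellRel (P := P) (Q := Q) (f := f) (g := g))
  id f := Quot.mk _ (Cell.id f)
  comp η θ := Quot.map₂ Cell.comp (fun η _ _ h => CellRel.comp_right η h)
    (fun _ _ θ h => CellRel.comp_left θ h) η θ
  id_comp η := Quot.inductionOn η fun η => Quot.sound (.id_comp η)
  comp_id η := Quot.inductionOn η fun η => Quot.sound (.comp_id η)
  assoc η θ κ := Quot.inductionOn η fun η => Quot.inductionOn θ fun θ =>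
    Quot.inductionOn κ fun κ => Quot.sound (.assoc η θ κ)

theorem mk_ofEq {p q : Gray P Q} {f g : p ⟶ q} (h : f = g) :
    (Quot.mk _ (Cell.ofEq h) : f ⟶ g) = eqToHom h := by
  cases h; rfl

/-- Left whiskering in the Gray tensor product. -/
def wL {p q r : Gray P Q} (f : p ⟶ q) {g h : q ⟶ r} (η : g ⟶ h) : f ≫ g ⟶ f ≫ h :=
  Quot.map (Cell.whiskerLeft f) (fun _ _ r => .whiskerLeft_congr f r) η

/-- Right whiskering in the Gray tensor product. -/
def wR {p q r : Gray P Q} {f g : p ⟶ q} (η : f ⟶ g) (h : q ⟶ r) : f ≫ h ⟶ g ≫ h :=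
  Quot.map (fun η => Cell.whiskerRight η h) (fun _ _ r => .whiskerRight_congr h r) η

theorem wL_eqToHom {p q r : Gray P Q} (f : p ⟶ q) {g h : q ⟶ r} (e : g = h) :
    wL f (eqToHom e) = eqToHom (e ▸ rfl) := by
  cases e; exact Quot.sound (.whiskerLeft_id f g)

theorem wR_eqToHom {p q r : Gray P Q} {f g : p ⟶ q} (e : f = g) (h : q ⟶ r) :
    wR (eqToHom e) h = eqToHom (e ▸ rfl) := by
  cases e; exact Quot.sound (.id_whiskerRight f h)

instance bicategory : Bicategory (Gray P Q) where
  homCategory := homCategory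
  whiskerLeft f _ _ η := wL f η
  whiskerRight η h := wR η h
  associator f g h := eqToIso (assoc' f g h)
  leftUnitor f := eqToIso (id_comp' f)
  rightUnitor f := eqToIso (comp_id' f)
  whiskerLeft_id f g := Quot.sound (.whiskerLeft_id f g)
  whiskerLeft_comp f _ _ _ η θ := Quot.inductionOn η fun η => Quot.inductionOn θ fun θ =>
    Quot.sound (.whiskerLeft_comp f η θ)
  id_whiskerLeft η := by
    simp only [eqToIso.hom, eqToIso.inv, ← mk_ofEq]
    exact Quot.inductionOn η fun η => Quot.sound (.id_whiskerLeft η)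
  comp_whiskerLeft f g _ _ η := by
    simp only [eqToIso.hom, eqToIso.inv, ← mk_ofEq]
    exact Quot.inductionOn η fun η => Quot.sound (.comp_whiskerLeft f g η)
  id_whiskerRight f g := Quot.sound (.id_whiskerRight f g)
  comp_whiskerRight η θ i := Quot.inductionOn η fun η => Quot.inductionOn θ fun θ =>
    Quot.sound (.comp_whiskerRight η θ i)
  whiskerRight_id η := by
    simp only [eqToIso.hom, eqToIso.inv, ← mk_ofEq]
    exact Quot.inductionOn η fun η => Quot.sound (.whiskerRight_id η)
  whiskerRight_comp η g h := by
    simp only [eqToIso.hom, eqToIso.inv, ← mk_ofEq]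
    exact Quot.inductionOn η fun η => Quot.sound (.whiskerRight_comp η g h)
  whisker_assoc f _ _ η h := by
    simp only [eqToIso.hom, eqToIso.inv, ← mk_ofEq]
    exact Quot.inductionOn η fun η => Quot.sound (.whisker_assoc f η h)
  whisker_exchange η θ := Quot.inductionOn η fun η => Quot.inductionOn θ fun θ =>
    Quot.sound (.whisker_exchange η θ)
  pentagon f g h i := by simp [wL_eqToHom, wR_eqToHom]
  triangle f g := by simp [wL_eqToHom, wR_eqToHom]

instance : Bicategory.Strict (Gray P Q) where
  id_comp := id_comp'
  comp_id := comp_id'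
  assoc := assoc'
  leftUnitor_eqToIso _ := rfl
  rightUnitor_eqToIso _ := rfl
  associator_eqToIso _ _ _ := rfl

variable (P Q) in
/-- The 2-cell `(α, 1)`. -/
def inl₂ {x x' : X} {f f' : x ⟶ x'} (α : f ⟶ f') (y : Y) : inl P Q f y ⟶ inl P Q f' y :=
  Quot.mk _ (.left α y)

variable (P Q) in
/-- The 2-cell `(1, β)`. -/
def inr₂ (x : X) {y y' : Y} {g g' : y ⟶ y'} (β : g ⟶ g') : inr P Q x g ⟶ inr P Q x g' :=
  Quot.mk _ (.right x β)

variable (P Q) in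
/-- The Gray cell `Σ : (1, g) ∘ (f, 1) ⟶ (f, 1) ∘ (1, g)` (in diagrammatic order
`(f, 1) ≫ (1, g) ⟶ (1, g) ≫ (f, 1)`). -/
def gray {x x' : X} (f : x ⟶ x') {y y' : Y} (g : y ⟶ y') :
    inl P Q f y ≫ inr P Q x' g ⟶ inr P Q x g ≫ inl P Q f y' :=
  Quot.mk _ (.sigma f g)
end
end Gray

namespace Gray

section
variable {X : Type u₁} [Bicategory.{w₁, v₁} X] {Y : Type u₂} [Bicategory.{w₂, v₂} Y]
  (P : FStr X) (Q : FStr Y)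

theorem inl₂_id {x x' : X} (f : x ⟶ x') (y : Y) : inl₂ P Q (𝟙 f) y = 𝟙 _ :=
  Quot.sound (.left_id f y)

theorem inl₂_comp {x x' : X} {f f' f'' : x ⟶ x'} (α : f ⟶ f') (α' : f' ⟶ f'') (y : Y) :
    inl₂ P Q (α ≫ α') y = inl₂ P Q α y ≫ inl₂ P Q α' y := Quot.sound (.left_comp α α' y)

theorem inl₂_whiskerLeft {x x' x'' : X} (f : x ⟶ x') {h h' : x' ⟶ x''} (α : h ⟶ h') (y : Y) :
    inl₂ P Q (f ◁ α) y = eqToHom (inl_comp f h y) ≫ inl P Q f y ◁ inl₂ P Q α y ≫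
      eqToHom (inl_comp f h' y).symm := by
  rw [← mk_ofEq, ← mk_ofEq]; exact Quot.sound (.left_whiskerLeft f α y)

theorem inl₂_whiskerRight {x x' x'' : X} {f f' : x ⟶ x'} (α : f ⟶ f') (h : x' ⟶ x'') (y : Y) :
    inl₂ P Q (α ▷ h) y = eqToHom (inl_comp f h y) ≫ inl₂ P Q α y ▷ inl P Q h y ≫
      eqToHom (inl_comp f' h y).symm := by
  rw [← mk_ofEq, ← mk_ofEq]; exact Quot.sound (.left_whiskerRight α h y)

theorem inr₂_id (x : X) {y y' : Y} (g : y ⟶ y') : inr₂ P Q x (𝟙 g) = 𝟙 _ :=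
  Quot.sound (.right_id x g)

theorem inr₂_comp (x : X) {y y' : Y} {g g' g'' : y ⟶ y'} (β : g ⟶ g') (β' : g' ⟶ g'') :
    inr₂ P Q x (β ≫ β') = inr₂ P Q x β ≫ inr₂ P Q x β' := Quot.sound (.right_comp x β β')

theorem inr₂_whiskerLeft (x : X) {y y' y'' : Y} (g : y ⟶ y') {h h' : y' ⟶ y''} (β : h ⟶ h') :
    inr₂ P Q x (g ◁ β) = eqToHom (inr_comp x g h) ≫ inr P Q x g ◁ inr₂ P Q x β ≫
      eqToHom (inr_comp x g h').symm := by
  rw [← mk_ofEq, ← mk_ofEq]; exact Quot.sound (.right_whiskerLeft x g β)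

theorem inr₂_whiskerRight (x : X) {y y' y'' : Y} {g g' : y ⟶ y'} (β : g ⟶ g') (h : y' ⟶ y'') :
    inr₂ P Q x (β ▷ h) = eqToHom (inr_comp x g h) ≫ inr₂ P Q x β ▷ inr P Q x h ≫
      eqToHom (inr_comp x g' h).symm := by
  rw [← mk_ofEq, ← mk_ofEq]; exact Quot.sound (.right_whiskerRight x β h)

theorem gray_left {x x' : X} {f f' : x ⟶ x'} (α : f ⟶ f') {y y' : Y} (g : y ⟶ y') :
    inl₂ P Q α y ▷ inr P Q x' g ≫ gray P Q f' g =
      gray P Q f g ≫ inr P Q x g ◁ inl₂ P Q α y' := Quot.sound (.sigma_left α g)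

theorem gray_right {x x' : X} (f : x ⟶ x') {y y' : Y} {g g' : y ⟶ y'} (β : g ⟶ g') :
    inl P Q f y ◁ inr₂ P Q x' β ≫ gray P Q f g' =
      gray P Q f g ≫ inr₂ P Q x β ▷ inl P Q f y' := Quot.sound (.sigma_right f β)

theorem gray_comp_left {x x' x'' : X} (f : x ⟶ x') (f' : x' ⟶ x'') {y y' : Y} (g : y ⟶ y') :
    gray P Q (f ≫ f') g =
      eqToHom (by rw [inl_comp, assoc']) ≫ inl P Q f y ◁ gray P Q f' g ≫
        eqToHom (assoc' _ _ _).symm ≫ gray P Q f g ▷ inl P Q f' y' ≫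
          eqToHom (by rw [inl_comp, assoc']) := by
  simp only [← mk_ofEq]; exact Quot.sound (.sigma_comp_left f f' g)

theorem gray_comp_right {x x' : X} (f : x ⟶ x') {y y' y'' : Y} (g : y ⟶ y') (g' : y' ⟶ y'') :
    gray P Q f (g ≫ g') =
      eqToHom (by rw [inr_comp, assoc']) ≫ gray P Q f g ▷ inr P Q x' g' ≫
        eqToHom (assoc' _ _ _) ≫ inr P Q x g ◁ gray P Q f g' ≫
          eqToHom (by rw [inr_comp, assoc']) := by
  simp only [← mk_ofEq]; exact Quot.sound (.sigma_comp_right f g g')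

theorem gray_tight {x x' : X} (f : x ⟶ x') {y y' : Y} (g : y ⟶ y')
    (h : P.Tight f ∨ Q.Tight g) : gray P Q f g = eqToHom (inl_inr f g h) := by
  rw [← mk_ofEq]; exact Quot.sound (.sigma_tight f g h)

/-- The data of a 2-functor out of a semi-strict Gray tensor product. -/
structure Bifunctor (C : Type u₃) [Bicategory.{w₃, v₃} C] where
  obj : X → Y → C
  mapL : ∀ {x x' : X} (_ : x ⟶ x') (y : Y), obj x y ⟶ obj x' y
  mapR : ∀ (x : X) {y y' : Y} (_ : y ⟶ y'), obj x y ⟶ obj x y'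
  mapL₂ : ∀ {x x' : X} {f f' : x ⟶ x'} (_ : f ⟶ f') (y : Y), mapL f y ⟶ mapL f' y
  mapR₂ : ∀ (x : X) {y y' : Y} {g g' : y ⟶ y'} (_ : g ⟶ g'), mapR x g ⟶ mapR x g'
  swap : ∀ {x x' : X} (f : x ⟶ x') {y y' : Y} (g : y ⟶ y'),
    mapL f y ≫ mapR x' g ⟶ mapR x g ≫ mapL f y'
  mapL_id : ∀ (x : X) (y : Y), mapL (𝟙 x) y = 𝟙 _
  mapL_comp : ∀ {x x' x'' : X} (f : x ⟶ x') (f' : x' ⟶ x'') (y : Y),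
    mapL (f ≫ f') y = mapL f y ≫ mapL f' y
  mapR_id : ∀ (x : X) (y : Y), mapR x (𝟙 y) = 𝟙 _
  mapR_comp : ∀ (x : X) {y y' y'' : Y} (g : y ⟶ y') (g' : y' ⟶ y''),
    mapR x (g ≫ g') = mapR x g ≫ mapR x g'
  mapL₂_id : ∀ {x x' : X} (f : x ⟶ x') (y : Y), mapL₂ (𝟙 f) y = 𝟙 _
  mapL₂_comp : ∀ {x x' : X} {f f' f'' : x ⟶ x'} (α : f ⟶ f') (α' : f' ⟶ f'') (y : Y),
    mapL₂ (α ≫ α') y = mapL₂ α y ≫ mapL₂ α' y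
  mapL₂_whiskerLeft : ∀ {x x' x'' : X} (f : x ⟶ x') {h h' : x' ⟶ x''} (α : h ⟶ h') (y : Y),
    mapL₂ (f ◁ α) y = eqToHom (mapL_comp f h y) ≫ mapL f y ◁ mapL₂ α y ≫
      eqToHom (mapL_comp f h' y).symm
  mapL₂_whiskerRight : ∀ {x x' x'' : X} {f f' : x ⟶ x'} (α : f ⟶ f') (h : x' ⟶ x'') (y : Y),
    mapL₂ (α ▷ h) y = eqToHom (mapL_comp f h y) ≫ mapL₂ α y ▷ mapL h y ≫
      eqToHom (mapL_comp f' h y).symm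
  mapR₂_id : ∀ (x : X) {y y' : Y} (g : y ⟶ y'), mapR₂ x (𝟙 g) = 𝟙 _
  mapR₂_comp : ∀ (x : X) {y y' : Y} {g g' g'' : y ⟶ y'} (β : g ⟶ g') (β' : g' ⟶ g''),
    mapR₂ x (β ≫ β') = mapR₂ x β ≫ mapR₂ x β'
  mapR₂_whiskerLeft : ∀ (x : X) {y y' y'' : Y} (g : y ⟶ y') {h h' : y' ⟶ y''} (β : h ⟶ h'),
    mapR₂ x (g ◁ β) = eqToHom (mapR_comp x g h) ≫ mapR x g ◁ mapR₂ x β ≫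
      eqToHom (mapR_comp x g h').symm
  mapR₂_whiskerRight : ∀ (x : X) {y y' y'' : Y} {g g' : y ⟶ y'} (β : g ⟶ g') (h : y' ⟶ y''),
    mapR₂ x (β ▷ h) = eqToHom (mapR_comp x g h) ≫ mapR₂ x β ▷ mapR x h ≫
      eqToHom (mapR_comp x g' h).symm
  swap_left : ∀ {x x' : X} {f f' : x ⟶ x'} (α : f ⟶ f') {y y' : Y} (g : y ⟶ y'),
    mapL₂ α y ▷ mapR x' g ≫ swap f' g = swap f g ≫ mapR x g ◁ mapL₂ α y'
  swap_right : ∀ {x x' : X} (f : x ⟶ x') {y y' : Y} {g g' : y ⟶ y'} (β : g ⟶ g'),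
    mapL f y ◁ mapR₂ x' β ≫ swap f g' = swap f g ≫ mapR₂ x β ▷ mapL f y'
  swap_comp_left : ∀ {x x' x'' : X} (f : x ⟶ x') (f' : x' ⟶ x'') {y y' : Y} (g : y ⟶ y'),
    swap (f ≫ f') g = eqToHom (mapL_comp f f' y) ▷ mapR x'' g ≫ (α_ _ _ _).hom ≫
      mapL f y ◁ swap f' g ≫ (α_ _ _ _).inv ≫ swap f g ▷ mapL f' y' ≫ (α_ _ _ _).hom ≫
        mapR x g ◁ eqToHom (mapL_comp f f' y').symm
  swap_comp_right : ∀ {x x' : X} (f : x ⟶ x') {y y' y'' : Y} (g : y ⟶ y') (g' : y' ⟶ y''),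
    swap f (g ≫ g') = mapL f y ◁ eqToHom (mapR_comp x' g g') ≫ (α_ _ _ _).inv ≫
      swap f g ▷ mapR x' g' ≫ (α_ _ _ _).hom ≫ mapR x g ◁ swap f g' ≫ (α_ _ _ _).inv ≫
        eqToHom (mapR_comp x g g').symm ▷ mapL f y''
  swap_tight : ∀ {x x' : X} (f : x ⟶ x') {y y' : Y} (g : y ⟶ y'), P.Tight f ∨ Q.Tight g →
    ∃ h : mapL f y ≫ mapR x' g = mapR x g ≫ mapL f y', swap f g = eqToHom h

namespace Bifunctor
variable {P Q} {C : Type u₃} [Bicategory.{w₃, v₃} C] [Strict C] (D : Bifunctor P Q C)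

/-- The value of `D` on a formal composite of 1-cells. -/
def evalPath : ∀ {p q : Gray P Q}, Path P Q p q → (D.obj p.fst p.snd ⟶ D.obj q.fst q.snd)
  | _, _, .nil _ => 𝟙 _
  | _, _, .left f y => D.mapL f y
  | _, _, .right x g => D.mapR x g
  | _, _, .comp s t => evalPath s ≫ evalPath t

theorem evalPath_rel {p q : Gray P Q} {s t : Path P Q p q} (h : PathRel s t) :
    D.evalPath s = D.evalPath t := by
  induction h with
  | comp_left t h ih => simp only [evalPath, ih]
  | comp_right s h ih => simp only [evalPath, ih]
  | nil_comp s => exact Strict.id_comp _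
  | comp_nil s => exact Strict.comp_id _
  | assoc f g h => exact Strict.assoc _ _ _
  | left_id x y => exact D.mapL_id x y
  | left_comp f f' y => exact D.mapL_comp f f' y
  | right_id x y => exact D.mapR_id x y
  | right_comp x g g' => exact D.mapR_comp x g g'
  | tight f g h => exact (D.swap_tight f g h).1

/-- The value of `D` on a 1-cell. -/
def evalHom {p q : Gray P Q} (s : p ⟶ q) : D.obj p.fst p.snd ⟶ D.obj q.fst q.snd :=
  Quot.lift D.evalPath (fun _ _ h => D.evalPath_rel h) s

theorem evalHom_comp {p q r : Gray P Q} (s : p ⟶ q) (t : q ⟶ r) :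
    D.evalHom (s ≫ t) = D.evalHom s ≫ D.evalHom t :=
  Quot.inductionOn s fun _ => Quot.inductionOn t fun _ => rfl

/-- The value of `D` on a formal composite of 2-cells. -/
def evalCell : ∀ {p q : Gray P Q} {s t : p ⟶ q}, Cell P Q s t → (D.evalHom s ⟶ D.evalHom t)
  | _, _, _, _, .id s => 𝟙 (D.evalHom s)
  | _, _, _, _, .comp η θ => evalCell η ≫ evalCell θ
  | _, _, _, _, .whiskerLeft f η =>
      eqToHom (D.evalHom_comp _ _) ≫ D.evalHom f ◁ evalCell η ≫ eqToHom (D.evalHom_comp _ _).symm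
  | _, _, _, _, .whiskerRight η h =>
      eqToHom (D.evalHom_comp _ _) ≫ evalCell η ▷ D.evalHom h ≫ eqToHom (D.evalHom_comp _ _).symm
  | _, _, _, _, .left α y => D.mapL₂ α y
  | _, _, _, _, .right x β => D.mapR₂ x β
  | _, _, _, _, .sigma f g => D.swap f g

theorem evalCell_ofEq {p q : Gray P Q} {s t : p ⟶ q} (h : s = t) :
    D.evalCell (Cell.ofEq h) = eqToHom (congrArg D.evalHom h) := by
  cases h; rfl

theorem wl_conj {a b c : C} {f f' : a ⟶ b} (h : f = f') {g g' : b ⟶ c} (η : g ⟶ g') :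
    f ◁ η = eqToHom (by rw [h]) ≫ f' ◁ η ≫ eqToHom (by rw [h]) := by
  cases h; simp

theorem wr_conj {a b c : C} {f f' : a ⟶ b} (η : f ⟶ f') {g g' : b ⟶ c} (h : g = g') :
    η ▷ g = eqToHom (by rw [h]) ≫ η ▷ g' ≫ eqToHom (by rw [h]) := by
  cases h; simp

theorem evalHom_id (p : Gray P Q) : D.evalHom (𝟙 p) = 𝟙 _ := rfl

theorem evalCell_rel {p q : Gray P Q} {s t : p ⟶ q} {η θ : Cell P Q s t} (h : CellRel η θ) :
    D.evalCell η = D.evalCell θ := by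
  induction h with
  | comp_left t h ih => simp only [evalCell, ih]
  | comp_right s h ih => simp only [evalCell, ih]
  | whiskerLeft_congr t h ih => simp only [evalCell, ih]
  | whiskerRight_congr s h ih => simp only [evalCell, ih]
  | id_comp => simp [evalCell]
  | comp_id => simp [evalCell]
  | assoc => simp [evalCell]
  | whiskerLeft_id f g => simp [evalCell]
  | whiskerLeft_comp => simp [evalCell]
  | id_whiskerLeft η => 
    simp only [evalCell, evalCell_ofEq]
    rw [wl_conj (D.evalHom_id _)]
    simp [Strict.leftUnitor_eqToIso]
  | comp_whiskerLeft f g η =>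
    simp only [evalCell, evalCell_ofEq]
    rw [wl_conj (D.evalHom_comp _ _)]
    simp [Strict.associator_eqToIso]
  | id_whiskerRight => simp [evalCell]
  | comp_whiskerRight => simp [evalCell]
  | whiskerRight_id η => 
    simp only [evalCell, evalCell_ofEq]
    rw [wr_conj _ (D.evalHom_id _)]
    simp [Strict.rightUnitor_eqToIso]
  | whiskerRight_comp η => 
    simp only [evalCell, evalCell_ofEq]
    rw [wr_conj _ (D.evalHom_comp _ _)]
    simp [Strict.associator_eqToIso]
  | whisker_assoc => 
    simp [evalCell, evalCell_ofEq, Strict.associator_eqToIso]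
  | whisker_exchange η θ => 
    simp [evalCell, whisker_exchange_assoc]
  | left_id => exact D.mapL₂_id _ _
  | left_comp => exact D.mapL₂_comp _ _ _
  | left_whiskerLeft f α y =>
    simp [evalCell, evalCell_ofEq]
    exact D.mapL₂_whiskerLeft f α y
  | left_whiskerRight α f y =>
    simp [evalCell, evalCell_ofEq]
    exact D.mapL₂_whiskerRight α f y
  | right_id => exact D.mapR₂_id _ _
  | right_comp => exact D.mapR₂_comp _ _ _
  | right_whiskerLeft x f α =>
    simp [evalCell, evalCell_ofEq]
    exact D.mapR₂_whiskerLeft x f α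
  | right_whiskerRight x α f =>
    simp [evalCell, evalCell_ofEq]
    exact D.mapR₂_whiskerRight x α f
  | sigma_left α g =>
    change (𝟙 (_ ≫ _) ≫ D.mapL₂ α _ ▷ D.mapR _ g ≫ 𝟙 (_ ≫ _)) ≫ D.swap _ g =
      D.swap _ g ≫ 𝟙 (_ ≫ _) ≫ D.mapR _ g ◁ D.mapL₂ α _ ≫ 𝟙 (_ ≫ _)
    simpa using D.swap_left α g
  | sigma_right f β =>
    change (𝟙 (_ ≫ _) ≫ D.mapL f _ ◁ D.mapR₂ _ β ≫ 𝟙 (_ ≫ _)) ≫ D.swap f _ =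
      D.swap f _ ≫ 𝟙 (_ ≫ _) ≫ D.mapR₂ _ β ▷ D.mapL f _ ≫ 𝟙 (_ ≫ _)
    simpa using D.swap_right f β
  | sigma_comp_left f f' g =>
    simp [evalCell, evalCell_ofEq]
    refine (D.swap_comp_left f f' g).trans ?_
    simp [Strict.associator_eqToIso]
    rfl
  | sigma_comp_right f g g' =>
    simp [evalCell, evalCell_ofEq]
    refine (D.swap_comp_right f g g').trans ?_
    simp [Strict.associator_eqToIso]
    rfl
  | sigma_tight f g h =>
    rw [evalCell_ofEq]
    exact (D.swap_tight f g h).2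

/-- The 2-functor out of the Gray tensor product with data `D`. -/
def lift : StrictPseudofunctor (Gray P Q) C := StrictPseudofunctor.mk''
  { obj p := D.obj p.fst p.snd
    map s := D.evalHom s
    map₂ η := Quot.lift D.evalCell (fun _ _ h => D.evalCell_rel h) η
    map₂_id _ := rfl
    map₂_comp η θ := Quot.inductionOn η fun _ => Quot.inductionOn θ fun _ => rfl
    map_id _ := rfl
    map_comp := D.evalHom_comp
    map₂_whisker_left _ _ _ η := Quot.inductionOn η fun _ => rfl
    map₂_whisker_right η _ := Quot.inductionOn η fun _ => rfl }

end Bifunctor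
end
end Gray

section
variable (X : Type u₁) [Bicategory.{w₁, v₁} X] 

/-- Being an identity 1-cell. -/
inductive IsIdCell : ∀ {x y : X}, (x ⟶ y) → Prop
  | mk (x : X) : IsIdCell (𝟙 x)

/-- The smallest `F`-category structure: only the identities are tight. -/
def FStr.min [Strict X] : FStr X where
  Tight := IsIdCell X
  tight_id := .mk
  tight_comp := by
    rintro a _ _ _ _ ⟨_⟩ ⟨_⟩
    rw [Strict.id_comp]; exact .mk a

variable (Y : Type u₂) [Bicategory.{w₂, v₂} Y]

/-- Being a 1-cell `(f, 1)` of a product. -/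
inductive IsFstCell : ∀ {p q : X × Y}, (p ⟶ q) → Prop
  | mk {x x' : X} (f : x ⟶ x') (y : Y) : IsFstCell (p := (x, y)) (q := (x', y)) (f, 𝟙 y)

/-- The `F`-category structure on `X × Y` whose tight 1-cells are the `(f, 1)`. -/
def FStr.fst [Strict Y] : FStr (X × Y) where
  Tight := IsFstCell X Y
  tight_id p := .mk (𝟙 p.1) p.2
  tight_comp := by
    rintro _ _ _ _ _ ⟨f, y⟩ ⟨g, _⟩
    have h := IsFstCell.mk (X := X) (f ≫ g) y
    rw [← Strict.id_comp (𝟙 y)] at h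
    exact h
end

section
variable {X : Type u₁} [Bicategory.{w₁, v₁} X]

theorem op_unop2_eqToHom {a b : Xᵒᵖ} {f g : a ⟶ b} (h : f = g) :
    (eqToHom h).unop2 = eqToHom (congrArg Quiver.Hom.unop h) := by
  cases h; rfl

theorem op_hom2_ext {a b : Xᵒᵖ} {f g : a ⟶ b} {η θ : f ⟶ g} (h : η.unop2 = θ.unop2) : η = θ :=
  congrArg Bicategory.Opposite.Hom2.op2' h

instance opStrict [Strict X] : Strict Xᵒᵖ where
  id_comp f := congrArg Quiver.Hom.op (Strict.comp_id f.unop)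
  comp_id f := congrArg Quiver.Hom.op (Strict.id_comp f.unop)
  assoc f g h := congrArg Quiver.Hom.op (Strict.assoc h.unop g.unop f.unop).symm
  leftUnitor_eqToIso f := by
    ext; apply op_hom2_ext; simp [op_unop2_eqToHom, Strict.rightUnitor_eqToIso]
  rightUnitor_eqToIso f := by
    ext; apply op_hom2_ext; simp [op_unop2_eqToHom, Strict.leftUnitor_eqToIso]
  associator_eqToIso f g h := by
    ext; apply op_hom2_ext; simp [op_unop2_eqToHom, Strict.associator_eqToIso]

variable {Y : Type u₂} [Bicategory.{w₂, v₂} Y]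

theorem prod_eqToHom_fst {p q : X × Y} {f g : p ⟶ q} (h : f = g) :
    (eqToHom h).1 = eqToHom (congrArg Prod.fst h) := by
  cases h; rfl

theorem prod_eqToHom_snd {p q : X × Y} {f g : p ⟶ q} (h : f = g) :
    (eqToHom h).2 = eqToHom (congrArg Prod.snd h) := by
  cases h; rfl

theorem prod_hom₂_ext {p q : X × Y} {f g : p ⟶ q} {η θ : f ⟶ g} (h₁ : η.1 = θ.1)
    (h₂ : η.2 = θ.2) : η = θ := Prod.ext h₁ h₂

end

/-- The lax Gray tensor product of two 2-categories: only the identities are tight, so that every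
`Σ` with non-identity `f` and `g` is a genuinely new 2-cell. -/
abbrev LaxGray (X : Type u₁) [Bicategory.{w₁, v₁} X] [Strict X]
    (Y : Type u₂) [Bicategory.{w₂, v₂} Y] [Strict Y] := Gray (FStr.min X) (FStr.min Y)

namespace LaxGray
variable (A : Type u₁) [Bicategory.{w₁, v₁} A] [Strict A]
  (B : Type u₂) [Bicategory.{w₂, v₂} B] [Strict B]

/-- The data of the quotient map `X ⊗ Y ⟶ X × Y`. -/
def toProdData : Gray.Bifunctor (FStr.min A) (FStr.min B) (A × B) where
  obj a b := (a, b)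
  mapL f b := (f, 𝟙 b)
  mapR a _ _ g := (𝟙 a, g)
  mapL₂ α b := (α, 𝟙 (𝟙 b))
  mapR₂ a _ _ _ _ β := (𝟙 (𝟙 a), β)
  swap f _ _ g := (eqToHom ((Strict.comp_id f).trans (Strict.id_comp f).symm),
    eqToHom ((Strict.id_comp g).trans (Strict.comp_id g).symm))
  mapL_id _ _ := rfl
  mapL_comp f f' b := Prod.ext rfl (Strict.id_comp (𝟙 b)).symm
  mapR_id _ _ := rfl
  mapR_comp a _ _ _ g g' := Prod.ext (Strict.id_comp (𝟙 a)).symm rfl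
  mapL₂_id _ _ := rfl
  mapL₂_comp _ _ _ := by refine prod_hom₂_ext ?_ ?_ <;> simp
  mapL₂_whiskerLeft f _ _ α b := by
    refine prod_hom₂_ext ?_ ?_ <;> simp [prod_eqToHom_fst, prod_eqToHom_snd]
  mapL₂_whiskerRight α h b := by
    refine prod_hom₂_ext ?_ ?_ <;> simp [prod_eqToHom_fst, prod_eqToHom_snd]
  mapR₂_id _ _ := by intros; rfl
  mapR₂_comp _ _ _ := by intros; refine prod_hom₂_ext ?_ ?_ <;> simp
  mapR₂_whiskerLeft a _ _ _ f _ _ α := by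
    refine prod_hom₂_ext ?_ ?_ <;> simp [prod_eqToHom_fst, prod_eqToHom_snd]
  mapR₂_whiskerRight a _ _ _ f _ _ α := by
    refine prod_hom₂_ext ?_ ?_ <;> simp [prod_eqToHom_fst, prod_eqToHom_snd]
  swap_left α _ _ g := by
    refine prod_hom₂_ext ?_ ?_ <;> simp [prod_eqToHom_fst, prod_eqToHom_snd, Strict.rightUnitor_eqToIso, Strict.leftUnitor_eqToIso]
  swap_right f _ _ _ _ β := by
    refine prod_hom₂_ext ?_ ?_ <;> simp [prod_eqToHom_fst, prod_eqToHom_snd, Strict.rightUnitor_eqToIso, Strict.leftUnitor_eqToIso]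
  swap_comp_left f f' _ _ g := by
    refine prod_hom₂_ext ?_ ?_ <;> simp [prod_eqToHom_fst, prod_eqToHom_snd, Strict.associator_eqToIso]
  swap_comp_right f _ _ _ g g' := by
    refine prod_hom₂_ext ?_ ?_ <;> simp [prod_eqToHom_fst, prod_eqToHom_snd, Strict.associator_eqToIso]
  swap_tight f _ _ g _ := by
    refine ⟨Prod.ext ((Strict.comp_id f).trans (Strict.id_comp f).symm)
      ((Strict.id_comp g).trans (Strict.comp_id g).symm), ?_⟩
    refine prod_hom₂_ext ?_ ?_ <;> simp [prod_eqToHom_fst, prod_eqToHom_snd]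

/-- The quotient map from the lax Gray tensor product to the product, which sends every `Σ` to an
identity. -/
def toProd : StrictPseudofunctor (LaxGray A B) (A × B) := (toProdData A B).lift
end LaxGray

section
variable (X₁ : Type u₁) [Bicategory.{w₁, v₁} X₁] [Strict X₁]
  (X₂ : Type u₂) [Bicategory.{w₂, v₂} X₂] [Strict X₂]
  (Y₁ : Type u₃) [Bicategory.{w₃, v₃} Y₁] [Strict Y₁]
  (Y₂ : Type u₄) [Bicategory.{w₄, v₄} Y₂] [Strict Y₂]

/-- The data of the 2-functor `jFunctor`. -/
def jData : Gray.Bifunctor (FStr.fst X₁ X₂) (FStr.fst Y₁ Y₂) (X₁ × Y₁ × LaxGray X₂ Y₂) where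
  obj p q := (p.1, q.1, ⟨p.2, q.2⟩)
  mapL f q := (f.1, 𝟙 q.1, Gray.inl _ _ f.2 q.2)
  mapR p _ _ g := (𝟙 p.1, g.1, Gray.inr _ _ p.2 g.2)
  mapL₂ α q := (α.1, 𝟙 (𝟙 q.1), Gray.inl₂ _ _ α.2 q.2)
  mapR₂ p _ _ _ _ β := (𝟙 (𝟙 p.1), β.1, Gray.inr₂ _ _ p.2 β.2)
  swap f _ _ g := (eqToHom ((Strict.comp_id f.1).trans (Strict.id_comp f.1).symm),
    eqToHom ((Strict.id_comp g.1).trans (Strict.comp_id g.1).symm), Gray.gray _ _ f.2 g.2)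
  mapL_id p q := Prod.ext rfl (Prod.ext rfl (Gray.inl_id p.2 q.2))
  mapL_comp f f' q := Prod.ext rfl (Prod.ext (Strict.id_comp (𝟙 q.1)).symm
    (Gray.inl_comp f.2 f'.2 q.2))
  mapR_id p q := Prod.ext rfl (Prod.ext rfl (Gray.inr_id p.2 q.2))
  mapR_comp p _ _ _ g g' := Prod.ext (Strict.id_comp (𝟙 p.1)).symm (Prod.ext rfl
    (Gray.inr_comp p.2 g.2 g'.2))
  mapL₂_id f q := Prod.ext rfl (Prod.ext rfl (Gray.inl₂_id _ _ f.2 q.2))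
  mapL₂_comp α α' q := by refine prod_hom₂_ext ?_ (prod_hom₂_ext ?_ ?_) <;> simp [Gray.inl₂_comp]
  mapL₂_whiskerLeft f _ _ α b := by
    refine prod_hom₂_ext ?_ (prod_hom₂_ext ?_ ?_) <;> simp [prod_eqToHom_fst, prod_eqToHom_snd, Gray.inl₂_whiskerLeft]
  mapL₂_whiskerRight α h b := by
    refine prod_hom₂_ext ?_ (prod_hom₂_ext ?_ ?_) <;> simp [prod_eqToHom_fst, prod_eqToHom_snd, Gray.inl₂_whiskerRight]
  mapR₂_id p _ _ g := Prod.ext rfl (Prod.ext rfl (Gray.inr₂_id _ _ p.2 g.2))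
  mapR₂_comp _ _ _ := by intros; refine prod_hom₂_ext ?_ (prod_hom₂_ext ?_ ?_) <;> simp [Gray.inr₂_comp]
  mapR₂_whiskerLeft a _ _ _ f _ _ α := by
    refine prod_hom₂_ext ?_ (prod_hom₂_ext ?_ ?_) <;> simp [prod_eqToHom_fst, prod_eqToHom_snd, Gray.inr₂_whiskerLeft]
  mapR₂_whiskerRight a _ _ _ f _ _ α := by
    refine prod_hom₂_ext ?_ (prod_hom₂_ext ?_ ?_) <;> simp [prod_eqToHom_fst, prod_eqToHom_snd, Gray.inr₂_whiskerRight]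
  swap_left α _ _ g := by
    refine prod_hom₂_ext ?_ (prod_hom₂_ext ?_ ?_) <;> simp [prod_eqToHom_fst, prod_eqToHom_snd, Strict.rightUnitor_eqToIso, Strict.leftUnitor_eqToIso, Gray.gray_left]
  swap_right f _ _ _ _ β := by
    refine prod_hom₂_ext ?_ (prod_hom₂_ext ?_ ?_) <;> simp [prod_eqToHom_fst, prod_eqToHom_snd, Strict.rightUnitor_eqToIso, Strict.leftUnitor_eqToIso, Gray.gray_right]
  swap_comp_left f f' _ _ g := by
    refine prod_hom₂_ext ?_ (prod_hom₂_ext ?_ ?_) <;> simp [prod_eqToHom_fst, prod_eqToHom_snd, Strict.associator_eqToIso, Gray.gray_comp_left]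
  swap_comp_right f _ _ _ g g' := by
    refine prod_hom₂_ext ?_ (prod_hom₂_ext ?_ ?_) <;> simp [prod_eqToHom_fst, prod_eqToHom_snd, Strict.associator_eqToIso, Gray.gray_comp_right]
  swap_tight f _ _ g h := by
    have h' : (FStr.min X₂).Tight f.2 ∨ (FStr.min Y₂).Tight g.2 := by
      rcases h with ⟨⟨_, _⟩⟩ | ⟨⟨_, _⟩⟩
      · exact .inl (.mk _)
      · exact .inr (.mk _)
    refine ⟨Prod.ext ((Strict.comp_id f.1).trans (Strict.id_comp f.1).symm) (Prod.ext
      ((Strict.id_comp g.1).trans (Strict.comp_id g.1).symm) (Gray.inl_inr f.2 g.2 h')), ?_⟩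
    refine prod_hom₂_ext ?_ (prod_hom₂_ext ?_ ?_) <;> simp [prod_eqToHom_fst, prod_eqToHom_snd, Gray.gray_tight _ _ _ _ h']

/-- The comparison `(X₁ × X₂) ⊗ (Y₁ × Y₂) ⟶ X₁ × Y₁ × (X₂ ⊗ Y₂)` that exchanges the two middle
factors. The tight 1-cells are those of the form `(f, 1)`, so that only the Gray cells in `X₂` and
`Y₂` remain on the left. -/
def jFunctor : StrictPseudofunctor (Gray (FStr.fst X₁ X₂) (FStr.fst Y₁ Y₂))
    (X₁ × Y₁ × LaxGray X₂ Y₂) := (jData X₁ X₂ Y₁ Y₂).lift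
end

section FunSL
open scoped Lax.LaxTrans

/-- The 2-category of 2-functors `X ⟶ C`, semi-strict transformations (lax natural transformations
that are strictly natural on tight 1-cells) and modifications. All 1-cells of `C` are tight. This
structure is the type of its objects. -/
structure FunSL {X : Type u₁} [Bicategory.{w₁, v₁} X] (P : FStr X)
    (C : Type u₃) [Bicategory.{w₃, v₃} C] where
  functor : StrictPseudofunctor X C

namespace FunSL
variable {X : Type u₁} [Bicategory.{w₁, v₁} X] {P : FStr X} {C : Type u₃} [Bicategory.{w₃, v₃} C]

/-- The underlying lax functor. -/
abbrev lax (F : FunSL P C) : X ⥤ᴸ C := F.functor.toPseudofunctor.toLax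

/-- A semi-strict transformation. Its lax naturality cells are
`trans.naturality f : trans.app x ≫ G f ⟶ F f ≫ trans.app y`, identities for tight `f`. -/
structure Hom (F G : FunSL P C) where
  trans : F.lax ⟶ G.lax
  strict : ∀ {x y : X} (f : x ⟶ y), P.Tight f →
    ∃ h : trans.app x ≫ G.lax.map f = F.lax.map f ≫ trans.app y, trans.naturality f = eqToHom h

variable [Strict C]

/-- The identity transformation. -/
def Hom.id (F : FunSL P C) : Hom F F where
  trans := 𝟙 F.lax
  strict f _ := ⟨by simp, by
    simp [Strict.leftUnitor_eqToIso, Strict.rightUnitor_eqToIso]; rfl⟩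

/-- The composite of two semi-strict transformations. -/
def Hom.comp {F G H : FunSL P C} (η : Hom F G) (θ : Hom G H) : Hom F H where
  trans := η.trans ≫ θ.trans
  strict f hf := by
    obtain ⟨h₁, e₁⟩ := η.strict f hf
    obtain ⟨h₂, e₂⟩ := θ.strict f hf
    refine ⟨?_, ?_⟩
    · simp only [Lax.LaxTrans.comp_app, Strict.assoc]
      rw [h₂, ← Strict.assoc, h₁, Strict.assoc]
    · simp [e₁, e₂, Strict.associator_eqToIso]; rfl

instance : CategoryStruct (FunSL P C) where
  Hom := Hom
  id := Hom.id
  comp := Hom.comp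

instance homCategory (F G : FunSL P C) : Category (F ⟶ G) where
  Hom η θ := η.trans ⟶ θ.trans
  id η := 𝟙 η.trans
  comp Γ Λ := Lax.LaxTrans.homCategory.comp Γ Λ
  id_comp Γ := Lax.LaxTrans.homCategory.id_comp Γ
  comp_id Γ := Lax.LaxTrans.homCategory.comp_id Γ
  assoc Γ Λ Θ := Lax.LaxTrans.homCategory.assoc Γ Λ Θ

/-- An invertible modification is an isomorphism in the hom category. -/
def isoOf {F G : FunSL P C} {η θ : F ⟶ G} (e : η.trans ≅ θ.trans) : η ≅ θ where
  hom := e.hom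
  inv := e.inv
  hom_inv_id := e.hom_inv_id
  inv_hom_id := e.inv_hom_id

/-- The component at `x` of a modification. -/
def app₂ {F G : FunSL P C} {η θ : F ⟶ G} (Γ : η ⟶ θ) (x : X) : η.trans.app x ⟶ θ.trans.app x :=
  Lax.LaxTrans.Modification.app (Lax.LaxTrans.Hom.as Γ) x

theorem hom₂_ext {F G : FunSL P C} {η θ : F ⟶ G} {Γ Λ : η ⟶ θ} (h : ∀ x, app₂ Γ x = app₂ Λ x) :
    Γ = Λ := Lax.LaxTrans.homCategory.ext h

theorem app₂_eqToHom {F G : FunSL P C} {η θ : F ⟶ G} (h : η = θ) (x : X) :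
    app₂ (eqToHom h) x = eqToHom (by rw [h]) := by
  cases h; rfl

theorem app₂_comp {F G : FunSL P C} {η θ ι : F ⟶ G} (Γ : η ⟶ θ) (Λ : θ ⟶ ι) (x : X) :
    app₂ (Γ ≫ Λ) x = app₂ Γ x ≫ app₂ Λ x := rfl

instance bicategory : Bicategory (FunSL P C) :=
  letI wl {F G H : FunSL P C} (η : F ⟶ G) {θ ι : G ⟶ H} (Γ : θ ⟶ ι) : η ≫ θ ⟶ η ≫ ι :=
    Lax.LaxTrans.whiskerLeft η.trans Γ
  letI wr {F G H : FunSL P C} {η θ : F ⟶ G} (Γ : η ⟶ θ) (ι : G ⟶ H) : η ≫ ι ⟶ θ ≫ ι :=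
    Lax.LaxTrans.whiskerRight Γ ι.trans
  { homCategory := homCategory
    whiskerLeft := wl
    whiskerRight := wr
    associator := fun {F G H K} η θ ι =>
      (isoOf (Lax.LaxTrans.associator η.trans θ.trans ι.trans) : (η ≫ θ) ≫ ι ≅ η ≫ θ ≫ ι)
    leftUnitor := fun {F G} η => (isoOf (Lax.LaxTrans.leftUnitor η.trans) : 𝟙 F ≫ η ≅ η)
    rightUnitor := fun {F G} η => (isoOf (Lax.LaxTrans.rightUnitor η.trans) : η ≫ 𝟙 G ≅ η)
    whiskerLeft_id := fun {F G H} η θ => by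
      apply Lax.LaxTrans.homCategory.ext
      intro x
      exact Bicategory.whiskerLeft_id (η.trans.app x) (θ.trans.app x)
    whiskerLeft_comp := fun η _ _ _ Γ Λ => by
      apply Lax.LaxTrans.homCategory.ext
      intro x
      exact Bicategory.whiskerLeft_comp (η.trans.app x) (app₂ Γ x) (app₂ Λ x)
    id_whiskerLeft := fun Γ => by
      apply Lax.LaxTrans.homCategory.ext
      intro x
      exact Bicategory.id_whiskerLeft (app₂ Γ x)
    comp_whiskerLeft := fun η θ _ _ Γ => by
      apply Lax.LaxTrans.homCategory.ext
      intro x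
      exact Bicategory.comp_whiskerLeft (η.trans.app x) (θ.trans.app x) (app₂ Γ x)
    id_whiskerRight := fun η θ => by
      apply Lax.LaxTrans.homCategory.ext
      intro x
      exact Bicategory.id_whiskerRight (η.trans.app x) (θ.trans.app x)
    comp_whiskerRight := fun Γ Λ η => by
      apply Lax.LaxTrans.homCategory.ext
      intro x
      exact Bicategory.comp_whiskerRight (app₂ Γ x) (app₂ Λ x) (η.trans.app x)
    whiskerRight_id := fun Γ => by
      apply Lax.LaxTrans.homCategory.ext
      intro x
      exact Bicategory.whiskerRight_id (app₂ Γ x)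
    whiskerRight_comp := fun Γ θ ι => by
      apply Lax.LaxTrans.homCategory.ext
      intro x
      exact Bicategory.whiskerRight_comp (app₂ Γ x) (θ.trans.app x) (ι.trans.app x)
    whisker_assoc := fun η _ _ Γ ι => by
      apply Lax.LaxTrans.homCategory.ext
      intro x
      exact Bicategory.whisker_assoc (η.trans.app x) (app₂ Γ x) (ι.trans.app x)
    whisker_exchange := fun Γ Λ => by
      apply Lax.LaxTrans.homCategory.ext
      intro x
      exact Bicategory.whisker_exchange (app₂ Γ x) (app₂ Λ x)
    pentagon := fun η θ ι κ => by
      apply Lax.LaxTrans.homCategory.ext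
      intro x
      exact Bicategory.pentagon (η.trans.app x) (θ.trans.app x) (ι.trans.app x) (κ.trans.app x)
    triangle := fun η θ => by
      apply Lax.LaxTrans.homCategory.ext
      intro x
      exact Bicategory.triangle (η.trans.app x) (θ.trans.app x) }

theorem hom_ext {F G : FunSL P C} {η θ : F ⟶ G} (h : ∀ x, η.trans.app x = θ.trans.app x)
    (h' : ∀ {x y : X} (f : x ⟶ y), η.trans.naturality f =
      eqToHom (by rw [h]) ≫ θ.trans.naturality f ≫ eqToHom (by rw [h])) : η = θ := by
  rcases η with ⟨⟨a, n, _, _, _⟩, _⟩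
  rcases θ with ⟨⟨a', n', _, _, _⟩, _⟩
  obtain rfl : a = a' := funext h
  have : @n = @n' := by
    funext x y f
    simpa using h' f
  subst this
  rfl

end FunSL
end FunSL

section strictlemmas
variable {X : Type u₁} [Bicategory.{w₁, v₁} X] {C : Type u₃} [Bicategory.{w₃, v₃} C]
  (T : StrictPseudofunctor X C)

theorem map₂_wL {x y z : X} (f : x ⟶ y) {g h : y ⟶ z} (η : g ⟶ h) :
    T.map₂ (f ◁ η) = eqToHom (T.map_comp f g) ≫ T.map f ◁ T.map₂ η ≫
      eqToHom (T.map_comp f h).symm := by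
  simp [T.map₂_whisker_left, T.mapComp_eq_eqToIso]

theorem map₂_wR {x y z : X} {f g : x ⟶ y} (η : f ⟶ g) (h : y ⟶ z) :
    T.map₂ (η ▷ h) = eqToHom (T.map_comp f h) ≫ T.map₂ η ▷ T.map h ≫
      eqToHom (T.map_comp g h).symm := by
  simp [T.map₂_whisker_right, T.mapComp_eq_eqToIso]

theorem wL_map₂ {x y z : X} (f : x ⟶ y) {g h : y ⟶ z} (η : g ⟶ h) :
    T.map f ◁ T.map₂ η = eqToHom (T.map_comp f g).symm ≫ T.map₂ (f ◁ η) ≫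
      eqToHom (T.map_comp f h) := by
  rw [map₂_wL]; simp

theorem wR_map₂ {x y z : X} {f g : x ⟶ y} (η : f ⟶ g) (h : y ⟶ z) :
    T.map₂ η ▷ T.map h = eqToHom (T.map_comp f h).symm ≫ T.map₂ (η ▷ h) ≫
      eqToHom (T.map_comp g h) := by
  rw [map₂_wR]; simp
theorem map₂_eqToHom' {x y : X} {f g : x ⟶ y} (h : f = g) :
    T.map₂ (eqToHom h) = eqToHom (congrArg T.map h) := by
  cases h; simp
end strictlemmas

namespace Gray
variable {X : Type u₁} [Bicategory.{w₁, v₁} X] [Strict X]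
  {Y : Type u₂} [Bicategory.{w₂, v₂} Y] [Strict Y] {P : FStr X} {Q : FStr Y}
  {C : Type u₃} [Bicategory.{w₃, v₃} C] [Strict C]

variable (P Q) in
/-- The 2-functor `y ↦ (x, y)`. -/
def inc (x : X) : StrictPseudofunctor Y (Gray P Q) := StrictPseudofunctor.mk''
  { obj y := ⟨x, y⟩
    map g := inr P Q x g
    map₂ β := inr₂ P Q x β
    map₂_id g := inr₂_id P Q x g
    map₂_comp β β' := inr₂_comp P Q x β β'
    map_id y := inr_id x y
    map_comp g g' := inr_comp x g g'
    map₂_whisker_left g _ _ β := inr₂_whiskerLeft P Q x g β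
    map₂_whisker_right β h := inr₂_whiskerRight P Q x β h }

variable (T : StrictPseudofunctor (Gray P Q) C)

/-- The image of a Gray cell under a 2-functor. -/
def mapGray {x x' : X} (f : x ⟶ x') {y y' : Y} (g : y ⟶ y') :
    T.map (inl P Q f y) ≫ T.map (inr P Q x' g) ⟶ T.map (inr P Q x g) ≫ T.map (inl P Q f y') :=
  eqToHom (T.map_comp _ _).symm ≫ T.map₂ (gray P Q f g) ≫ eqToHom (T.map_comp _ _)

theorem mapGray_right {x x' : X} (f : x ⟶ x') {y y' : Y} {g g' : y ⟶ y'} (β : g ⟶ g') :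
    mapGray T f g ≫ T.map₂ (inr₂ P Q x β) ▷ T.map (inl P Q f y') =
      T.map (inl P Q f y) ◁ T.map₂ (inr₂ P Q x' β) ≫ mapGray T f g' := by
  have := congrArg T.map₂ (gray_right P Q f β)
  simp only [T.map₂_comp] at this
  simp only [mapGray, wL_map₂, wR_map₂]
  simp only [Category.assoc, eqToHom_trans, eqToHom_trans_assoc, eqToHom_refl, Category.id_comp,
    reassoc_of% this]

theorem mapGray_left {x x' : X} {f f' : x ⟶ x'} (α : f ⟶ f') {y y' : Y} (g : y ⟶ y') :
    T.map₂ (inl₂ P Q α y) ▷ T.map (inr P Q x' g) ≫ mapGray T f' g =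
      mapGray T f g ≫ T.map (inr P Q x g) ◁ T.map₂ (inl₂ P Q α y') := by
  have := congrArg T.map₂ (gray_left P Q α g)
  simp only [T.map₂_comp] at this
  simp only [mapGray, wL_map₂, wR_map₂]
  simp only [Category.assoc, eqToHom_trans, eqToHom_trans_assoc, eqToHom_refl, Category.id_comp,
    reassoc_of% this]

theorem mapGray_tight {x x' : X} (f : x ⟶ x') {y y' : Y} (g : y ⟶ y')
    (h : P.Tight f ∨ Q.Tight g) : mapGray T f g = eqToHom ((T.map_comp _ _).symm.trans
      ((congrArg T.map (inl_inr f g h)).trans (T.map_comp _ _))) := by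
  simp [mapGray, gray_tight P Q f g h, map₂_eqToHom']

theorem mapGray_comp_right {x x' : X} (f : x ⟶ x') {y y' y'' : Y} (g : y ⟶ y') (g' : y' ⟶ y'') :
    mapGray T f (g ≫ g') =
      eqToHom (by rw [inr_comp, T.map_comp, Strict.assoc]) ≫
        mapGray T f g ▷ T.map (inr P Q x' g') ≫ eqToHom (Strict.assoc _ _ _) ≫
          T.map (inr P Q x g) ◁ mapGray T f g' ≫
            eqToHom (by rw [inr_comp, T.map_comp, Strict.assoc]) := by
  simp only [mapGray, gray_comp_right, T.map₂_comp, map₂_eqToHom', map₂_wL, map₂_wR]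
  simp

theorem mapGray_comp_left {x x' x'' : X} (f : x ⟶ x') (f' : x' ⟶ x'') {y y' : Y} (g : y ⟶ y') :
    mapGray T (f ≫ f') g =
      eqToHom (by rw [inl_comp, T.map_comp, Strict.assoc]) ≫
        T.map (inl P Q f y) ◁ mapGray T f' g ≫ eqToHom (Strict.assoc _ _ _).symm ≫
          mapGray T f g ▷ T.map (inl P Q f' y') ≫
            eqToHom (by rw [inl_comp, T.map_comp, Strict.assoc]) := by
  simp only [mapGray, gray_comp_left, T.map₂_comp, map₂_eqToHom', map₂_wL, map₂_wR]
  simp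

/-- The 2-functor `y ↦ T (x, y)`. -/
def curryObj (x : X) : FunSL Q C := ⟨(inc P Q x).comp T⟩

theorem curryObj_mapId (x : X) (y : Y) : (curryObj T x).functor.mapId y =
    eqToIso ((curryObj T x).functor.map_id y) := (curryObj T x).functor.mapId_eq_eqToIso y

theorem aux_id {a b : C} (f : a ⟶ b) {g : b ⟶ b} (hg : g = 𝟙 b) {k : a ⟶ a}
    (hk : k = 𝟙 a) {σ : f ≫ g ⟶ k ≫ f} (h : f ≫ g = k ≫ f) (hσ : σ = eqToHom h) :
    f ◁ (eqToIso hg).inv ≫ σ = (ρ_ f).hom ≫ (λ_ f).inv ≫ (eqToIso hk).inv ▷ f := by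
  subst hg hk hσ
  simp [Strict.rightUnitor_eqToIso, Strict.leftUnitor_eqToIso]

theorem aux_comp {a b c a' b' c' : C} {p : a ⟶ a'} {q : b ⟶ b'} {r : c ⟶ c'} {f : a ⟶ b}
    {g : b ⟶ c} {h : a ⟶ c} (e : h = f ≫ g) {f' : a' ⟶ b'} {g' : b' ⟶ c'} {h' : a' ⟶ c'}
    (e' : h' = f' ≫ g') (σ : p ≫ f' ⟶ f ≫ q) (τ : q ≫ g' ⟶ g ≫ r) {u v w}
    {κ : p ≫ h' ⟶ h ≫ r}
    (hκ : κ = eqToHom u ≫ σ ▷ g' ≫ eqToHom v ≫ f ◁ τ ≫ eqToHom w) :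
    p ◁ (eqToIso e').inv ≫ κ = (α_ _ _ _).inv ≫ σ ▷ g' ≫ (α_ _ _ _).hom ≫ f ◁ τ ≫ (α_ _ _ _).inv ≫
      (eqToIso e).inv ▷ r := by
  subst e e' hκ
  simp [Strict.associator_eqToIso]

/-- The semi-strict transformation `T (x, -) ⟶ T (x', -)` with components `T (f, 1)` and lax
naturality cells `T Σ`. -/
def curryMap {x x' : X} (f : x ⟶ x') : curryObj T x ⟶ curryObj T x' where
  trans :=
    { app y := T.map (inl P Q f y)
      naturality {y y'} g := mapGray T f g
      naturality_naturality {y y' g g'} β := mapGray_right T f β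
      naturality_id y := by
        simp only [FunSL.lax, Pseudofunctor.toLax_mapId, curryObj_mapId]
        exact aux_id _ _ _ _ (mapGray_tight T f (𝟙 y) (.inr (Q.tight_id y)))
      naturality_comp {y y' y''} g g' := by
        simp only [FunSL.lax, Pseudofunctor.toLax_mapComp, StrictPseudofunctor.mapComp_eq_eqToIso]
        exact aux_comp _ _ _ _ (mapGray_comp_right T f g g') }
  strict {y y'} g hg := ⟨_, mapGray_tight T f g (.inr hg)⟩

end Gray

namespace FunSL
section
variable {C : Type u₃} [Bicategory.{w₃, v₃} C] [Strict C]

theorem aux_id_comp {a b c d : C} {f : a ⟶ b} {g : b ⟶ d} {k : a ⟶ c} {h : c ⟶ d}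
    (σ : f ≫ g ⟶ k ≫ h) :
    (α_ (𝟙 a) f g).hom ≫ 𝟙 a ◁ σ ≫ (α_ (𝟙 a) k h).inv ≫ ((λ_ k).hom ≫ (ρ_ k).inv) ▷ h ≫
      (α_ k (𝟙 c) h).hom = eqToHom (by simp) ≫ σ ≫ eqToHom (by simp) := by
  simp [Strict.associator_eqToIso, Strict.leftUnitor_eqToIso, Strict.rightUnitor_eqToIso]

theorem aux_comp_id {a b c d : C} {f : a ⟶ b} {g : b ⟶ d} {k : a ⟶ c} {h : c ⟶ d}
    (σ : f ≫ g ⟶ k ≫ h) :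
    (α_ f (𝟙 b) g).hom ≫ f ◁ ((λ_ g).hom ≫ (ρ_ g).inv) ≫ (α_ f g (𝟙 d)).inv ≫ σ ▷ 𝟙 d ≫
      (α_ k h (𝟙 d)).hom = eqToHom (by simp) ≫ σ ≫ eqToHom (by simp) := by
  simp [Strict.associator_eqToIso, Strict.leftUnitor_eqToIso, Strict.rightUnitor_eqToIso]

theorem aux_assoc {a b c d a' b' c' d' : C} {p : a ⟶ b} {q : b ⟶ c} {r : c ⟶ d} {p' : a' ⟶ b'}
    {q' : b' ⟶ c'} {r' : c' ⟶ d'} {f : a ⟶ a'} {g : b ⟶ b'} {h : c ⟶ c'} {k : d ⟶ d'}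
    (σ : p ≫ g ⟶ f ≫ p') (τ : q ≫ h ⟶ g ≫ q') (υ : r ≫ k ⟶ h ≫ r') :
    (α_ (p ≫ q) r k).hom ≫ (p ≫ q) ◁ υ ≫ (α_ (p ≫ q) h r').inv ≫
      ((α_ p q h).hom ≫ p ◁ τ ≫ (α_ p g q').inv ≫ σ ▷ q' ≫ (α_ f p' q').hom) ▷ r' ≫
        (α_ f (p' ≫ q') r').hom =
    eqToHom (by simp) ≫ ((α_ p (q ≫ r) k).hom ≫
      p ◁ ((α_ q r k).hom ≫ q ◁ υ ≫ (α_ q h r').inv ≫ τ ▷ r' ≫ (α_ g q' r').hom) ≫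
        (α_ p g (q' ≫ r')).inv ≫ σ ▷ (q' ≫ r') ≫ (α_ f p' (q' ≫ r')).hom) ≫ eqToHom (by simp) := by
  simp [Strict.associator_eqToIso]

variable {X : Type u₁} [Bicategory.{w₁, v₁} X] {P : FStr X}

theorem app_eqToHom {F G : FunSL P C} {η θ : F ⟶ G} (h : η = θ) (x : X) :
    app₂ (eqToHom h) x = eqToHom (congrArg (fun η : F ⟶ G => η.trans.app x) h) :=
  app₂_eqToHom h x

theorem id_comp' {F G : FunSL P C} (η : F ⟶ G) : 𝟙 F ≫ η = η :=
  hom_ext (fun x => Strict.id_comp (η.trans.app x)) fun f => aux_id_comp (η.trans.naturality f)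

theorem comp_id' {F G : FunSL P C} (η : F ⟶ G) : η ≫ 𝟙 G = η :=
  hom_ext (fun x => Strict.comp_id (η.trans.app x)) fun f => aux_comp_id (η.trans.naturality f)

theorem assoc' {F G H K : FunSL P C} (η : F ⟶ G) (θ : G ⟶ H) (ι : H ⟶ K) :
    (η ≫ θ) ≫ ι = η ≫ θ ≫ ι :=
  hom_ext (fun x => Strict.assoc (η.trans.app x) (θ.trans.app x) (ι.trans.app x))
    fun f => aux_assoc (η.trans.naturality f) (θ.trans.naturality f) (ι.trans.naturality f)

instance strict : Strict (FunSL P C) where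
  id_comp := id_comp'
  comp_id := comp_id'
  assoc := assoc'
  leftUnitor_eqToIso η := by
    ext
    refine hom₂_ext fun x => ?_
    exact (congrArg Iso.hom (Strict.leftUnitor_eqToIso (η.trans.app x))).trans
      (app_eqToHom (id_comp' η) x).symm
  rightUnitor_eqToIso η := by
    ext
    refine hom₂_ext fun x => ?_
    exact (congrArg Iso.hom (Strict.rightUnitor_eqToIso (η.trans.app x))).trans
      (app_eqToHom (comp_id' η) x).symm
  associator_eqToIso η θ ι := by
    ext
    refine hom₂_ext fun x => ?_
    exact (congrArg Iso.hom (Strict.associator_eqToIso (η.trans.app x) (θ.trans.app x)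
      (ι.trans.app x))).trans (app_eqToHom (assoc' η θ ι) x).symm
end
end FunSL

namespace Gray
section
variable {X : Type u₁} [Bicategory.{w₁, v₁} X] [Strict X]
  {Y : Type u₂} [Bicategory.{w₂, v₂} Y] [Strict Y] {P : FStr X} {Q : FStr Y}
  {C : Type u₃} [Bicategory.{w₃, v₃} C] [Strict C] (T : StrictPseudofunctor (Gray P Q) C)

/-- The modification with components `T (α, 1)`. -/
def curryMap₂ {x x' : X} {f f' : x ⟶ x'} (α : f ⟶ f') : curryMap T f ⟶ curryMap T f' :=
  ⟨{ app := fun y => T.map₂ (inl₂ P Q α y)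
     naturality := fun g => mapGray_left T α g }⟩

theorem aux_curry_id {a b : C} {g : a ⟶ b} (l : a ⟶ a) (r : b ⟶ b)
   (hl : l = 𝟙 a) (hr : r = 𝟙 b) {σ : l ≫ g ⟶ g ≫ r} (h) (hσ : σ = eqToHom h) :
    σ = eqToHom (by rw [hl]) ≫ ((λ_ g).hom ≫ (ρ_ g).inv) ≫ eqToHom (by rw [hr]) := by
  subst hl hr hσ
  simp [Strict.leftUnitor_eqToIso, Strict.rightUnitor_eqToIso]

theorem aux_curry_comp {a b c a' b' c' : C} {f : a ⟶ b} {f' : b ⟶ c} {p : a ⟶ a'} {q : b ⟶ b'}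
    {r : c ⟶ c'} {g : a' ⟶ b'} {g' : b' ⟶ c'} (σ : f ≫ q ⟶ p ≫ g) (τ : f' ≫ r ⟶ q ≫ g')
    {k : a ⟶ c} (hk : k = f ≫ f') {k' : a' ⟶ c'} (hk' : k' = g ≫ g') {κ : k ≫ r ⟶ p ≫ k'} {u v w}
    (hκ : κ = eqToHom u ≫ f ◁ τ ≫ eqToHom v ≫ σ ▷ g' ≫ eqToHom w) :
    κ = eqToHom (by rw [hk]) ≫
      ((α_ f f' r).hom ≫ f ◁ τ ≫ (α_ f q g').inv ≫ σ ▷ g' ≫ (α_ p g g').hom) ≫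
        eqToHom (by rw [hk']) := by
  subst hk hk' hκ
  simp [Strict.associator_eqToIso]

/-- The transpose `X ⟶ FunSL Q C` of a 2-functor `T : X ⊗ Y ⟶ C`. -/
def curry : StrictPseudofunctor X (FunSL Q C) := StrictPseudofunctor.mk''
  { obj x := curryObj T x
    map f := curryMap T f
    map₂ α := curryMap₂ T α
    map₂_id f := FunSL.hom₂_ext fun y =>
      (congrArg T.map₂ (inl₂_id P Q f y)).trans (T.map₂_id _)
    map₂_comp α α' := FunSL.hom₂_ext fun y =>
      (congrArg T.map₂ (inl₂_comp P Q α α' y)).trans (T.map₂_comp _ _)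
    map_id x := FunSL.hom_ext (fun y => (congrArg T.map (inl_id x y)).trans (T.map_id _)) fun g =>
      aux_curry_id _ _ ((congrArg T.map (inl_id x _)).trans (T.map_id _))
        ((congrArg T.map (inl_id x _)).trans (T.map_id _)) _
        (mapGray_tight T (𝟙 x) g (.inl (P.tight_id x)))
    map_comp f f' := FunSL.hom_ext
      (fun y => (congrArg T.map (inl_comp f f' y)).trans (T.map_comp _ _)) fun g =>
      aux_curry_comp _ _ ((congrArg T.map (inl_comp f f' _)).trans (T.map_comp _ _))
        ((congrArg T.map (inl_comp f f' _)).trans (T.map_comp _ _)) (mapGray_comp_left T f f' g)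
    map₂_whisker_left f _ _ α := by
      refine FunSL.hom₂_ext fun y => ?_
      simp only [FunSL.app₂_comp, FunSL.app₂_eqToHom]
      refine (congrArg T.map₂ (inl₂_whiskerLeft P Q f α y)).trans ?_
      simp only [T.map₂_comp, map₂_eqToHom', map₂_wL]
      simp
      rfl
    map₂_whisker_right α f := by
      refine FunSL.hom₂_ext fun y => ?_
      simp only [FunSL.app₂_comp, FunSL.app₂_eqToHom]
      refine (congrArg T.map₂ (inl₂_whiskerRight P Q α f y)).trans ?_
      simp only [T.map₂_comp, map₂_eqToHom', map₂_wR]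
      simp
      rfl }
end
end Gray

section act
variable {X : Type u₁} [Bicategory.{w₁, v₁} X] (T : StrictPseudofunctor X Cat.{v₃, u₃})

/-- The functor `T u : T p ⥤ T q` for a 1-cell `u : p ⟶ q`. -/
abbrev act {p q : X} (u : p ⟶ q) : T.obj p ⥤ T.obj q := (T.map u).toFunctor

/-- The component at `x` of the natural transformation `T α`. -/
abbrev act₂ {p q : X} {u v : p ⟶ q} (α : u ⟶ v) (x : T.obj p) : (act T u).obj x ⟶ (act T v).obj x :=
  (T.map₂ α).toNatTrans.app x

variable {T}

theorem act_congr {p q : X} {u v : p ⟶ q} (h : u = v) (x : T.obj p) :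
    (act T u).obj x = (act T v).obj x := by rw [h]

theorem act_id_obj {p : X} (x : T.obj p) : (act T (𝟙 p)).obj x = x :=
  congrArg (fun F : T.obj p ⟶ T.obj p => F.toFunctor.obj x) (T.map_id p)

theorem act_comp_obj {p q r : X} (u : p ⟶ q) (v : q ⟶ r) (x : T.obj p) :
    (act T (u ≫ v)).obj x = (act T v).obj ((act T u).obj x) :=
  congrArg (fun F : T.obj p ⟶ T.obj r => F.toFunctor.obj x) (T.map_comp u v)

theorem act_comp_map {p q r : X} (u : p ⟶ q) (v : q ⟶ r) {x y : T.obj p} (m : x ⟶ y) :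
    (act T (u ≫ v)).map m = eqToHom (act_comp_obj u v x) ≫ (act T v).map ((act T u).map m) ≫
      eqToHom (act_comp_obj u v y).symm :=
  Functor.congr_hom (congrArg Cat.Hom.toFunctor (T.map_comp u v)) m

end act

section
variable {A : Type u₁} [Bicategory.{w₁, v₁} A] [Strict A]
  (T : StrictPseudofunctor (Aᵒᵖ × A) Cat.{v₃, u₃})

/-- The 1-cell `(1, f)` of `Aᵒᵖ × A`. -/
def push (x : Aᵒᵖ) {a b : A} (f : a ⟶ b) : ((x, a) : Aᵒᵖ × A) ⟶ (x, b) := (𝟙 x, f)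
/-- The 1-cell `(f, 1)` of `Aᵒᵖ × A`. -/
def pull {a b : A} (f : a ⟶ b) (y : A) : ((op b, y) : Aᵒᵖ × A) ⟶ (op a, y) := (f.op, 𝟙 y)

/-- The 2-cell `(1, α)` of `Aᵒᵖ × A`. -/
def push₂ (x : Aᵒᵖ) {a b : A} {f g : a ⟶ b} (α : f ⟶ g) : push x f ⟶ push x g := (𝟙 (𝟙 x), α)
/-- The 2-cell `(α, 1)` of `Aᵒᵖ × A`. -/
def pull₂ {a b : A} {f g : a ⟶ b} (α : f ⟶ g) (y : A) : pull f y ⟶ pull g y := (op2 α, 𝟙 (𝟙 y))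

theorem push_id (x : Aᵒᵖ) (a : A) : push x (𝟙 a) = 𝟙 (x, a) := rfl
theorem pull_id (a y : A) : pull (𝟙 a) y = 𝟙 (op a, y) := rfl
theorem push_comp (x : Aᵒᵖ) {a b c : A} (f : a ⟶ b) (g : b ⟶ c) :
    push x (f ≫ g) = push x f ≫ push x g := Prod.ext (Strict.id_comp (𝟙 x)).symm rfl
theorem pull_comp {a b c : A} (f : a ⟶ b) (g : b ⟶ c) (y : A) :
    pull (f ≫ g) y = pull g y ≫ pull f y := Prod.ext rfl (Strict.id_comp (𝟙 y)).symm
theorem pull_push {a b c d : A} (f : a ⟶ b) (g : c ⟶ d) :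
    pull f c ≫ push (op a) g = push (op b) g ≫ pull f d :=
  Prod.ext ((Strict.comp_id f.op).trans (Strict.id_comp f.op).symm)
    ((Strict.id_comp g).trans (Strict.comp_id g).symm)

theorem push_pull_id {T : StrictPseudofunctor (Aᵒᵖ × A) Cat.{v₃, u₃}} (a : A) (x : T.obj (op a, a)) :
    (act T (push (op a) (𝟙 a))).obj x = (act T (pull (𝟙 a) a)).obj x := rfl

/-- The lax end of a 2-functor `T : Aᵒᵖ × A ⟶ Cat`, constructed explicitly. An object is a lax wedge
from the terminal category: objects `pt a` of `T (a, a)` and morphisms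
`cell f : T (1, f) (pt a) ⟶ T (f, 1) (pt b)` for `f : a ⟶ b`, with `cell 1 = 1`, natural in 2-cells
`f ⟶ g`, and such that `cell (f ≫ g)` is `T (1, g) (cell f)` followed by `T (f, 1) (cell g)`. The
universal property is proved in `LaxWedge.equivFunctor` and `LaxWedge.homEquiv`. -/
structure LaxEnd where
  pt (a : A) : T.obj (op a, a)
  cell {a b : A} (f : a ⟶ b) : (act T (push (op a) f)).obj (pt a) ⟶ (act T (pull f b)).obj (pt b)
  cell_id (a : A) : cell (𝟙 a) = eqToHom (push_pull_id a (pt a))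
  cell_naturality {a b : A} {f g : a ⟶ b} (α : f ⟶ g) :
    cell f ≫ act₂ T (pull₂ α b) (pt b) = act₂ T (push₂ (op a) α) (pt a) ≫ cell g
  cell_comp {a b c : A} (f : a ⟶ b) (g : b ⟶ c) : cell (f ≫ g) =
    eqToHom ((act_congr (push_comp (op a) f g) (pt a)).trans (act_comp_obj _ _ _)) ≫
      (act T (push (op a) g)).map (cell f) ≫
        eqToHom ((act_comp_obj _ _ _).symm.trans
          ((act_congr (pull_push f g) (pt b)).trans (act_comp_obj _ _ _))) ≫
          (act T (pull f c)).map (cell g) ≫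
            eqToHom ((act_congr (pull_comp f g c) (pt c)).trans (act_comp_obj _ _ _)).symm

namespace LaxEnd
variable {T}

/-- A morphism of the lax end: a modification of wedges. -/
@[ext]
structure Hom (x y : LaxEnd T) where
  app (a : A) : x.pt a ⟶ y.pt a
  comm {a b : A} (f : a ⟶ b) : (act T (push (op a) f)).map (app a) ≫ y.cell f =
    x.cell f ≫ (act T (pull f b)).map (app b)

instance : Category (LaxEnd T) where
  Hom := Hom
  id x := { app a := 𝟙 _, comm f := by simp }
  comp s t :=
    { app a := s.app a ≫ t.app a
      comm f := by
        simp only [Functor.map_comp, Category.assoc]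
        rw [t.comm, ← Category.assoc, s.comm, Category.assoc] }
  id_comp s := Hom.ext (funext fun a => Category.id_comp _)
  comp_id s := Hom.ext (funext fun a => Category.comp_id _)
  assoc s t u := Hom.ext (funext fun a => Category.assoc _ _ _)

theorem obj_ext {x y : LaxEnd T} (h : ∀ a, x.pt a = y.pt a)
    (h' : ∀ {a b : A} (f : a ⟶ b), x.cell f = eqToHom (by rw [h]) ≫ y.cell f ≫
      eqToHom (by rw [h])) : x = y := by
  rcases x with ⟨p, c, _, _, _⟩
  rcases y with ⟨p', c', _, _, _⟩
  obtain rfl : p = p' := funext h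
  have : @c = @c' := by
    funext x y f
    simpa using h' f
  subst this
  rfl

theorem hom_ext {x y : LaxEnd T} {s t : x ⟶ y} (h : ∀ a, s.app a = t.app a) : s = t :=
  Hom.ext (funext h)

theorem eqToHom_app {x y : LaxEnd T} (h : x = y) (a : A) :
    (eqToHom h : x ⟶ y).app a = eqToHom (by rw [h]) := by
  cases h; rfl

theorem comp_app {x y z : LaxEnd T} (s : x ⟶ y) (t : y ⟶ z) (a : A) :
    (s ≫ t).app a = s.app a ≫ t.app a := rfl

theorem conj_app {x y z w : LaxEnd T} (h : x = y) (s : y ⟶ z) (h' : z = w) (a : A) :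
    Hom.app (eqToHom h ≫ s ≫ eqToHom h') a =
      eqToHom (by rw [h]) ≫ Hom.app s a ≫ eqToHom (by rw [h']) := by
  rw [comp_app, comp_app, eqToHom_app, eqToHom_app]

variable (T) in
/-- The projection of the lax end to `T (a, a)`. -/
def proj (a : A) : LaxEnd T ⥤ T.obj (op a, a) where
  obj x := x.pt a
  map s := s.app a
end LaxEnd

end

namespace FunSL
section
variable {X : Type u₁} [Bicategory.{w₁, v₁} X] {P : FStr X} {F G : FunSL P Cat.{v₃, u₃}} (η : F ⟶ G)

/-- The component at `p` of a semi-strict transformation of `Cat`-valued 2-functors. -/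
abbrev at' (p : X) : F.functor.obj p ⥤ G.functor.obj p :=
  Cat.Hom.toFunctor (C := F.functor.obj p) (D := G.functor.obj p) (η.trans.app p)

/-- The lax naturality cell of `η` at `u`, evaluated at the object `x`. -/
def nat {p q : X} (u : p ⟶ q) (x : F.functor.obj p) :
    (act G.functor u).obj ((at' η p).obj x) ⟶ (at' η q).obj ((act F.functor u).obj x) :=
  (η.trans.naturality u).toNatTrans.app x

theorem nat_map {p q : X} (u : p ⟶ q) {x y : F.functor.obj p} (m : x ⟶ y) :
    (act G.functor u).map ((at' η p).map m) ≫ nat η u y =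
      nat η u x ≫ (at' η q).map ((act F.functor u).map m) :=
  (η.trans.naturality u).toNatTrans.naturality m

theorem nat_map₂ {p q : X} {u v : p ⟶ q} (α : u ⟶ v) (x : F.functor.obj p) :
    act₂ G.functor α ((at' η p).obj x) ≫ nat η v x =
      nat η u x ≫ (at' η q).map (act₂ F.functor α x) :=
  (congrArg (fun (t : (η.trans.app p ≫ G.lax.map u ⟶ F.lax.map v ≫ η.trans.app q)) =>
    t.toNatTrans.app x) (η.trans.naturality_naturality α)).symm

theorem strict_obj {p q : X} {u : p ⟶ q} (h : P.Tight u) (x : F.functor.obj p) :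
    (act G.functor u).obj ((at' η p).obj x) = (at' η q).obj ((act F.functor u).obj x) := by
  obtain ⟨h, _⟩ := η.strict u h
  exact congrArg (fun t : F.functor.obj p ⟶ G.functor.obj q => t.toFunctor.obj x) h

theorem nat_tight {p q : X} {u : p ⟶ q} (h : P.Tight u) (x : F.functor.obj p) :
    nat η u x = eqToHom (strict_obj η h x) := by
  obtain ⟨h, e⟩ := η.strict u h
  unfold nat
  rw [e]
  exact Cat.eqToHom_app _ _ h x

theorem nat_congr {p q : X} {u v : p ⟶ q} (h : u = v) (x : F.functor.obj p) :
    nat η u x = eqToHom (by rw [h]) ≫ nat η v x ≫ eqToHom (by rw [h]) := by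
  cases h; simp

theorem aux_nat_comp {a b c a' b' c' : Cat.{v₃, u₃}} {p : a ⟶ a'} {q : b ⟶ b'} {r : c ⟶ c'}
    {f : a ⟶ b} {g : b ⟶ c} {h : a ⟶ c} (e : h = f ≫ g) {f' : a' ⟶ b'} {g' : b' ⟶ c'}
    {h' : a' ⟶ c'} (e' : h' = f' ≫ g') (σ : p ≫ f' ⟶ f ≫ q) (τ : q ≫ g' ⟶ g ≫ r)
    {κ : p ≫ h' ⟶ h ≫ r}
    (hκ : p ◁ (eqToIso e').inv ≫ κ = (α_ _ _ _).inv ≫ σ ▷ g' ≫ (α_ _ _ _).hom ≫ f ◁ τ ≫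
      (α_ _ _ _).inv ≫ (eqToIso e).inv ▷ r) (x : a) :
    κ.toNatTrans.app x =
      eqToHom (congrArg (fun F : a' ⟶ c' => F.toFunctor.obj (p.toFunctor.obj x)) e') ≫
        g'.toFunctor.map (σ.toNatTrans.app x) ≫ τ.toNatTrans.app (f.toFunctor.obj x) ≫
          eqToHom (congrArg (fun F : a ⟶ c => r.toFunctor.obj (F.toFunctor.obj x)) e).symm := by
  subst e e'
  have := congrArg (fun t => t.toNatTrans.app x) hκ
  simpa using this

theorem nat_comp {p q r : X} (u : p ⟶ q) (v : q ⟶ r) (x : F.functor.obj p) :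
    nat η (u ≫ v) x = eqToHom (act_comp_obj u v _) ≫ (act G.functor v).map (nat η u x) ≫
      nat η v ((act F.functor u).obj x) ≫
        eqToHom (congrArg (at' η r).obj (act_comp_obj u v x).symm) := by
  have := η.trans.naturality_comp u v
  simp only [FunSL.lax, Pseudofunctor.toLax_mapComp, StrictPseudofunctor.mapComp_eq_eqToIso] at this
  exact aux_nat_comp _ _ _ _ this x
end
end FunSL

namespace FunSL
section
variable {X : Type u₁} [Bicategory.{w₁, v₁} X] {P : FStr X} {F G : FunSL P Cat.{v₃, u₃}}
    {η θ : F ⟶ G} (Γ : η ⟶ θ)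

/-- The component at `p` of a modification, evaluated at the object `x`. -/
def modApp (p : X) (x : F.functor.obj p) : (at' η p).obj x ⟶ (at' θ p).obj x :=
  (app₂ Γ p).toNatTrans.app x

theorem modApp_naturality (p : X) {x y : F.functor.obj p} (m : x ⟶ y) :
    (at' η p).map m ≫ modApp Γ p y = modApp Γ p x ≫ (at' θ p).map m :=
  (app₂ Γ p).toNatTrans.naturality m

theorem modApp_nat {p q : X} (u : p ⟶ q) (x : F.functor.obj p) :
    (act G.functor u).map (modApp Γ p x) ≫ nat θ u x =
      nat η u x ≫ modApp Γ q ((act F.functor u).obj x) :=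
  congrArg (fun (t : (η.trans.app p ≫ G.lax.map u ⟶ F.lax.map u ≫ θ.trans.app q)) =>
    t.toNatTrans.app x) ((Lax.LaxTrans.Hom.as Γ).naturality u)

theorem nat_id (F : FunSL P Cat.{v₃, u₃}) {p q : X} (u : p ⟶ q) (x : F.functor.obj p) :
    nat (𝟙 F) u x = 𝟙 ((act F.functor u).obj x) := by
  have : nat (𝟙 F) u x = 𝟙 ((act F.functor u).obj x) ≫ 𝟙 ((act F.functor u).obj x) := rfl
  rw [this, Category.comp_id]

theorem nat_comp_trans {F G H : FunSL P Cat.{v₃, u₃}} (η : F ⟶ G) (θ : G ⟶ H) {p q : X}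
    (u : p ⟶ q) (x : F.functor.obj p) :
    nat (η ≫ θ) u x = nat θ u ((at' η p).obj x) ≫ (at' θ q).map (nat η u x) := by
  have : nat (η ≫ θ) u x = 𝟙 _ ≫ nat θ u ((at' η p).obj x) ≫ 𝟙 _ ≫ (at' θ q).map (nat η u x) ≫
    𝟙 _ := rfl
  rw [this]
  simp only [Category.id_comp, Category.comp_id]
  rfl
end
end FunSL

namespace LaxEnd
section
variable {A : Type u₁} [Bicategory.{w₁, v₁} A] [Strict A]

theorem tight_pull {a b : A} (f : a ⟶ b) (y : A) : (FStr.fst Aᵒᵖ A).Tight (pull f y) :=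
  .mk f.op y

variable {F G : FunSL (FStr.fst Aᵒᵖ A) Cat.{v₃, u₃}} (η : F ⟶ G)

open FunSL

/-- The wedge induced by a wedge `x` for `F` and a semi-strict `η : F ⟶ G`: its points are
`η (pt a)`, and its cell at `f` is the lax naturality cell of `η` at `(1, f)`, followed by
`η (cell f)` and by the identity `η (T (f, 1) (pt b)) = T (f, 1) (η (pt b))`, which holds because
`(f, 1)` is tight. -/
def mapObj (x : LaxEnd F.functor) : LaxEnd G.functor where
  pt a := (at' η (op a, a)).obj (x.pt a)
  cell {a b} f := nat η (push (op a) f) (x.pt a) ≫ (at' η (op a, b)).map (x.cell f) ≫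
    eqToHom (strict_obj η (tight_pull f b) (x.pt b)).symm
  cell_id a := by
    rw [x.cell_id, eqToHom_map, eqToHom_trans,
      nat_tight η (u := push (op a) (𝟙 a)) (tight_pull (𝟙 a) a), eqToHom_trans]
  cell_naturality {a b f g} α := by
    have h1 := nat_map₂ η (push₂ (op a) α) (x.pt a)
    have h2 := nat_map₂ η (pull₂ α b) (x.pt b)
    have h3 := congrArg (at' η (op a, b)).map (x.cell_naturality α)
    rw [nat_tight η (tight_pull f b), nat_tight η (tight_pull g b)] at h2
    rw [comp_eqToHom_iff] at h2
    simp only [Functor.map_comp] at h3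
    simp only [h2, Category.assoc, eqToHom_trans_assoc, eqToHom_refl, Category.id_comp,
      reassoc_of% h3, reassoc_of% h1]
  cell_comp {a b c} f g := by
    have h1 := nat_congr η (push_comp (op a) f g) (x.pt a)
    rw [nat_comp] at h1
    have h2 := nat_map η (push (op a) g) (x.cell f)
    have h3 := nat_congr η (pull_push f g) (x.pt b)
    rw [nat_comp, nat_comp, nat_tight η (tight_pull f b), nat_tight η (tight_pull f c)] at h3
    have h4 := nat_map η (pull f c) (x.cell g)
    rw [nat_tight η (tight_pull f c), nat_tight η (tight_pull f c)] at h4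
    simp only [eqToHom_map, eqToHom_trans, Category.assoc, eqToHom_trans_assoc,
      eqToHom_comp_iff, comp_eqToHom_iff] at h3 h4
    rw [h1]
    simp only [x.cell_comp, Functor.map_comp, eqToHom_map, Category.assoc,
      eqToHom_trans_assoc, eqToHom_trans, eqToHom_refl, Category.id_comp, ← reassoc_of% h2]
    simp only [h3, h4, Category.assoc, eqToHom_trans_assoc, eqToHom_trans]

/-- The functor between lax ends induced by a semi-strict transformation. -/
def map : LaxEnd F.functor ⥤ LaxEnd G.functor where
  obj := mapObj η
  map {x y} s :=
    { app a := (at' η (op a, a)).map (s.app a)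
      comm {a b} f := by
        have h1 := nat_map η (push (op a) f) (s.app a)
        have h2 := nat_map η (pull f b) (s.app b)
        have h3 := congrArg (at' η (op a, b)).map (s.comm f)
        rw [nat_tight η (tight_pull f b), nat_tight η (tight_pull f b), comp_eqToHom_iff] at h2
        simp only [Functor.map_comp] at h3
        simp only [mapObj, h2, Category.assoc, eqToHom_trans_assoc, eqToHom_refl, Category.id_comp,
          reassoc_of% h1, reassoc_of% h3] }
  map_id x := LaxEnd.hom_ext fun a => (at' η (op a, a)).map_id _
  map_comp s t := LaxEnd.hom_ext fun a => (at' η (op a, a)).map_comp _ _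

variable {η} in
/-- The natural transformation between lax ends induced by a modification. -/
def map₂ {θ : F ⟶ G} (Γ : η ⟶ θ) : map η ⟶ map θ where
  app x :=
    { app a := modApp Γ (op a, a) (x.pt a)
      comm {a b} f := by
        have h1 := modApp_nat Γ (push (op a) f) (x.pt a)
        have h2 := modApp_nat Γ (pull f b) (x.pt b)
        have h3 := modApp_naturality Γ (op a, b) (x.cell f)
        rw [nat_tight η (tight_pull f b), nat_tight θ (tight_pull f b), comp_eqToHom_iff] at h2
        simp only [map, mapObj, h2, Category.assoc, eqToHom_trans_assoc, eqToHom_refl,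
          Category.id_comp, reassoc_of% h1, reassoc_of% h3] }
  naturality x y s := LaxEnd.hom_ext fun a => modApp_naturality Γ (op a, a) (s.app a)

end

section
variable (A : Type u₁) [Bicategory.{w₁, v₁} A] [Strict A]
open FunSL

theorem mapObj_id {F : FunSL (FStr.fst Aᵒᵖ A) Cat.{v₃, u₃}} (x : LaxEnd F.functor) :
    mapObj (𝟙 F) x = x := by
  refine obj_ext (fun a => rfl) fun f => ?_
  have h : (mapObj (𝟙 F) x).cell f = 𝟙 _ ≫ x.cell f ≫ 𝟙 _ := by
    change nat (𝟙 F) _ _ ≫ x.cell f ≫ 𝟙 _ = _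
    rw [nat_id]; rfl
  rw [h]; rfl

theorem map_id' (F : FunSL (FStr.fst Aᵒᵖ A) Cat.{v₃, u₃}) : map (𝟙 F) = 𝟭 (LaxEnd F.functor) := by
  refine CategoryTheory.Functor.ext (fun x => mapObj_id A x) ?_
  intro x y s
  refine hom_ext fun a => ?_
  refine Eq.trans ?_ (conj_app _ _ _ a).symm
  exact ((Category.id_comp (s.app a ≫ 𝟙 _)).trans (Category.comp_id (s.app a))).symm

theorem aux_mapObj_comp {C : Type u₁} [Category.{v₁} C] {D : Type u₂} [Category.{v₂} D] (K : C ⥤ D)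
    {X V : D} {Y Z W W' : C} (α : X ⟶ K.obj Y) (β : Y ⟶ Z) (γ : Z ⟶ W) (h : W = W')
    (h' : K.obj W = V) (h'' : K.obj W' = V) :
    (α ≫ K.map β) ≫ K.map γ ≫ eqToHom h' = α ≫ K.map (β ≫ γ ≫ eqToHom h) ≫ eqToHom h'' := by
  subst h
  simp

theorem mapObj_comp {F G H : FunSL (FStr.fst Aᵒᵖ A) Cat.{v₃, u₃}} (η : F ⟶ G) (θ : G ⟶ H)
    (x : LaxEnd F.functor) : mapObj (η ≫ θ) x = mapObj θ (mapObj η x) := by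
  refine obj_ext (fun a => rfl) fun {a b} f => ?_
  have h : (mapObj (η ≫ θ) x).cell f = (mapObj θ (mapObj η x)).cell f := by
    change nat (η ≫ θ) (push (op a) f) (x.pt a) ≫ _ = _
    rw [nat_comp_trans]
    exact aux_mapObj_comp (at' θ (op a, b)) _ _ _ _ _ _
  rw [h]
  exact ((Category.id_comp _).trans (Category.comp_id _)).symm

theorem map_comp' {F G H : FunSL (FStr.fst Aᵒᵖ A) Cat.{v₃, u₃}} (η : F ⟶ G) (θ : G ⟶ H) :
    map (η ≫ θ) = (map η ⋙ map θ : LaxEnd F.functor ⥤ LaxEnd H.functor) := by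
  refine CategoryTheory.Functor.ext (fun x => mapObj_comp A η θ x) ?_
  intro x y s
  refine hom_ext fun a => ?_
  refine Eq.trans ?_ (conj_app _ _ _ a).symm
  exact ((Category.id_comp (((map η ⋙ map θ).map s).app a ≫ 𝟙 _)).trans (Category.comp_id (((map η ⋙ map θ).map s).app a))).symm

theorem aux_eqToHom {C : Cat.{max u₁ v₃, max u₁ v₁ u₃ v₃}}
    {T : StrictPseudofunctor (Aᵒᵖ × A) Cat.{v₃, u₃}} {F G : C ⟶ Cat.of (LaxEnd T)} (h : F = G)
    (x : C) (a : A) : Hom.app ((eqToHom h).toNatTrans.app x) a =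
      eqToHom (congrArg (fun F : C ⟶ Cat.of (LaxEnd T) => LaxEnd.pt (F.toFunctor.obj x) a) h) := by
  cases h; rfl

theorem aux_conj {C : Cat.{max u₁ v₃, max u₁ v₁ u₃ v₃}}
    {T : StrictPseudofunctor (Aᵒᵖ × A) Cat.{v₃, u₃}} {F G H K : C ⟶ Cat.of (LaxEnd T)}
    (h : F = G) (α : G ⟶ H) (h' : H = K) (x : C) (a : A) :
    Hom.app ((eqToHom h ≫ α ≫ eqToHom h').toNatTrans.app x) a =
      eqToHom (congrArg (fun F : C ⟶ Cat.of (LaxEnd T) => LaxEnd.pt (F.toFunctor.obj x) a) h) ≫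
        Hom.app (α.toNatTrans.app x) a ≫
      eqToHom (congrArg (fun F : C ⟶ Cat.of (LaxEnd T) => LaxEnd.pt (F.toFunctor.obj x) a) h') := by
  cases h; cases h'; simp

/-- The 2-functor that sends `T : Aᵒᵖ × A ⟶ Cat` to its lax end, on the 2-category of 2-functors
and semi-strict transformations for the `F`-category structure on `Aᵒᵖ × A` with tight 1-cells
`(f, 1)`. -/
def laxEnd : StrictPseudofunctor (FunSL (FStr.fst Aᵒᵖ A) Cat.{v₃, u₃})
    Cat.{max u₁ v₃, max u₁ v₁ u₃ v₃} := StrictPseudofunctor.mk''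
  { obj F := Cat.of (LaxEnd F.functor)
    map η := (map η).toCatHom
    map₂ Γ := NatTrans.toCatHom₂ (map₂ Γ)
    map₂_id η := rfl
    map₂_comp Γ Λ := rfl
    map_id F := congrArg Functor.toCatHom (map_id' A F)
    map_comp η θ := congrArg Functor.toCatHom (map_comp' A η θ)
    map₂_whisker_left η _ _ Γ := by
      ext x
      refine hom_ext fun a => ?_
      refine Eq.trans ?_ (aux_conj A _ _ _ x a).symm
      exact ((Category.id_comp _).trans (Category.comp_id _)).symm
    map₂_whisker_right Γ η := by
      ext x
      refine hom_ext fun a => ?_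
      refine Eq.trans ?_ (aux_conj A _ _ _ x a).symm
      exact ((Category.id_comp _).trans (Category.comp_id _)).symm }
end
end LaxEnd

section
variable {A : Type u₁} [Bicategory.{w₁, v₁} A] [Strict A]
  (T : StrictPseudofunctor (Aᵒᵖ × A) Cat.{v₃, u₃}) (C : Type u₄) [Category.{v₄} C]

/-- A lax wedge from a category `C` to a 2-functor `T : Aᵒᵖ × A ⟶ Cat`. -/
structure LaxWedge where
  leg (a : A) : C ⥤ T.obj (op a, a)
  cell {a b : A} (f : a ⟶ b) : leg a ⋙ act T (push (op a) f) ⟶ leg b ⋙ act T (pull f b)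
  cell_id (a : A) (x : C) : (cell (𝟙 a)).app x = eqToHom (push_pull_id a ((leg a).obj x))
  cell_naturality {a b : A} {f g : a ⟶ b} (α : f ⟶ g) (x : C) :
    (cell f).app x ≫ act₂ T (pull₂ α b) ((leg b).obj x) =
      act₂ T (push₂ (op a) α) ((leg a).obj x) ≫ (cell g).app x
  cell_comp {a b c : A} (f : a ⟶ b) (g : b ⟶ c) (x : C) : (cell (f ≫ g)).app x =
    eqToHom ((act_congr (push_comp (op a) f g) ((leg a).obj x)).trans (act_comp_obj _ _ _)) ≫
      (act T (push (op a) g)).map ((cell f).app x) ≫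
        eqToHom ((act_comp_obj _ _ _).symm.trans
          ((act_congr (pull_push f g) ((leg b).obj x)).trans (act_comp_obj _ _ _))) ≫
          (act T (pull f c)).map ((cell g).app x) ≫
            eqToHom ((act_congr (pull_comp f g c) ((leg c).obj x)).trans (act_comp_obj _ _ _)).symm

namespace LaxWedge
variable {T C}

/-- A modification of lax wedges. -/
@[ext]
structure Hom (W V : LaxWedge T C) where
  app (a : A) : W.leg a ⟶ V.leg a
  comm {a b : A} (f : a ⟶ b) : Functor.whiskerRight (app a) (act T (push (op a) f)) ≫ V.cell f =
    W.cell f ≫ Functor.whiskerRight (app b) (act T (pull f b))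

/-- The universal property of the lax end, on 1-cells. -/
def equivFunctor : LaxWedge T C ≃ (C ⥤ LaxEnd T) where
  toFun W :=
    { obj x :=
        { pt a := (W.leg a).obj x
          cell f := (W.cell f).app x
          cell_id a := W.cell_id a x
          cell_naturality α := W.cell_naturality α x
          cell_comp f g := W.cell_comp f g x }
      map m :=
        { app a := (W.leg a).map m
          comm f := (W.cell f).naturality m }
      map_id x := LaxEnd.hom_ext fun a => (W.leg a).map_id x
      map_comp m n := LaxEnd.hom_ext fun a => (W.leg a).map_comp m n }
  invFun F :=
    { leg a := F ⋙ LaxEnd.proj T a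
      cell f :=
        { app x := (F.obj x).cell f
          naturality x y m := (F.map m).comm f }
      cell_id a x := (F.obj x).cell_id a
      cell_naturality α x := (F.obj x).cell_naturality α
      cell_comp f g x := (F.obj x).cell_comp f g }
  left_inv W := rfl
  right_inv F := rfl

/-- The universal property of the lax end, on 2-cells. -/
def homEquiv (W V : LaxWedge T C) : Hom W V ≃ (equivFunctor W ⟶ equivFunctor V) where
  toFun s :=
    { app x :=
        { app a := (s.app a).app x
          comm f := congrArg (fun t => t.app x) (s.comm f) }
      naturality x y m := LaxEnd.hom_ext fun a => (s.app a).naturality m }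
  invFun t :=
    { app a :=
        { app x := (t.app x).app a
          naturality x y m := congrArg (fun s => LaxEnd.Hom.app s a) (t.naturality m) }
      comm f := by
        ext x
        exact (t.app x).comm f }
  left_inv s := rfl
  right_inv t := rfl
end LaxWedge
end

section
variable {A : Type u₁} [Bicategory.{w₁, v₁} A] [Strict A] {B : Type u₂} [Bicategory.{w₂, v₂} B] [Strict B]

theorem unop2_conj {X : Type u₁} [Bicategory.{w₁, v₁} X] {a b : Xᵒᵖ} {f g h k : a ⟶ b} (e : f = g)
    (α : g ⟶ h) (e' : h = k) : (eqToHom e ≫ α ≫ eqToHom e').unop2 =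
      eqToHom (congrArg Quiver.Hom.unop e) ≫ α.unop2 ≫ eqToHom (congrArg Quiver.Hom.unop e') := by
  cases e; cases e'; simp

theorem fst_conj {X : Type u₁} [Bicategory.{w₁, v₁} X] {Y : Type u₂} [Bicategory.{w₂, v₂} Y]
    {a b : X × Y} {f g h k : a ⟶ b} (e : f = g) (α : g ⟶ h) (e' : h = k) :
    (eqToHom e ≫ α ≫ eqToHom e').1 =
      eqToHom (congrArg Prod.fst e) ≫ α.1 ≫ eqToHom (congrArg Prod.fst e') := by
  cases e; cases e'; simp

theorem snd_conj {X : Type u₁} [Bicategory.{w₁, v₁} X] {Y : Type u₂} [Bicategory.{w₂, v₂} Y]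
    {a b : X × Y} {f g h k : a ⟶ b} (e : f = g) (α : g ⟶ h) (e' : h = k) :
    (eqToHom e ≫ α ≫ eqToHom e').2 =
      eqToHom (congrArg Prod.snd e) ≫ α.2 ≫ eqToHom (congrArg Prod.snd e') := by
  cases e; cases e'; simp

variable (A B) in
/-- The 2-functor `(A ⊗ B)ᵒᵖ × (A ⊗ B) ⟶ Aᵒᵖ × Bᵒᵖ × (A ⊗ B)` induced by the quotient map
`A ⊗ B ⟶ A × B` in the contravariant variable. -/
def quotMap : StrictPseudofunctor ((LaxGray A B)ᵒᵖ × LaxGray A B) (Aᵒᵖ × Bᵒᵖ × LaxGray A B) :=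
  StrictPseudofunctor.mk''
  { obj p := (op p.1.unop.fst, op p.1.unop.snd, p.2)
    map s := (((LaxGray.toProd A B).map s.1.unop).1.op, ((LaxGray.toProd A B).map s.1.unop).2.op, s.2)
    map₂ η := (op2 ((LaxGray.toProd A B).map₂ η.1.unop2).1,
      op2 ((LaxGray.toProd A B).map₂ η.1.unop2).2, η.2)
    map₂_id s := by
      have h := (LaxGray.toProd A B).map₂_id s.1.unop
      exact prod_hom₂_ext (op_hom2_ext (congrArg (fun t => Prod.fst t) h))
        (prod_hom₂_ext (op_hom2_ext (congrArg (fun t => Prod.snd t) h)) rfl)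
    map₂_comp η θ := by
      have h := (LaxGray.toProd A B).map₂_comp η.1.unop2 θ.1.unop2
      exact prod_hom₂_ext (op_hom2_ext (congrArg (fun t => Prod.fst t) h))
        (prod_hom₂_ext (op_hom2_ext (congrArg (fun t => Prod.snd t) h)) rfl)
    map_id p := by
      have h := (LaxGray.toProd A B).map_id p.1.unop
      exact Prod.ext (congrArg (fun t => (Prod.fst t).op) h)
        (Prod.ext (congrArg (fun t => (Prod.snd t).op) h) rfl)
    map_comp s t := by
      have h := (LaxGray.toProd A B).map_comp t.1.unop s.1.unop
      exact Prod.ext (congrArg (fun t => (Prod.fst t).op) h)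
        (Prod.ext (congrArg (fun t => (Prod.snd t).op) h) rfl)
    map₂_whisker_left s _ _ η := by
      have h := map₂_wR (LaxGray.toProd A B) η.1.unop2 s.1.unop
      refine prod_hom₂_ext (op_hom2_ext ((congrArg (fun t => Prod.fst t) h).trans ?_))
        (prod_hom₂_ext (op_hom2_ext ((congrArg (fun t => Prod.snd t) h).trans ?_)) ?_)
      · rw [fst_conj, fst_conj]
        symm
        refine (unop2_conj _ _ _).trans ?_
        rfl
      · rw [snd_conj, snd_conj, fst_conj]
        symm
        refine (unop2_conj _ _ _).trans ?_
        rfl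
      · rw [snd_conj, snd_conj]
        simp
    map₂_whisker_right η s := by
      have h := map₂_wL (LaxGray.toProd A B) s.1.unop η.1.unop2
      refine prod_hom₂_ext (op_hom2_ext ((congrArg (fun t => Prod.fst t) h).trans ?_))
        (prod_hom₂_ext (op_hom2_ext ((congrArg (fun t => Prod.snd t) h).trans ?_)) ?_)
      · rw [fst_conj, fst_conj]
        symm
        refine (unop2_conj _ _ _).trans ?_
        rfl
      · rw [snd_conj, snd_conj, fst_conj]
        symm
        refine (unop2_conj _ _ _).trans ?_
        rfl
      · rw [snd_conj, snd_conj]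
        simp }

/-- The 2-functor whose lax end is the two-variable lax end of `T`. -/
def twoVar (T : StrictPseudofunctor (Aᵒᵖ × Bᵒᵖ × LaxGray A B) Cat.{v₃, u₃}) :
    StrictPseudofunctor ((LaxGray A B)ᵒᵖ × LaxGray A B) Cat.{v₃, u₃} := (quotMap A B).comp T

/-- The transpose `Aᵒᵖ × A ⟶ FunSL (Bᵒᵖ × B) Cat`, `(a, a') ↦ T (a, -, a', -)`, of `T ∘ j`. -/
def transpose (T : StrictPseudofunctor (Aᵒᵖ × Bᵒᵖ × LaxGray A B) Cat.{v₃, u₃}) :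
    StrictPseudofunctor (Aᵒᵖ × A) (FunSL (FStr.fst Bᵒᵖ B) Cat.{v₃, u₃}) :=
  Gray.curry ((jFunctor Aᵒᵖ A Bᵒᵖ B).comp T)

/-- The 2-functor `(a, a') ↦ ∫_b T (a, b, a', b)`: the composite of the transpose of
`T ∘ j` with the 2-functor `laxEnd B`. -/
def innerEnd (T : StrictPseudofunctor (Aᵒᵖ × Bᵒᵖ × LaxGray A B) Cat.{v₃, u₃}) :
    StrictPseudofunctor (Aᵒᵖ × A) Cat.{max u₂ v₃, max u₂ v₂ u₃ v₃} :=
  (transpose T).comp (LaxEnd.laxEnd B)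

end

end LaxFubini

open LaxFubini

/-!
A lax wedge on a Gray tensor product is determined by its cells at the generating 1-cells `(f, 1)`
and `(1, g)`, and a choice of such cells extends to a lax wedge as soon as it respects the relations
in each variable and is compatible with the 2-cells `Σ_{f,g}`. These are the data of an object `s`
of the iterated lax end: the cells at `(1, g)` are those of the objects `s_a` of the lax end over
`B`, and the cells at `(f, 1)` are the components of the morphisms `s_f`. Compatibility with
`Σ_{f,g}` says precisely that `s_f` is a morphism of the lax end over `B`.
-/

namespace LaxFubini

section HEq

theorem eq_iff_heq_of_heq {α β γ : Sort u₁} {x y : α} {x' : β} {y' : γ}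
    (hx : x ≍ x') (hy : y ≍ y') : x = y ↔ x' ≍ y' :=
  ⟨fun h => hx.symm.trans ((heq_of_eq h).trans hy),
    fun h => eq_of_heq (hx.trans (h.trans hy.symm))⟩

theorem prod_hom₂_heq {X : Type u₁} [Bicategory.{w₁, v₁} X] {Y : Type u₂}
    [Bicategory.{w₂, v₂} Y] {p q : X × Y} {u u' v v' : p ⟶ q} {α : u ⟶ v} {β : u' ⟶ v'}
    (hu : u = u') (hv : v = v') (h₁ : α.1 ≍ β.1) (h₂ : α.2 ≍ β.2) : α ≍ β := by
  subst hu hv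
  exact heq_of_eq (prod_hom₂_ext (eq_of_heq h₁) (eq_of_heq h₂))

theorem conj_eqToHom_refl {C : Type u₁} [Category.{v₁} C] {a b : C} (m : a ⟶ b) :
    eqToHom rfl ≫ m ≫ eqToHom rfl = m :=
  (Category.id_comp _).trans (Category.comp_id m)

theorem toNatTrans_app_heq {C D : Cat.{v₃, u₃}} {F F' G G' : C ⟶ D} {α : F ⟶ G} {β : F' ⟶ G'}
    (hF : F = F') (hG : G = G') (h : α ≍ β) (x : C) : α.toNatTrans.app x ≍ β.toNatTrans.app x := by
  subst hF hG h
  rfl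

variable {K : Type u₁} [Bicategory.{w₁, v₁} K] [Strict K]

theorem id_whiskerLeft_heq {a b : K} {u v : a ⟶ b} (α : u ⟶ v) : 𝟙 a ◁ α ≍ α := by
  refine (conj_eqToHom_iff_heq _ _ (Strict.id_comp u) (Strict.id_comp v)).1 ?_
  simp [Strict.leftUnitor_eqToIso]

theorem whiskerRight_id_heq {a b : K} {u v : a ⟶ b} (α : u ⟶ v) : α ▷ 𝟙 b ≍ α := by
  refine (conj_eqToHom_iff_heq _ _ (Strict.comp_id u) (Strict.comp_id v)).1 ?_
  simp [Strict.rightUnitor_eqToIso]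

theorem whiskerLeft_id_heq {a b c : K} {u : a ⟶ b} {v : b ⟶ c} {w : a ⟶ c} (h : u ≫ v = w) :
    u ◁ 𝟙 v ≍ 𝟙 w := by
  subst h
  rw [Bicategory.whiskerLeft_id]

theorem id_whiskerRight_heq {a b c : K} {u : a ⟶ b} {v : b ⟶ c} {w : a ⟶ c} (h : u ≫ v = w) :
    𝟙 u ▷ v ≍ 𝟙 w := by
  subst h
  rw [Bicategory.id_whiskerRight]

end HEq

section Action
variable {X : Type u₁} [Bicategory.{w₁, v₁} X] {S : StrictPseudofunctor X Cat.{v₃, u₃}}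

theorem act_id (p : X) : act S (𝟙 p) = 𝟭 (S.obj p) := congrArg Cat.Hom.toFunctor (S.map_id p)

theorem act_comp {p q r : X} (u : p ⟶ q) (v : q ⟶ r) : act S (u ≫ v) = act S u ⋙ act S v :=
  congrArg Cat.Hom.toFunctor (S.map_comp u v)

theorem act₂_id {p q : X} (u : p ⟶ q) (x : S.obj p) : act₂ S (𝟙 u) x = 𝟙 _ :=
  congrArg (fun t : S.map u ⟶ S.map u => t.toNatTrans.app x) (S.map₂_id u)

theorem act₂_comp {p q : X} {u v w : p ⟶ q} (α : u ⟶ v) (β : v ⟶ w) (x : S.obj p) :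
    act₂ S (α ≫ β) x = act₂ S α x ≫ act₂ S β x :=
  congrArg (fun t : S.map u ⟶ S.map w => t.toNatTrans.app x) (S.map₂_comp α β)

theorem act₂_naturality {p q : X} {u v : p ⟶ q} (α : u ⟶ v) {x y : S.obj p} (m : x ⟶ y) :
    (act S u).map m ≫ act₂ S α y = act₂ S α x ≫ (act S v).map m :=
  (S.map₂ α).toNatTrans.naturality m

theorem act₂_heq {p q : X} {u u' v v' : p ⟶ q} {α : u ⟶ v} {β : u' ⟶ v'} (hu : u = u')
    (hv : v = v') (h : α ≍ β) (x : S.obj p) : act₂ S α x ≍ act₂ S β x := by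
  subst hu hv h
  rfl

theorem act₂_whiskerLeft_heq {p q r : X} (u : p ⟶ q) {v w : q ⟶ r} (α : v ⟶ w) (x : S.obj p) :
    act₂ S (u ◁ α) x ≍ act₂ S α ((act S u).obj x) :=
  toNatTrans_app_heq (S.map_comp u v) (S.map_comp u w)
    ((conj_eqToHom_iff_heq' _ _ _ _).1 (map₂_wL S u α)) x

theorem act₂_whiskerRight_heq {p q r : X} {u v : p ⟶ q} (α : u ⟶ v) (w : q ⟶ r) (x : S.obj p) :
    act₂ S (α ▷ w) x ≍ (act S w).map (act₂ S α x) :=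
  toNatTrans_app_heq (S.map_comp u w) (S.map_comp v w)
    ((conj_eqToHom_iff_heq' _ _ _ _).1 (map₂_wR S α w)) x

end Action

section PushPull
variable {K : Type u₁} [Bicategory.{w₁, v₁} K] [Strict K]
  {S : StrictPseudofunctor (Kᵒᵖ × K) Cat.{v₃, u₃}}

theorem act_push_comp (x : Kᵒᵖ) {p q r : K} (u : p ⟶ q) (v : q ⟶ r) :
    act S (push x (u ≫ v)) = act S (push x u) ⋙ act S (push x v) :=
  (congrArg (act S) (push_comp x u v)).trans (act_comp _ _)

theorem act_pull_comp {p q r : K} (u : p ⟶ q) (v : q ⟶ r) (y : K) :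
    act S (pull (u ≫ v) y) = act S (pull v y) ⋙ act S (pull u y) :=
  (congrArg (act S) (pull_comp u v y)).trans (act_comp _ _)

theorem act_pull_push {p q r s : K} (u : p ⟶ q) (v : r ⟶ s) :
    act S (pull u r) ⋙ act S (push (op p) v) = act S (push (op q) v) ⋙ act S (pull u s) :=
  (act_comp _ _).symm.trans ((congrArg (act S) (pull_push u v)).trans (act_comp _ _))

theorem act_push_comp_map (x : Kᵒᵖ) {p q r : K} (u : p ⟶ q) (v : q ⟶ r) {m n : S.obj (x, p)}
    (t : m ⟶ n) : (act S (push x (u ≫ v))).map t =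
      eqToHom (Functor.congr_obj (act_push_comp x u v) m) ≫
        (act S (push x v)).map ((act S (push x u)).map t) ≫
          eqToHom (Functor.congr_obj (act_push_comp x u v) n).symm :=
  Functor.congr_hom (act_push_comp x u v) t

theorem act_pull_comp_map {p q r : K} (u : p ⟶ q) (v : q ⟶ r) (y : K) {m n : S.obj (op r, y)}
    (t : m ⟶ n) : (act S (pull (u ≫ v) y)).map t =
      eqToHom (Functor.congr_obj (act_pull_comp u v y) m) ≫
        (act S (pull u y)).map ((act S (pull v y)).map t) ≫
          eqToHom (Functor.congr_obj (act_pull_comp u v y) n).symm :=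
  Functor.congr_hom (act_pull_comp u v y) t

theorem act_pull_push_map {p q r s : K} (u : p ⟶ q) (v : r ⟶ s) {m n : S.obj (op q, r)}
    (t : m ⟶ n) : (act S (push (op p) v)).map ((act S (pull u r)).map t) =
      eqToHom (Functor.congr_obj (act_pull_push u v) m) ≫
        (act S (pull u s)).map ((act S (push (op q) v)).map t) ≫
          eqToHom (Functor.congr_obj (act_pull_push u v) n).symm :=
  Functor.congr_hom (act_pull_push u v) t

theorem act₂_push₂_whiskerLeft (x : Kᵒᵖ) {p q r : K} (u : p ⟶ q) {v w : q ⟶ r} (α : v ⟶ w)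
    (m : S.obj (x, p)) : act₂ S (push₂ x (u ◁ α)) m =
      eqToHom (Functor.congr_obj (act_push_comp x u v) m) ≫
        act₂ S (push₂ x α) ((act S (push x u)).obj m) ≫
          eqToHom (Functor.congr_obj (act_push_comp x u w) m).symm := by
  have h : push₂ x (u ◁ α) ≍ push x u ◁ push₂ x α :=
    prod_hom₂_heq (push_comp x u v) (push_comp x u w)
      (whiskerLeft_id_heq (Strict.id_comp (𝟙 x))).symm HEq.rfl
  exact (conj_eqToHom_iff_heq' _ _ _ _).2
    ((act₂_heq (push_comp x u v) (push_comp x u w) h m).trans (act₂_whiskerLeft_heq _ _ m))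

theorem act₂_push₂_whiskerRight (x : Kᵒᵖ) {p q r : K} {u v : p ⟶ q} (α : u ⟶ v) (w : q ⟶ r)
    (m : S.obj (x, p)) : act₂ S (push₂ x (α ▷ w)) m =
      eqToHom (Functor.congr_obj (act_push_comp x u w) m) ≫
        (act S (push x w)).map (act₂ S (push₂ x α) m) ≫
          eqToHom (Functor.congr_obj (act_push_comp x v w) m).symm := by
  have h : push₂ x (α ▷ w) ≍ push₂ x α ▷ push x w :=
    prod_hom₂_heq (push_comp x u w) (push_comp x v w)
      (id_whiskerRight_heq (Strict.id_comp (𝟙 x))).symm HEq.rfl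
  exact (conj_eqToHom_iff_heq' _ _ _ _).2
    ((act₂_heq (push_comp x u w) (push_comp x v w) h m).trans (act₂_whiskerRight_heq _ _ m))

theorem act₂_pull₂_whiskerLeft {p q r : K} (u : p ⟶ q) {v w : q ⟶ r} (α : v ⟶ w) (y : K)
    (m : S.obj (op r, y)) : act₂ S (pull₂ (u ◁ α) y) m =
      eqToHom (Functor.congr_obj (act_pull_comp u v y) m) ≫
        (act S (pull u y)).map (act₂ S (pull₂ α y) m) ≫
          eqToHom (Functor.congr_obj (act_pull_comp u w y) m).symm := by
  have h : pull₂ (u ◁ α) y ≍ pull₂ α y ▷ pull u y :=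
    prod_hom₂_heq (pull_comp u v y) (pull_comp u w y)
      HEq.rfl (id_whiskerRight_heq (Strict.id_comp (𝟙 y))).symm
  exact (conj_eqToHom_iff_heq' _ _ _ _).2
    ((act₂_heq (pull_comp u v y) (pull_comp u w y) h m).trans (act₂_whiskerRight_heq _ _ m))

theorem act₂_pull₂_whiskerRight {p q r : K} {u v : p ⟶ q} (α : u ⟶ v) (w : q ⟶ r) (y : K)
    (m : S.obj (op r, y)) : act₂ S (pull₂ (α ▷ w) y) m =
      eqToHom (Functor.congr_obj (act_pull_comp u w y) m) ≫
        act₂ S (pull₂ α y) ((act S (pull w y)).obj m) ≫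
          eqToHom (Functor.congr_obj (act_pull_comp v w y) m).symm := by
  have h : pull₂ (α ▷ w) y ≍ pull w y ◁ pull₂ α y :=
    prod_hom₂_heq (pull_comp u w y) (pull_comp v w y)
      HEq.rfl (whiskerLeft_id_heq (Strict.id_comp (𝟙 y))).symm
  exact (conj_eqToHom_iff_heq' _ _ _ _).2
    ((act₂_heq (pull_comp u w y) (pull_comp v w y) h m).trans (act₂_whiskerLeft_heq _ _ m))

theorem act₂_push₂_pull {p q r s : K} (u : p ⟶ q) {v w : r ⟶ s} (α : v ⟶ w)
    (m : S.obj (op q, r)) : act₂ S (push₂ (op p) α) ((act S (pull u r)).obj m) =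
      eqToHom (Functor.congr_obj (act_pull_push u v) m) ≫
        (act S (pull u s)).map (act₂ S (push₂ (op q) α) m) ≫
          eqToHom (Functor.congr_obj (act_pull_push u w) m).symm := by
  have h : pull u r ◁ push₂ (op p) α ≍ push₂ (op q) α ▷ pull u s :=
    prod_hom₂_heq (pull_push u v) (pull_push u w)
      ((whiskerLeft_id_heq (Strict.comp_id u.op)).trans
        (id_whiskerRight_heq (Strict.id_comp u.op)).symm)
      ((id_whiskerLeft_heq α).trans (whiskerRight_id_heq α).symm)
  exact (conj_eqToHom_iff_heq' _ _ _ _).2 ((act₂_whiskerLeft_heq _ _ m).symm.trans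
    ((act₂_heq (pull_push u v) (pull_push u w) h m).trans (act₂_whiskerRight_heq _ _ m)))

theorem act_push_map_act₂_pull₂ {p q r s : K} {u v : p ⟶ q} (α : u ⟶ v) (w : r ⟶ s)
    (m : S.obj (op q, r)) : (act S (push (op p) w)).map (act₂ S (pull₂ α r) m) =
      eqToHom (Functor.congr_obj (act_pull_push u w) m) ≫
        act₂ S (pull₂ α s) ((act S (push (op q) w)).obj m) ≫
          eqToHom (Functor.congr_obj (act_pull_push v w) m).symm := by
  have h : pull₂ α r ▷ push (op p) w ≍ push (op q) w ◁ pull₂ α s :=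
    prod_hom₂_heq (pull_push u w) (pull_push v w)
      ((whiskerRight_id_heq (op2 α)).trans (id_whiskerLeft_heq (op2 α)).symm)
      ((id_whiskerRight_heq (Strict.id_comp w)).trans
        (whiskerLeft_id_heq (Strict.comp_id w)).symm)
  exact (conj_eqToHom_iff_heq' _ _ _ _).2 ((act₂_whiskerRight_heq _ _ m).symm.trans
    ((act₂_heq (pull_push u w) (pull_push v w) h m).trans (act₂_whiskerLeft_heq _ _ m)))

end PushPull

section WedgeCell
variable {K : Type u₁} [Bicategory.{w₁, v₁} K] [Strict K]
  {S : StrictPseudofunctor (Kᵒᵖ × K) Cat.{v₃, u₃}}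

/-- The type of the cells at the 1-cell `u` of the lax wedges to `S` with points `pt`. -/
abbrev WedgeCell (pt : ∀ p : K, S.obj (op p, p)) {p q : K} (u : p ⟶ q) :=
  (act S (push (op p) u)).obj (pt p) ⟶ (act S (pull u q)).obj (pt q)

namespace WedgeCell
variable {pt pt' pt'' : ∀ p : K, S.obj (op p, p)}

variable (pt) in
/-- The cell that the unit axiom of a lax wedge prescribes at an identity. -/
def id (p : K) : WedgeCell pt (𝟙 p) := eqToHom (push_pull_id p (pt p))

/-- The cell that the composition axiom of a lax wedge prescribes at a composite. -/
def comp {p q r : K} {u : p ⟶ q} {v : q ⟶ r} (σ : WedgeCell pt u) (τ : WedgeCell pt v) :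
    WedgeCell pt (u ≫ v) :=
  eqToHom (Functor.congr_obj (act_push_comp (op p) u v) (pt p)) ≫ (act S (push (op p) v)).map σ ≫
    eqToHom (Functor.congr_obj (act_pull_push u v) (pt q)) ≫ (act S (pull u r)).map τ ≫
      eqToHom (Functor.congr_obj (act_pull_comp u v r) (pt r)).symm

theorem comp_heq_comp {p q r : K} {u u' : p ⟶ q} {v v' : q ⟶ r} (hu : u = u') (hv : v = v')
    {σ : WedgeCell pt u} {σ' : WedgeCell pt u'} {τ : WedgeCell pt v} {τ' : WedgeCell pt v'}
    (hσ : σ ≍ σ') (hτ : τ ≍ τ') : σ.comp τ ≍ σ'.comp τ' := by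
  subst hu hv hσ hτ
  rfl

theorem id_comp_heq {p q : K} {u : p ⟶ q} (σ : WedgeCell pt u) : (id pt p).comp σ ≍ σ := by
  have hσ : (act S (pull (𝟙 p) q)).map σ ≍ σ := Functor.hcongr_hom (act_id _) σ
  simpa [comp, id, eqToHom_map] using hσ

theorem comp_id_heq {p q : K} {u : p ⟶ q} (σ : WedgeCell pt u) : σ.comp (id pt q) ≍ σ := by
  have hσ : (act S (push (op p) (𝟙 q))).map σ ≍ σ := Functor.hcongr_hom (act_id _) σ
  simpa [comp, id, eqToHom_map] using hσ

theorem assoc_heq {p q r s : K} {u : p ⟶ q} {v : q ⟶ r} {w : r ⟶ s} (σ : WedgeCell pt u)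
    (τ : WedgeCell pt v) (υ : WedgeCell pt w) : (σ.comp τ).comp υ ≍ σ.comp (τ.comp υ) := by
  refine (conj_eqToHom_iff_heq' _ _
    (congrArg (fun t => (act S (push (op p) t)).obj (pt p)) (Strict.assoc u v w))
    (congrArg (fun t => (act S (pull t s)).obj (pt s)) (Strict.assoc u v w)).symm).1 ?_
  simp [comp, act_push_comp_map, act_pull_comp_map, act_pull_push_map, eqToHom_map]

/-- The axiom of a lax wedge for the 2-cell `α`. -/
def Compat {p q : K} {u v : p ⟶ q} (α : u ⟶ v) (σ : WedgeCell pt u) (τ : WedgeCell pt v) : Prop :=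
  σ ≫ act₂ S (pull₂ α q) (pt q) = act₂ S (push₂ (op p) α) (pt p) ≫ τ

theorem compat_id_iff {p q : K} {u : p ⟶ q} {σ τ : WedgeCell pt u} :
    Compat (𝟙 u) σ τ ↔ σ = τ := by
  have hpull : act₂ S (pull₂ (𝟙 u) q) (pt q) = 𝟙 _ := act₂_id _ _
  have hpush : act₂ S (push₂ (op p) (𝟙 u)) (pt p) = 𝟙 _ := act₂_id _ _
  rw [Compat, hpull, hpush, Category.comp_id, Category.id_comp]

theorem Compat.heq {p q : K} {u v : p ⟶ q} (h : u = v) {σ : WedgeCell pt u} {τ : WedgeCell pt v}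
    (hστ : Compat (eqToHom h) σ τ) : σ ≍ τ := by
  subst h
  exact heq_of_eq (compat_id_iff.1 hστ)

theorem Compat.trans {p q : K} {u v w : p ⟶ q} {α : u ⟶ v} {β : v ⟶ w} {σ : WedgeCell pt u}
    {τ : WedgeCell pt v} {υ : WedgeCell pt w} (hα : Compat α σ τ) (hβ : Compat β τ υ) :
    Compat (α ≫ β) σ υ := by
  have hpull : pull₂ (α ≫ β) q = pull₂ α q ≫ pull₂ β q :=
    prod_hom₂_ext rfl (Category.id_comp (𝟙 (𝟙 q))).symm
  have hpush : push₂ (op p) (α ≫ β) = push₂ (op p) α ≫ push₂ (op p) β :=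
    prod_hom₂_ext (Category.id_comp (𝟙 (𝟙 (op p)))).symm rfl
  unfold Compat at *
  rw [hpull, hpush, act₂_comp, act₂_comp, reassoc_of% hα, hβ, Category.assoc]

theorem Compat.whiskerLeft {p q r : K} {u : p ⟶ q} (σ : WedgeCell pt u) {v w : q ⟶ r}
    {α : v ⟶ w} {τ : WedgeCell pt v} {υ : WedgeCell pt w} (h : Compat α τ υ) :
    Compat (u ◁ α) (σ.comp τ) (σ.comp υ) := by
  have hmap := congrArg (act S (pull u r)).map h
  have hnat := act₂_naturality (push₂ (op p) α) σ
  simp only [Functor.map_comp] at hmap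
  rw [act₂_push₂_pull] at hnat
  unfold Compat
  rw [act₂_pull₂_whiskerLeft, act₂_push₂_whiskerLeft]
  simp only [comp, Category.assoc, eqToHom_trans_assoc, eqToHom_refl, Category.id_comp,
    reassoc_of% hmap, ← reassoc_of% hnat]

theorem Compat.whiskerRight {p q r : K} {u v : p ⟶ q} {α : u ⟶ v} {σ : WedgeCell pt u}
    {τ : WedgeCell pt v} (h : Compat α σ τ) {w : q ⟶ r} (υ : WedgeCell pt w) :
    Compat (α ▷ w) (σ.comp υ) (τ.comp υ) := by
  have hmap := congrArg (act S (push (op p) w)).map h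
  have hnat := act₂_naturality (pull₂ α r) υ
  simp only [Functor.map_comp] at hmap
  rw [act_push_map_act₂_pull₂] at hmap
  unfold Compat
  rw [act₂_pull₂_whiskerRight, act₂_push₂_whiskerRight]
  simp only [comp, Category.assoc, eqToHom_trans_assoc, eqToHom_refl, Category.id_comp,
    reassoc_of% hnat, ← reassoc_of% hmap]

/-- The axiom, at a 1-cell, of a modification with components `t` between lax wedges. -/
def Comm (t : ∀ p, pt p ⟶ pt' p) {p q : K} {u : p ⟶ q} (σ : WedgeCell pt u)
    (τ : WedgeCell pt' u) : Prop :=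
  (act S (push (op p) u)).map (t p) ≫ τ = σ ≫ (act S (pull u q)).map (t q)

theorem Comm.refl {p q : K} {u : p ⟶ q} (σ : WedgeCell pt u) : Comm (fun p => 𝟙 (pt p)) σ σ := by
  simp [Comm]

theorem Comm.trans {t : ∀ p, pt p ⟶ pt' p} {t' : ∀ p, pt' p ⟶ pt'' p} {p q : K} {u : p ⟶ q}
    {σ : WedgeCell pt u} {τ : WedgeCell pt' u} {υ : WedgeCell pt'' u} (h : Comm t σ τ)
    (h' : Comm t' τ υ) : Comm (fun p => t p ≫ t' p) σ υ := by
  unfold Comm at *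
  rw [Functor.map_comp, Functor.map_comp, Category.assoc, h', reassoc_of% h]

theorem Comm.id (t : ∀ p, pt p ⟶ pt' p) (p : K) :
    Comm t (WedgeCell.id pt p) (WedgeCell.id pt' p) :=
  (Category.comp_id _).trans (Category.id_comp _).symm

theorem Comm.comp {t : ∀ p, pt p ⟶ pt' p} {p q r : K} {u : p ⟶ q} {v : q ⟶ r}
    {σ : WedgeCell pt u} {σ' : WedgeCell pt' u} {τ : WedgeCell pt v} {τ' : WedgeCell pt' v}
    (hσ : Comm t σ σ') (hτ : Comm t τ τ') : Comm t (σ.comp τ) (σ'.comp τ') := by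
  have hpush := congrArg (act S (push (op p) v)).map hσ
  have hpull := congrArg (act S (pull u r)).map hτ
  simp only [Functor.map_comp] at hpush hpull
  rw [act_pull_push_map] at hpush
  simp only [Comm, WedgeCell.comp, act_push_comp_map, act_pull_comp_map, Category.assoc,
    eqToHom_trans_assoc, eqToHom_refl, Category.id_comp, reassoc_of% hpush, reassoc_of% hpull]

end WedgeCell
end WedgeCell

namespace Gray
variable {X : Type u₁} [Bicategory.{w₁, v₁} X] {Y : Type u₂} [Bicategory.{w₂, v₂} Y]
  {P : FStr X} {Q : FStr Y}

/-- A lax wedge, with vertex the terminal category, on a Gray tensor product, presented by its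
cells at the generating 1-cells `(f, 1)` and `(1, g)`. -/
@[ext]
structure Wedge (S : StrictPseudofunctor ((Gray P Q)ᵒᵖ × Gray P Q) Cat.{v₃, u₃}) where
  pt (p : Gray P Q) : S.obj (op p, p)
  left {x x' : X} (f : x ⟶ x') (y : Y) : WedgeCell pt (inl P Q f y)
  right (x : X) {y y' : Y} (g : y ⟶ y') : WedgeCell pt (inr P Q x g)
  left_id (x : X) (y : Y) : left (𝟙 x) y ≍ WedgeCell.id pt ⟨x, y⟩
  left_comp {x x' x'' : X} (f : x ⟶ x') (f' : x' ⟶ x'') (y : Y) :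
    left (f ≫ f') y ≍ (left f y).comp (left f' y)
  right_id (x : X) (y : Y) : right x (𝟙 y) ≍ WedgeCell.id pt ⟨x, y⟩
  right_comp (x : X) {y y' y'' : Y} (g : y ⟶ y') (g' : y' ⟶ y'') :
    right x (g ≫ g') ≍ (right x g).comp (right x g')
  left_naturality {x x' : X} {f f' : x ⟶ x'} (α : f ⟶ f') (y : Y) :
    WedgeCell.Compat (inl₂ P Q α y) (left f y) (left f' y)
  right_naturality (x : X) {y y' : Y} {g g' : y ⟶ y'} (β : g ⟶ g') :
    WedgeCell.Compat (inr₂ P Q x β) (right x g) (right x g')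
  swap {x x' : X} (f : x ⟶ x') {y y' : Y} (g : y ⟶ y') :
    WedgeCell.Compat (gray P Q f g) ((left f y).comp (right x' g)) ((right x g).comp (left f y'))

namespace Wedge
variable {S : StrictPseudofunctor ((Gray P Q)ᵒᵖ × Gray P Q) Cat.{v₃, u₃}}

/-- A modification of lax wedges on a Gray tensor product that are presented by their cells at
the generating 1-cells. -/
@[ext]
structure Hom (W V : Wedge S) where
  app (p : Gray P Q) : W.pt p ⟶ V.pt p
  comm_left {x x' : X} (f : x ⟶ x') (y : Y) : WedgeCell.Comm app (W.left f y) (V.left f y)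
  comm_right (x : X) {y y' : Y} (g : y ⟶ y') : WedgeCell.Comm app (W.right x g) (V.right x g)

instance : Category (Wedge S) where
  Hom := Hom
  id _ :=
    { app _ := 𝟙 _
      comm_left _ _ := .refl _
      comm_right _ _ _ _ := .refl _ }
  comp s t :=
    { app p := s.app p ≫ t.app p
      comm_left f y := (s.comm_left f y).trans (t.comm_left f y)
      comm_right x _ _ g := (s.comm_right x g).trans (t.comm_right x g) }
  id_comp _ := Hom.ext (funext fun _ => Category.id_comp _)
  comp_id _ := Hom.ext (funext fun _ => Category.comp_id _)
  assoc _ _ _ := Hom.ext (funext fun _ => Category.assoc _ _ _)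

theorem conj_app {W W' V V' : Wedge S} (h : W' = W) (t : W ⟶ V) (h' : V = V') (p : Gray P Q) :
    Hom.app (eqToHom h ≫ t ≫ eqToHom h') p =
      eqToHom (congrArg (fun W => pt W p) h) ≫ Hom.app t p ≫
        eqToHom (congrArg (fun W => pt W p) h') := by
  subst h h'
  rfl

variable (W : Wedge S)

/-- The cell at a formal composite of generating 1-cells. -/
def pathCell : ∀ {p q : Gray P Q} (s : Path P Q p q), WedgeCell W.pt (Quot.mk PathRel s : p ⟶ q)
  | _, _, .nil p => WedgeCell.id W.pt p
  | _, _, .left f y => W.left f y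
  | _, _, .right x g => W.right x g
  | _, _, .comp s t => WedgeCell.comp (pathCell s) (pathCell t)

theorem pathCell_heq_of_pathRel {p q : Gray P Q} {s t : Path P Q p q} (h : PathRel s t) :
    W.pathCell s ≍ W.pathCell t := by
  induction h with
  | comp_left t h ih => exact WedgeCell.comp_heq_comp (Quot.sound h) rfl ih HEq.rfl
  | comp_right s h ih => exact WedgeCell.comp_heq_comp rfl (Quot.sound h) HEq.rfl ih
  | nil_comp s => exact WedgeCell.id_comp_heq _
  | comp_nil s => exact WedgeCell.comp_id_heq _
  | assoc f g h => exact WedgeCell.assoc_heq _ _ _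
  | left_id x y => exact W.left_id x y
  | left_comp f f' y => exact W.left_comp f f' y
  | right_id x y => exact W.right_id x y
  | right_comp x g g' => exact W.right_comp x g g'
  | tight f g h =>
    have hswap := W.swap f g
    rw [gray_tight P Q f g h] at hswap
    exact hswap.heq (inl_inr f g h)

/-- The cell at an arbitrary 1-cell, determined by the cells at the generators. -/
def cell {p q : Gray P Q} (s : p ⟶ q) : WedgeCell W.pt s :=
  Quot.hrecOn (motive := fun s : p ⟶ q => WedgeCell W.pt s) s W.pathCell
    fun _ _ h => W.pathCell_heq_of_pathRel h

theorem cell_comp {p q r : Gray P Q} (s : p ⟶ q) (t : q ⟶ r) :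
    W.cell (s ≫ t) = (W.cell s).comp (W.cell t) :=
  Quot.inductionOn s fun _ => Quot.inductionOn t fun _ => rfl

theorem compat_cell {p q : Gray P Q} {s t : p ⟶ q} (η : s ⟶ t) :
    WedgeCell.Compat η (W.cell s) (W.cell t) := by
  induction η using Quot.ind with | mk η
  induction η with
  | id s => exact WedgeCell.compat_id_iff.2 rfl
  | comp η θ hη hθ => exact hη.trans hθ
  | whiskerLeft f η ih =>
    have h := ih.whiskerLeft (W.cell f)
    rwa [← cell_comp, ← cell_comp] at h
  | whiskerRight η g ih =>
    have h := ih.whiskerRight (W.cell g)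
    rwa [← cell_comp, ← cell_comp] at h
  | left α y => exact W.left_naturality α y
  | right x β => exact W.right_naturality x β
  | sigma f g => exact W.swap f g

theorem comm_cell {W V : Wedge S} (t : W ⟶ V) {p q : Gray P Q} (s : p ⟶ q) :
    WedgeCell.Comm t.app (W.cell s) (V.cell s) := by
  induction s using Quot.ind with | mk s
  induction s with
  | nil p => exact .id _ p
  | left f y => exact t.comm_left f y
  | right x g => exact t.comm_right x g
  | comp s u hs hu => exact .comp hs hu

end Wedge
end Gray

namespace LaxEnd

section
variable {K : Type u₁} [Bicategory.{w₁, v₁} K] [Strict K]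
  {S : StrictPseudofunctor (Kᵒᵖ × K) Cat.{v₃, u₃}} (w : LaxEnd S)

theorem cell_heq_id {p : K} {u : p ⟶ p} (h : u = 𝟙 p) : w.cell u ≍ WedgeCell.id w.pt p := by
  subst h
  exact heq_of_eq (w.cell_id p)

theorem cell_heq_comp {p q r : K} {u : p ⟶ r} {v : p ⟶ q} {v' : q ⟶ r} (h : u = v ≫ v') :
    w.cell u ≍ WedgeCell.comp (pt := w.pt) (w.cell v) (w.cell v') := by
  subst h
  exact heq_of_eq (w.cell_comp v v')

theorem compat_comp_cell {p q q' r : K} {u : p ⟶ q} {v : q ⟶ r} {u' : p ⟶ q'} {v' : q' ⟶ r}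
    (α : u ≫ v ⟶ u' ≫ v') :
    WedgeCell.Compat α (WedgeCell.comp (pt := w.pt) (w.cell u) (w.cell v))
      (WedgeCell.comp (pt := w.pt) (w.cell u') (w.cell v')) := by
  have h : WedgeCell.Compat α (w.cell (u ≫ v)) (w.cell (u' ≫ v')) := w.cell_naturality α
  rwa [eq_of_heq (w.cell_heq_comp rfl), eq_of_heq (w.cell_heq_comp rfl)] at h

end

variable {X : Type u₁} [Bicategory.{w₁, v₁} X] {Y : Type u₂} [Bicategory.{w₂, v₂} Y]
  {P : FStr X} {Q : FStr Y} {S : StrictPseudofunctor ((Gray P Q)ᵒᵖ × Gray P Q) Cat.{v₃, u₃}}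

theorem ext_of_generators {w w' : LaxEnd S} (hpt : w.pt = w'.pt)
    (hl : ∀ {x x' : X} (f : x ⟶ x') (y : Y),
      w.cell (Gray.inl P Q f y) ≍ w'.cell (Gray.inl P Q f y))
    (hr : ∀ (x : X) {y y' : Y} (g : y ⟶ y'),
      w.cell (Gray.inr P Q x g) ≍ w'.cell (Gray.inr P Q x g)) : w = w' := by
  rcases w with ⟨pt, cell, cell_id, _, cell_comp⟩
  rcases w' with ⟨pt', cell', cell_id', _, cell_comp'⟩
  obtain rfl : pt = pt' := hpt
  suffices h : @cell = @cell' by subst h; rfl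
  funext p q s
  induction s using Quot.ind with | mk s
  induction s with
  | nil p => exact (cell_id p).trans (cell_id' p).symm
  | left f y => exact eq_of_heq (hl f y)
  | right x g => exact eq_of_heq (hr x g)
  | comp s t hs ht =>
    refine (cell_comp (Quot.mk _ s) (Quot.mk _ t)).trans
      (Eq.trans ?_ (cell_comp' (Quot.mk _ s) (Quot.mk _ t)).symm)
    rw [hs, ht]

variable (S) in
/-- Restriction of lax wedges on a Gray tensor product to the generating 1-cells. -/
def restrict : LaxEnd S ⥤ Gray.Wedge S where
  obj w :=
    { pt := w.pt
      left f y := w.cell (Gray.inl P Q f y)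
      right x _ _ g := w.cell (Gray.inr P Q x g)
      left_id x y := w.cell_heq_id (Gray.inl_id x y)
      left_comp f f' y := w.cell_heq_comp (Gray.inl_comp f f' y)
      right_id x y := w.cell_heq_id (Gray.inr_id x y)
      right_comp x _ _ _ g g' := w.cell_heq_comp (Gray.inr_comp x g g')
      left_naturality _ _ := w.cell_naturality _
      right_naturality _ _ _ _ _ _ := w.cell_naturality _
      swap _ _ _ _ := w.compat_comp_cell _ }
  map t :=
    { app := Hom.app t
      comm_left _ _ := Hom.comm t _
      comm_right _ _ _ _ := Hom.comm t _ }

variable (S) in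
/-- Extension of lax wedges on a Gray tensor product from the generating 1-cells. -/
def extend : Gray.Wedge S ⥤ LaxEnd S where
  obj W :=
    { pt := W.pt
      cell := W.cell
      cell_id _ := rfl
      cell_naturality := W.compat_cell
      cell_comp := W.cell_comp }
  map t :=
    { app := t.app
      comm := Gray.Wedge.comm_cell t }

theorem extend_obj_restrict_obj (w : LaxEnd S) : (extend S).obj ((restrict S).obj w) = w :=
  ext_of_generators rfl (fun _ _ => HEq.rfl) (fun _ _ _ _ => HEq.rfl)

variable (S) in
/-- A lax wedge on a Gray tensor product is the same as one presented by its cells at the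
generating 1-cells. -/
def restrictIso : Cat.of (LaxEnd S) ≅ Cat.of (Gray.Wedge S) where
  hom := (restrict S).toCatHom
  inv := (extend S).toCatHom
  hom_inv_id := congrArg Functor.toCatHom <|
    CategoryTheory.Functor.ext (F := restrict S ⋙ extend S) (G := 𝟭 _) extend_obj_restrict_obj
      fun _ _ t => hom_ext fun p => by
        refine Eq.trans ?_ (conj_app _ t _ p).symm
        exact (conj_eqToHom_refl _).symm
  inv_hom_id := rfl

end LaxEnd

section HEq

theorem comp_eq_comp_iff_of_heq {C : Type u₁} [Category.{v₁} C] {x y y' z w w' z' : C} {f : x ⟶ y}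
    {g : y ⟶ z} {h : x ⟶ w} {k : w ⟶ z} {f' : x ⟶ y'} {g' : y' ⟶ z'} {h' : x ⟶ w'} {k' : w' ⟶ z'}
    (hy : y = y') (hw : w = w') (hz : z = z') (hf : f ≍ f') (hg : g ≍ g') (hh : h ≍ h')
    (hk : k ≍ k') : f ≫ g = h ≫ k ↔ f' ≫ g' = h' ≫ k' := by
  subst hy hw hz hf hg hh hk
  rfl

theorem id_heq_id {C : Type u₁} [Category.{v₁} C] {x y : C} (h : x = y) : 𝟙 x ≍ 𝟙 y := by
  subst h
  rfl

theorem conj_map_comp_map_heq {C : Type u₁} [Category.{v₁} C] {D : Type u₂} [Category.{v₂} D]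
    {E : Type u₃} [Category.{v₃} E] {F : C ⥤ D} {G G' : E ⥤ D} (hG : G = G') {x y y' : C}
    {z w w' : E} {σ : x ⟶ y} {σ' : x ⟶ y'} {τ : z ⟶ w} {τ' : z ⟶ w'} (hy : y = y') (hw : w = w')
    (hσ : σ ≍ σ') (hτ : τ ≍ τ') {d d' e e' : D} (h₁ : d = F.obj x) (h₂ : F.obj y = G.obj z)
    (h₃ : G.obj w = e) (h₁' : d' = F.obj x) (h₂' : F.obj y' = G'.obj z) (h₃' : G'.obj w' = e') :
    eqToHom h₁ ≫ F.map σ ≫ eqToHom h₂ ≫ G.map τ ≫ eqToHom h₃ ≍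
      eqToHom h₁' ≫ F.map σ' ≫ eqToHom h₂' ≫ G'.map τ' ≫ eqToHom h₃' := by
  subst hG hy hw hσ hτ h₁ h₁' h₃ h₃'
  rfl

theorem comp_map_square_iff_of_heq {C : Type u₁} [Category.{v₁} C] {C' : Type u₂}
    [Category.{v₂} C'] {D : Type u₃} [Category.{v₃} D] {E E' : Type u₄} [Category.{v₄} E]
    [Category.{v₄} E'] {F : C ⥤ D} {G G' : E ⥤ D} {H : C' ⥤ D} {L L' : E' ⥤ D} (hG : G = G')
    (hL : L = L') {a b b' : C} {c d d' : E} {a₁ b₁ b₁' : C'} {c₁ d₁ d₁' : E'} {σ : a ⟶ b}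
    {σ' : a ⟶ b'} {τ : c ⟶ d} {τ' : c ⟶ d'} {ρ : a₁ ⟶ b₁} {ρ' : a₁ ⟶ b₁'} {υ : c₁ ⟶ d₁}
    {υ' : c₁ ⟶ d₁'} (hb : b = b') (hd : d = d') (hb₁ : b₁ = b₁') (hd₁ : d₁ = d₁') (hσ : σ ≍ σ')
    (hτ : τ ≍ τ') (hρ : ρ ≍ ρ') (hυ : υ ≍ υ') {s s' t k : D} {ν : F.obj a ⟶ H.obj a₁}
    {γ : s ⟶ s'} (hν : ν ≍ γ) (h₁ : F.obj b = G.obj c) (h₂ : G.obj d = L.obj d₁)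
    (h₃ : H.obj b₁ = L.obj c₁) (i₁ : s = F.obj a) (i₂ : F.obj b' = G'.obj c) (i₃ : G'.obj d' = t)
    (i₄ : t = k) (j₁ : s' = H.obj a₁) (j₂ : H.obj b₁' = L'.obj c₁) (j₃ : L'.obj d₁' = k) :
    F.map σ ≫ (eqToHom h₁ ≫ G.map τ ≫ eqToHom h₂) = (ν ≫ H.map ρ ≫ eqToHom h₃) ≫ L.map υ ↔
      (eqToHom i₁ ≫ F.map σ' ≫ eqToHom i₂ ≫ G'.map τ' ≫ eqToHom i₃) ≫ eqToHom i₄ =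
        γ ≫ eqToHom j₁ ≫ H.map ρ' ≫ eqToHom j₂ ≫ L'.map υ' ≫ eqToHom j₃ := by
  subst hG hL hb hd hb₁ hd₁ hσ hτ hρ hυ i₁ j₁ hν i₄ j₃
  simp only [eqToHom_refl, Category.id_comp, Category.comp_id, Category.assoc]

end HEq

section Restriction
variable {A : Type u₁} [Bicategory.{w₁, v₁} A] [Strict A]
  {B : Type u₂} [Bicategory.{w₂, v₂} B] [Strict B]
  {T : StrictPseudofunctor (Aᵒᵖ × Bᵒᵖ × LaxGray A B) Cat.{v₃, u₃}}

variable (T) in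
/-- The 2-functor `T (a, -, c, -)`. -/
abbrev partialEval (a c : A) : StrictPseudofunctor (Bᵒᵖ × B) Cat.{v₃, u₃} :=
  ((transpose T).obj (op a, c)).functor

theorem pull_inr_eq (a c : A) {y y' : B} (g : y ⟶ y') (z : B) :
    ((𝟙 (op a), g.op, Gray.inr _ _ c (𝟙 z)) :
      ((op a, op y', ⟨c, z⟩) : Aᵒᵖ × Bᵒᵖ × LaxGray A B) ⟶ (op a, op y, ⟨c, z⟩)) =
    (𝟙 (op a), g.op, 𝟙 _) :=
  Prod.ext rfl (Prod.ext rfl (Gray.inr_id c z))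

theorem pull_inl_eq {a a' : A} (f : a ⟶ a') (c : A) (y z : B) :
    ((f.op, 𝟙 (op y), Gray.inl _ _ (𝟙 c) z) :
      ((op a', op y, ⟨c, z⟩) : Aᵒᵖ × Bᵒᵖ × LaxGray A B) ⟶ (op a, op y, ⟨c, z⟩)) =
    (f.op, 𝟙 (op y), 𝟙 _) :=
  Prod.ext rfl (Prod.ext rfl (Gray.inl_id c z))

theorem act_pull_inr (a c : A) {y y' : B} (g : y ⟶ y') (z : B) :
    act (partialEval T a c) (pull g z) =
      act (twoVar T) (pull (Gray.inr (FStr.min A) (FStr.min B) a g) ⟨c, z⟩) :=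
  congrArg (act T) (pull_inr_eq a c g z)

theorem at'_pull_inl {a a' : A} (f : a ⟶ a') (c : A) (y z : B) :
    FunSL.at' ((transpose T).map (pull f c)) (op y, z) =
      act (twoVar T) (pull (Gray.inl (FStr.min A) (FStr.min B) f y) ⟨c, z⟩) :=
  congrArg (act T) (pull_inl_eq f c y z)

theorem act₂_pull₂_inr₂_heq (a c : A) {y y' : B} {g g' : y ⟶ y'} (β : g ⟶ g') (z : B)
    (m : (partialEval T a c).obj (op y', z)) :
    act₂ (partialEval T a c) (pull₂ β z) m ≍
      act₂ (twoVar T) (pull₂ (Gray.inr₂ (FStr.min A) (FStr.min B) a β) ⟨c, z⟩) m :=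
  act₂_heq (S := T) (pull_inr_eq a c g z) (pull_inr_eq a c g' z)
    (prod_hom₂_heq (pull_inr_eq a c g z) (pull_inr_eq a c g' z) HEq.rfl
      (prod_hom₂_heq (congrArg Prod.snd (pull_inr_eq a c g z))
        (congrArg Prod.snd (pull_inr_eq a c g' z)) HEq.rfl
        ((heq_of_eq (Gray.inr₂_id _ _ c (𝟙 z))).trans (id_heq_id (Gray.inr_id c z))))) m

theorem modApp_pull₂_inl₂_heq {a a' : A} {f f' : a ⟶ a'} (α : f ⟶ f') (c : A) (y z : B)
    (m : (partialEval T a' c).obj (op y, z)) :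
    FunSL.modApp ((transpose T).map₂ (pull₂ α c)) (op y, z) m ≍
      act₂ (twoVar T) (pull₂ (Gray.inl₂ (FStr.min A) (FStr.min B) α y) ⟨c, z⟩) m :=
  act₂_heq (S := T) (pull_inl_eq f c y z) (pull_inl_eq f' c y z)
    (prod_hom₂_heq (pull_inl_eq f c y z) (pull_inl_eq f' c y z) HEq.rfl
      (prod_hom₂_heq (congrArg Prod.snd (pull_inl_eq f c y z))
        (congrArg Prod.snd (pull_inl_eq f' c y z)) HEq.rfl
        ((heq_of_eq (Gray.inl₂_id _ _ (𝟙 c) z)).trans (id_heq_id (Gray.inl_id c z))))) m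

theorem nat_pull_eq_eqToHom {a a' : A} (f : a ⟶ a') (c : A) (y : B) {z z' : B} (g : z ⟶ z')
    (m : (partialEval T a' c).obj (op y, z)) :
    ∃ h, FunSL.nat ((transpose T).map (pull f c)) (push (op y) g) m = eqToHom h :=
  ⟨_, (congrArg (fun t => t.toNatTrans.app m)
    (Gray.mapGray_tight ((jFunctor Aᵒᵖ A Bᵒᵖ B).comp T) (pull f c) (push (op y) g)
      (.inl (LaxEnd.tight_pull f c)))).trans (Cat.eqToHom_app _ _ _ m)⟩

theorem nat_push_heq {a c c' : A} (f : c ⟶ c') {y z z' : B} (g : z ⟶ z')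
    (m : (partialEval T a c).obj (op y, z)) :
    FunSL.nat ((transpose T).map (push (op a) f)) (push (op y) g) m ≍
      act₂ (twoVar T)
        (push₂ (op (⟨a, y⟩ : LaxGray A B)) (Gray.gray (FStr.min A) (FStr.min B) f g)) m := by
  let JT := (jFunctor Aᵒᵖ A Bᵒᵖ B).comp T
  have hnat : FunSL.nat ((transpose T).map (push (op a) f)) (push (op y) g) m ≍
      act₂ JT (Gray.gray (FStr.fst Aᵒᵖ A) (FStr.fst Bᵒᵖ B) (push (op a) f) (push (op y) g)) m :=
    toNatTrans_app_heq (JT.map_comp _ _).symm (JT.map_comp _ _).symm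
      ((conj_eqToHom_iff_heq' _ _ (JT.map_comp _ _).symm (JT.map_comp _ _)).1 rfl) m
  have unit (s : (⟨c, z⟩ : LaxGray A B) ⟶ ⟨c', z'⟩) :
      ((𝟙 (op a) ≫ 𝟙 (op a), 𝟙 (op y) ≫ 𝟙 (op y), s) :
        ((op a, op y, ⟨c, z⟩) : Aᵒᵖ × Bᵒᵖ × LaxGray A B) ⟶ (op a, op y, ⟨c', z'⟩)) =
      (𝟙 (op a), 𝟙 (op y), s) :=
    Prod.ext (Strict.comp_id _) (Prod.ext (Strict.comp_id _) rfl)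
  exact hnat.trans (act₂_heq (S := T) (p := (op a, op y, ⟨c, z⟩)) (unit _) (unit _)
    (prod_hom₂_heq (unit _) (unit _) (id_heq_id (Strict.comp_id (𝟙 (op a))))
      (prod_hom₂_heq (congrArg Prod.snd (unit _)) (congrArg Prod.snd (unit _))
        (id_heq_id (Strict.comp_id (𝟙 (op y)))) HEq.rfl)) m)

theorem act₂_eqToHom {K : Type u₁} [Bicategory.{w₁, v₁} K]
    {S : StrictPseudofunctor K Cat.{v₃, u₃}} {p q : K} {u v : p ⟶ q} (h : u = v) (x : S.obj p) :
    act₂ S (eqToHom h) x = eqToHom (act_congr h x) := by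
  cases h
  exact act₂_id u x

theorem op2_eqToHom_prod {X : Type u₁} [Bicategory.{w₁, v₁} X] {Y : Type u₂}
    [Bicategory.{w₂, v₂} Y] {Z : Type u₃} [Bicategory.{w₃, v₃} Z] {a b : X} {f f' : a ⟶ b}
    {c d : Y} {g g' : c ⟶ d} {p q : Z} (s : p ⟶ q) (hf : f = f') (hg : g = g')
    (h : ((f.op, g.op, s) : ((op b, op d, p) : Xᵒᵖ × Yᵒᵖ × Z) ⟶ (op a, op c, q)) =
      (f'.op, g'.op, s)) :
    (op2 (eqToHom hf), op2 (eqToHom hg), 𝟙 s) = eqToHom h := by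
  cases hf
  cases hg
  rfl

theorem act₂_pull₂_gray_eq_eqToHom {a a' : A} (f : a ⟶ a') {y y' : B} (g : y ⟶ y')
    (p : LaxGray A B) (m : (twoVar T).obj (op ⟨a', y'⟩, p)) :
    ∃ h, act₂ (twoVar T) (pull₂ (Gray.gray (FStr.min A) (FStr.min B) f g) p) m = eqToHom h :=
  have hf := (Strict.comp_id f).trans (Strict.id_comp f).symm
  have hg := (Strict.id_comp g).trans (Strict.comp_id g).symm
  ⟨_, (congrArg (fun t => act₂ T t m) (op2_eqToHom_prod (𝟙 p) hf hg
    (Prod.ext (congrArg Quiver.Hom.op hf) (Prod.ext (congrArg Quiver.Hom.op hg) rfl)))).trans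
    (act₂_eqToHom (S := T) (p := (op a', op y', p)) _ m)⟩

section Cells
variable {pt : ∀ p : LaxGray A B, (twoVar T).obj (op p, p)}

variable (pt) in
/-- The type of the cells at `(f, 1)` that occur in the iterated lax end. -/
abbrev LeftCell {a a' : A} (f : a ⟶ a') (b : B) :=
  (FunSL.at' ((transpose T).map (push (op a) f)) (op b, b)).obj (pt ⟨a, b⟩) ⟶
    (FunSL.at' ((transpose T).map (pull f a')) (op b, b)).obj (pt ⟨a', b⟩)

variable (pt) in
/-- The type of the cells at `(1, g)` that occur in the iterated lax end. -/
abbrev RightCell (a : A) {b b' : B} (g : b ⟶ b') :=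
  (act (partialEval T a a) (push (op b) g)).obj (pt ⟨a, b⟩) ⟶
    (act (partialEval T a a) (pull g b')).obj (pt ⟨a, b'⟩)

/-- The cells at `(f, 1)` in the iterated and in the two-variable lax end correspond. -/
def leftEquiv {a a' : A} {f : a ⟶ a'} {b : B} :
    LeftCell pt f b ≃ WedgeCell pt (Gray.inl (FStr.min A) (FStr.min B) f b) :=
  Equiv.cast (congrArg (_ ⟶ ·) (Functor.congr_obj (at'_pull_inl f a' b b) (pt ⟨a', b⟩)))

/-- The cells at `(1, g)` in the iterated and in the two-variable lax end correspond. -/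
def rightEquiv {a : A} {b b' : B} {g : b ⟶ b'} :
    RightCell pt a g ≃ WedgeCell pt (Gray.inr (FStr.min A) (FStr.min B) a g) :=
  Equiv.cast (congrArg (_ ⟶ ·) (Functor.congr_obj (act_pull_inr a a g b') (pt ⟨a, b'⟩)))

theorem heq_leftEquiv {a a' : A} {f : a ⟶ a'} {b : B} (σ : LeftCell pt f b) : σ ≍ leftEquiv σ :=
  (cast_heq _ σ).symm

theorem heq_rightEquiv {a : A} {b b' : B} {g : b ⟶ b'} (σ : RightCell pt a g) :
    σ ≍ rightEquiv σ :=
  (cast_heq _ σ).symm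

theorem eqToHom_heq_wedgeCell_id {p : LaxGray A B} {u : p ⟶ p} (hu : u = 𝟙 p) {x}
    (h : (act (twoVar T) (push (op p) u)).obj (pt p) = x) : eqToHom h ≍ WedgeCell.id pt p := by
  subst hu
  subst h
  exact (eqToHom_heq_id_dom _ _ _).symm

theorem leftCell_id_iff {a : A} {b : B} (σ : LeftCell pt (𝟙 a) b) (h) :
    σ = eqToHom h ↔ leftEquiv σ ≍ WedgeCell.id pt ⟨a, b⟩ :=
  eq_iff_heq_of_heq (heq_leftEquiv σ) (eqToHom_heq_wedgeCell_id (Gray.inl_id a b) h)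

theorem rightCell_id_iff {a : A} {b : B} (σ : RightCell pt a (𝟙 b)) (h) :
    σ = eqToHom h ↔ rightEquiv σ ≍ WedgeCell.id pt ⟨a, b⟩ :=
  eq_iff_heq_of_heq (heq_rightEquiv σ) (eqToHom_heq_wedgeCell_id (Gray.inr_id a b) h)

theorem leftCell_naturality_iff {a a' : A} {f f' : a ⟶ a'} (α : f ⟶ f') {b : B}
    (σ : LeftCell pt f b) (τ : LeftCell pt f' b) :
    σ ≫ FunSL.modApp ((transpose T).map₂ (pull₂ α a')) (op b, b) (pt ⟨a', b⟩) =
        FunSL.modApp ((transpose T).map₂ (push₂ (op a) α)) (op b, b) (pt ⟨a, b⟩) ≫ τ ↔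
      WedgeCell.Compat (Gray.inl₂ (FStr.min A) (FStr.min B) α b) (leftEquiv σ) (leftEquiv τ) :=
  comp_eq_comp_iff_of_heq (Functor.congr_obj (at'_pull_inl f a' b b) _) rfl
    (Functor.congr_obj (at'_pull_inl f' a' b b) _) (heq_leftEquiv σ)
    (modApp_pull₂_inl₂_heq α a' b b _) HEq.rfl (heq_leftEquiv τ)

theorem rightCell_naturality_iff {a : A} {b b' : B} {g g' : b ⟶ b'} (β : g ⟶ g')
    (σ : RightCell pt a g) (τ : RightCell pt a g') :
    σ ≫ act₂ (partialEval T a a) (pull₂ β b') (pt ⟨a, b'⟩) =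
        act₂ (partialEval T a a) (push₂ (op b) β) (pt ⟨a, b⟩) ≫ τ ↔
      WedgeCell.Compat (Gray.inr₂ (FStr.min A) (FStr.min B) a β) (rightEquiv σ) (rightEquiv τ) :=
  comp_eq_comp_iff_of_heq (Functor.congr_obj (act_pull_inr a a g b') _) rfl
    (Functor.congr_obj (act_pull_inr a a g' b') _) (heq_rightEquiv σ)
    (act₂_pull₂_inr₂_heq a a β b' _) HEq.rfl (heq_rightEquiv τ)

theorem leftCell_comp_iff {a a' a'' : A} {b : B} {f : a ⟶ a'} {f' : a' ⟶ a''}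
    (σ : LeftCell pt f b) (τ : LeftCell pt f' b) (κ : LeftCell pt (f ≫ f') b) (h₁ h₂ h₃) :
    κ = eqToHom h₁ ≫ (FunSL.at' ((transpose T).map (push (op a) f')) (op b, b)).map σ ≫
        eqToHom h₂ ≫ (FunSL.at' ((transpose T).map (pull f a'')) (op b, b)).map τ ≫
          eqToHom h₃ ↔
      leftEquiv κ ≍ (leftEquiv σ).comp (leftEquiv τ) :=
  eq_iff_heq_of_heq (heq_leftEquiv κ) <|
    conj_map_comp_map_heq (at'_pull_inl f a'' b b)
      (Functor.congr_obj (at'_pull_inl f a' b b) _) (Functor.congr_obj (at'_pull_inl f' a'' b b) _)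
      (heq_leftEquiv σ) (heq_leftEquiv τ) _ _ _ _ _ _

theorem rightCell_comp_iff {a : A} {b b' b'' : B} {g : b ⟶ b'} {g' : b' ⟶ b''}
    (σ : RightCell pt a g) (τ : RightCell pt a g') (κ : RightCell pt a (g ≫ g')) (h₁ h₂ h₃) :
    κ = eqToHom h₁ ≫ (act (partialEval T a a) (push (op b) g')).map σ ≫ eqToHom h₂ ≫
        (act (partialEval T a a) (pull g b'')).map τ ≫ eqToHom h₃ ↔
      rightEquiv κ ≍ (rightEquiv σ).comp (rightEquiv τ) :=
  eq_iff_heq_of_heq (heq_rightEquiv κ) <|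
    conj_map_comp_map_heq (act_pull_inr a a g b'')
      (Functor.congr_obj (act_pull_inr a a g b') _) (Functor.congr_obj (act_pull_inr a a g' b'') _)
      (heq_rightEquiv σ) (heq_rightEquiv τ) _ _ _ _ _ _

theorem leftCell_comm_iff {pt' : ∀ p : LaxGray A B, (twoVar T).obj (op p, p)}
    (t : ∀ p, pt p ⟶ pt' p) {a a' : A} {f : a ⟶ a'} {b : B} (σ : LeftCell pt f b)
    (τ : LeftCell pt' f b) :
    (FunSL.at' ((transpose T).map (push (op a) f)) (op b, b)).map (t ⟨a, b⟩) ≫ τ =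
        σ ≫ (FunSL.at' ((transpose T).map (pull f a')) (op b, b)).map (t ⟨a', b⟩) ↔
      WedgeCell.Comm t (leftEquiv σ) (leftEquiv τ) :=
  comp_eq_comp_iff_of_heq rfl (Functor.congr_obj (at'_pull_inl f a' b b) _)
    (Functor.congr_obj (at'_pull_inl f a' b b) _) HEq.rfl (heq_leftEquiv τ) (heq_leftEquiv σ)
    (Functor.hcongr_hom (at'_pull_inl f a' b b) _)

theorem rightCell_comm_iff {pt' : ∀ p : LaxGray A B, (twoVar T).obj (op p, p)}
    (t : ∀ p, pt p ⟶ pt' p) {a : A} {b b' : B} {g : b ⟶ b'} (σ : RightCell pt a g)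
    (τ : RightCell pt' a g) :
    (act (partialEval T a a) (push (op b) g)).map (t ⟨a, b⟩) ≫ τ =
        σ ≫ (act (partialEval T a a) (pull g b')).map (t ⟨a, b'⟩) ↔
      WedgeCell.Comm t (rightEquiv σ) (rightEquiv τ) :=
  comp_eq_comp_iff_of_heq rfl (Functor.congr_obj (act_pull_inr a a g b') _)
    (Functor.congr_obj (act_pull_inr a a g b') _) HEq.rfl (heq_rightEquiv τ) (heq_rightEquiv σ)
    (Functor.hcongr_hom (act_pull_inr a a g b') _)

theorem swap_iff {a a' : A} {f : a ⟶ a'} {b b' : B} {g : b ⟶ b'} (σ : LeftCell pt f b)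
    (τ : RightCell pt a' g) (ρ : RightCell pt a g) (υ : LeftCell pt f b') (h₁ h₂) :
    (act (partialEval T a a') (push (op b) g)).map σ ≫
        (FunSL.nat ((transpose T).map (pull f a')) (push (op b) g) (pt ⟨a', b⟩) ≫
          (FunSL.at' ((transpose T).map (pull f a')) (op b, b')).map τ ≫ eqToHom h₁) =
      (FunSL.nat ((transpose T).map (push (op a) f)) (push (op b) g) (pt ⟨a, b⟩) ≫
          (FunSL.at' ((transpose T).map (push (op a) f)) (op b, b')).map ρ ≫ eqToHom h₂) ≫
        (act (partialEval T a a') (pull g b')).map υ ↔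
      WedgeCell.Compat (Gray.gray (FStr.min A) (FStr.min B) f g)
        ((leftEquiv σ).comp (rightEquiv τ)) ((rightEquiv ρ).comp (leftEquiv υ)) := by
  obtain ⟨_, hpull⟩ := nat_pull_eq_eqToHom f a' b g (pt ⟨a', b⟩)
  have hpush := nat_push_heq f g (pt ⟨a, b⟩)
  obtain ⟨_, hgray⟩ := act₂_pull₂_gray_eq_eqToHom f g ⟨a', b'⟩ (pt ⟨a', b'⟩)
  unfold WedgeCell.Compat WedgeCell.comp
  rw [hpull, hgray]
  exact comp_map_square_iff_of_heq (at'_pull_inl f a' b b') (act_pull_inr a a' g b')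
    (Functor.congr_obj (at'_pull_inl f a' b b) _) (Functor.congr_obj (act_pull_inr a' a' g b') _)
    (Functor.congr_obj (act_pull_inr a a g b') _) (Functor.congr_obj (at'_pull_inl f a' b' b') _)
    (heq_leftEquiv σ) (heq_rightEquiv τ) (heq_rightEquiv ρ) (heq_leftEquiv υ) hpush
    _ _ _ _ _ _ _ _ _ _

end Cells
end Restriction

namespace LaxEnd

theorem conj_comp_conj_app {K : Type u₁} [Bicategory.{w₁, v₁} K] [Strict K]
    {S : StrictPseudofunctor (Kᵒᵖ × K) Cat.{v₃, u₃}} {x y z w v u : LaxEnd S} (h : x = y)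
    (s : y ⟶ z) (h' : z = w) (t : w ⟶ v) (h'' : v = u) (a : K) :
    Hom.app (eqToHom h ≫ s ≫ eqToHom h' ≫ t ≫ eqToHom h'') a =
      eqToHom (congrArg (fun x => pt x a) h) ≫ Hom.app s a ≫
        eqToHom (congrArg (fun x => pt x a) h') ≫ Hom.app t a ≫
          eqToHom (congrArg (fun x => pt x a) h'') := by
  simp only [comp_app, eqToHom_app]

end LaxEnd

section Comparison
variable {A : Type u₁} [Bicategory.{w₁, v₁} A] [Strict A]
  {B : Type u₂} [Bicategory.{w₂, v₂} B] [Strict B]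
  {T : StrictPseudofunctor (Aᵒᵖ × Bᵒᵖ × LaxGray A B) Cat.{v₃, u₃}}

section ToWedge
variable {x y : LaxEnd (innerEnd T)}

variable (x) in
/-- The component at `a` of an object of the iterated lax end, as an object of the lax end
over `B`. -/
abbrev innerPt (a : A) : LaxEnd (partialEval T a a) := x.pt a

variable (x) in
/-- The component at `(a, b)` of an object of the iterated lax end. -/
abbrev iteratedPt (p : LaxGray A B) : (twoVar T).obj (op p, p) := (innerPt x p.fst).pt p.snd

variable (x) in
/-- The cell at `f` of an object of the iterated lax end, as a morphism of the lax end over `B`. -/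
abbrev innerCell {a a' : A} (f : a ⟶ a') :
    LaxEnd.mapObj ((transpose T).map (push (op a) f)) (innerPt x a) ⟶
      LaxEnd.mapObj ((transpose T).map (pull f a')) (innerPt x a') := x.cell f

variable (x) in
/-- The component at `b` of the cell at `f` of an object of the iterated lax end. -/
abbrev iteratedLeft {a a' : A} (f : a ⟶ a') (b : B) : LeftCell (iteratedPt x) f b :=
  LaxEnd.Hom.app (innerCell x f) b

variable (x) in
/-- The cell at `g` of the component at `a` of an object of the iterated lax end. -/
abbrev iteratedRight (a : A) {b b' : B} (g : b ⟶ b') : RightCell (iteratedPt x) a g :=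
  (innerPt x a).cell g

/-- The component at `a` of a morphism of the iterated lax end, as a morphism of the lax end
over `B`. -/
abbrev innerHom (t : x ⟶ y) (a : A) : innerPt x a ⟶ innerPt y a := LaxEnd.Hom.app t a

/-- The component at `(a, b)` of a morphism of the iterated lax end. -/
abbrev iteratedApp (t : x ⟶ y) (p : LaxGray A B) : iteratedPt x p ⟶ iteratedPt y p :=
  LaxEnd.Hom.app (innerHom t p.fst) p.snd

variable (x) in
/-- The lax wedge on the Gray tensor product given by an object of the iterated lax end. -/
def iteratedWedge : Gray.Wedge (twoVar T) where
  pt := iteratedPt x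
  left f b := leftEquiv (iteratedLeft x f b)
  right a _ _ g := rightEquiv (iteratedRight x a g)
  left_id a b := (leftCell_id_iff (iteratedLeft x (𝟙 a) b) _).1 <|
    (congrArg (fun s => LaxEnd.Hom.app s b) (x.cell_id a)).trans (LaxEnd.eqToHom_app _ b)
  left_comp f f' b :=
    (leftCell_comp_iff (iteratedLeft x f b) (iteratedLeft x f' b)
      (iteratedLeft x (f ≫ f') b) _ _ _).1 <|
      (congrArg (fun s => LaxEnd.Hom.app s b) (x.cell_comp f f')).trans
        (LaxEnd.conj_comp_conj_app _ _ _ _ _ b)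
  right_id a b := (rightCell_id_iff (iteratedRight x a (𝟙 b)) _).1 ((innerPt x a).cell_id b)
  right_comp a _ _ _ g g' :=
    (rightCell_comp_iff (iteratedRight x a g) (iteratedRight x a g')
      (iteratedRight x a (g ≫ g')) _ _ _).1 ((innerPt x a).cell_comp g g')
  left_naturality {_ _ f f'} α b :=
    (leftCell_naturality_iff α (iteratedLeft x f b) (iteratedLeft x f' b)).1 <|
      congrArg (fun s => LaxEnd.Hom.app s b) (x.cell_naturality α)
  right_naturality a _ _ g g' β :=
    (rightCell_naturality_iff β (iteratedRight x a g) (iteratedRight x a g')).1 <|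
      (innerPt x a).cell_naturality β
  swap {a a'} f {b b'} g :=
    (swap_iff (iteratedLeft x f b) (iteratedRight x a' g) (iteratedRight x a g)
      (iteratedLeft x f b') _ _).1 (LaxEnd.Hom.comm (innerCell x f) g)

variable (T) in
/-- The comparison functor from the iterated lax end to lax wedges on the Gray tensor product. -/
def toWedge : LaxEnd (innerEnd T) ⥤ Gray.Wedge (twoVar T) where
  obj := iteratedWedge
  map {x y} t :=
    { app := iteratedApp t
      comm_left f b :=
        (leftCell_comm_iff (iteratedApp t) (iteratedLeft x f b) (iteratedLeft y f b)).1 <|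
          congrArg (fun s => LaxEnd.Hom.app s b) (LaxEnd.Hom.comm t f)
      comm_right a _ _ g :=
        (rightCell_comm_iff (iteratedApp t) (iteratedRight x a g) (iteratedRight y a g)).1 <|
          LaxEnd.Hom.comm (innerHom t a) g }

end ToWedge

section OfWedge
variable {W V : Gray.Wedge (twoVar T)}

variable (W) in
/-- The restriction of a lax wedge on the Gray tensor product to `{a} × B`. -/
def wedgeInnerPt (a : A) : LaxEnd (partialEval T a a) where
  pt b := W.pt ⟨a, b⟩
  cell g := rightEquiv.symm (W.right a g)
  cell_id b := (rightCell_id_iff (rightEquiv.symm (W.right a (𝟙 b))) _).2 <| by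
    rw [Equiv.apply_symm_apply]
    exact W.right_id a b
  cell_naturality {b b' g g'} β :=
    (rightCell_naturality_iff β (rightEquiv.symm (W.right a g))
      (rightEquiv.symm (W.right a g'))).2 <| by
        rw [Equiv.apply_symm_apply, Equiv.apply_symm_apply]
        exact W.right_naturality a β
  cell_comp g g' :=
    (rightCell_comp_iff (rightEquiv.symm (W.right a g)) (rightEquiv.symm (W.right a g'))
      (rightEquiv.symm (W.right a (g ≫ g'))) _ _ _).2 <| by
        rw [Equiv.apply_symm_apply, Equiv.apply_symm_apply, Equiv.apply_symm_apply]
        exact W.right_comp a g g'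

variable (W) in
/-- The cells at `(f, 1)` of a lax wedge on the Gray tensor product, as a morphism of the lax end
over `B`. -/
def wedgeInnerCell {a a' : A} (f : a ⟶ a') :
    LaxEnd.mapObj ((transpose T).map (push (op a) f)) (wedgeInnerPt W a) ⟶
      LaxEnd.mapObj ((transpose T).map (pull f a')) (wedgeInnerPt W a') where
  app b := leftEquiv.symm (W.left f b)
  comm {b b'} g :=
    (swap_iff (leftEquiv.symm (W.left f b)) (rightEquiv.symm (W.right a' g))
      (rightEquiv.symm (W.right a g)) (leftEquiv.symm (W.left f b')) _ _).2 <| by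
        simp only [Equiv.apply_symm_apply]
        exact W.swap f g

variable (W) in
/-- The object of the iterated lax end given by a lax wedge on the Gray tensor product. -/
def wedgeIterated : LaxEnd (innerEnd T) where
  pt a := wedgeInnerPt W a
  cell f := wedgeInnerCell W f
  cell_id a := LaxEnd.hom_ext fun b => by
    refine Eq.trans ?_ (LaxEnd.eqToHom_app (T := partialEval T a a)
      (x := LaxEnd.mapObj ((transpose T).map (push (op a) (𝟙 a))) (wedgeInnerPt W a))
      (y := LaxEnd.mapObj ((transpose T).map (pull (𝟙 a) a)) (wedgeInnerPt W a)) _ b).symm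
    refine (leftCell_id_iff (leftEquiv.symm (W.left (𝟙 a) b)) _).2 ?_
    rw [Equiv.apply_symm_apply]
    exact W.left_id a b
  cell_naturality {a a' f f'} α := LaxEnd.hom_ext fun b =>
    (leftCell_naturality_iff α (leftEquiv.symm (W.left f b))
      (leftEquiv.symm (W.left f' b))).2 <| by
        rw [Equiv.apply_symm_apply, Equiv.apply_symm_apply]
        exact W.left_naturality α b
  cell_comp {a a' a''} f f' := LaxEnd.hom_ext fun b => by
    refine Eq.trans ?_ (LaxEnd.conj_comp_conj_app (S := partialEval T a a'') _
      ((LaxEnd.map ((transpose T).map (push (op a) f'))).map (wedgeInnerCell W f)) _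
      ((LaxEnd.map ((transpose T).map (pull f a''))).map (wedgeInnerCell W f')) _ b).symm
    refine (leftCell_comp_iff (leftEquiv.symm (W.left f b)) (leftEquiv.symm (W.left f' b))
      (leftEquiv.symm (W.left (f ≫ f') b)) _ _ _).2 ?_
    rw [Equiv.apply_symm_apply, Equiv.apply_symm_apply, Equiv.apply_symm_apply]
    exact W.left_comp f f' b

/-- The restriction of a modification of lax wedges on the Gray tensor product to `{a} × B`. -/
def wedgeInnerHom (t : W ⟶ V) (a : A) : wedgeInnerPt W a ⟶ wedgeInnerPt V a where
  app b := t.app ⟨a, b⟩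
  comm {b b'} g :=
    (rightCell_comm_iff t.app (rightEquiv.symm (W.right a g))
      (rightEquiv.symm (V.right a g))).2 <| by
        rw [Equiv.apply_symm_apply, Equiv.apply_symm_apply]
        exact t.comm_right a g

variable (T) in
/-- The comparison functor from lax wedges on the Gray tensor product to the iterated lax end. -/
def ofWedge : Gray.Wedge (twoVar T) ⥤ LaxEnd (innerEnd T) where
  obj := wedgeIterated
  map {W V} t :=
    { app := wedgeInnerHom t
      comm {a a'} f := LaxEnd.hom_ext fun b =>
        (leftCell_comm_iff t.app (leftEquiv.symm (W.left f b))
          (leftEquiv.symm (V.left f b))).2 <| by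
            rw [Equiv.apply_symm_apply, Equiv.apply_symm_apply]
            exact t.comm_left f b }

end OfWedge

theorem iteratedWedge_wedgeIterated (W : Gray.Wedge (twoVar T)) :
    iteratedWedge (wedgeIterated W) = W :=
  Gray.Wedge.ext rfl
    (heq_of_eq (by
      funext a a' f b
      exact leftEquiv.apply_symm_apply (W.left f b)))
    (heq_of_eq (by
      funext a b b' g
      exact rightEquiv.apply_symm_apply (W.right a g)))

theorem wedgeInnerPt_iteratedWedge (x : LaxEnd (innerEnd T)) (a : A) :
    wedgeInnerPt (iteratedWedge x) a = innerPt x a :=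
  LaxEnd.obj_ext (fun _ => rfl) fun g =>
    (rightEquiv.symm_apply_apply (iteratedRight x a g)).trans (conj_eqToHom_refl _).symm

theorem wedgeIterated_iteratedWedge (x : LaxEnd (innerEnd T)) :
    wedgeIterated (iteratedWedge x) = x := by
  refine LaxEnd.obj_ext (wedgeInnerPt_iteratedWedge x) fun {a a'} f => LaxEnd.hom_ext fun b => ?_
  refine Eq.trans ?_ (LaxEnd.conj_app (T := partialEval T a a') _ (innerCell x f) _ b).symm
  exact (leftEquiv.symm_apply_apply (iteratedLeft x f b)).trans (conj_eqToHom_refl _).symm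

theorem toWedge_ofWedge : toWedge T ⋙ ofWedge T = 𝟭 _ :=
  CategoryTheory.Functor.ext wedgeIterated_iteratedWedge fun x y t => LaxEnd.hom_ext fun a => by
    refine Eq.trans ?_ (LaxEnd.conj_app (T := innerEnd T) _ t _ a).symm
    refine LaxEnd.hom_ext fun b => (conj_eqToHom_refl _).symm.trans ?_
    exact (LaxEnd.conj_app (T := partialEval T a a) (wedgeInnerPt_iteratedWedge x a)
      (innerHom t a) (wedgeInnerPt_iteratedWedge y a).symm b).symm

theorem ofWedge_toWedge : ofWedge T ⋙ toWedge T = 𝟭 _ :=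
  CategoryTheory.Functor.ext iteratedWedge_wedgeIterated fun W V t => Gray.Wedge.Hom.ext <|
    funext fun p => by
      refine Eq.trans ?_ (Gray.Wedge.conj_app _ t _ p).symm
      exact (conj_eqToHom_refl _).symm

variable (T) in
/-- Lax wedges on the Gray tensor product, presented by their cells at the generating 1-cells,
are the objects of the iterated lax end. -/
def wedgeIso : Cat.of (Gray.Wedge (twoVar T)) ≅ Cat.of (LaxEnd (innerEnd T)) where
  hom := (ofWedge T).toCatHom
  inv := (toWedge T).toCatHom
  hom_inv_id := congrArg Functor.toCatHom ofWedge_toWedge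
  inv_hom_id := congrArg Functor.toCatHom toWedge_ofWedge

end Comparison

end LaxFubini

theorem mainTheorem11 {A : Type u₁} [Bicategory.{w₁, v₁} A] [Strict A]
    {B : Type u₂} [Bicategory.{w₂, v₂} B] [Strict B]
    (T : StrictPseudofunctor (Aᵒᵖ × Bᵒᵖ × LaxGray A B) Cat.{v₃, u₃}) :
    ∃ e : Cat.of (LaxEnd (twoVar T)) ≅ Cat.of (LaxEnd (innerEnd T)),
      ∀ (a : A) (b : B),
        e.hom.toFunctor ⋙ LaxEnd.proj (innerEnd T) a ⋙
          LaxEnd.proj ((transpose T).obj (op a, a)).functor b =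
        LaxEnd.proj (twoVar T) ⟨a, b⟩ :=
  ⟨LaxEnd.restrictIso (twoVar T) ≪≫ wedgeIso T, fun _ _ => rfl⟩
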